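/- **Model.** $n$ asynchronous processes $0,\dots,n-1$, any of which may stop (crash) at any time, communicate through shared registers. In one atomic step a process invokes an operation, applies one primitive to one register, or returns a response. Every register supports $\mathrm{Read}$, $\mathrm{LL}$ (which returns the value) and $\mathrm{SC}(v)$ (which writes $v$ and returns true if the register has not been changed since the last $\mathrm{LL}$ of the same process on it, and otherwise returns false and has no effect); an LL/SC-Write register also supports $\mathrm{Write}$. A snapshot object with $m$ components, all initially $NULL$, has the operations $UPDATE(j,v)$, which sets component $j$ to $v\ne NULL$, and $SCAN()$, which returns the vector of all components. **The algorithm $\lambda$-Snap** ($1\le\lambda\le n$, $m\ge 1$). Shared LL/SC registers: an integer $seq$; $values[j]$ with fields $(value, proposed, seq)$ for $0\le j<m$; $pre\_values[i][j]$ with fields $(value,seq)$ for $0\le i<\lambda$, $0\le j<m$. Shared LL/SC-Write registers: $s\_table[i]$ with fields $(seq, write\_enable)$ for $0\le i<\lambda$. Initially all values are $NULL$, all sequence numbers are $0$ and $write\_enable=0$. Every occurrence of a shared register in the code is a separate step. * $ApplyUpdate(j)$: $cur:=LL(values[j])$; $c:=seq$. For each $i=0,\dots,\lambda-1$, do twice: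 $LL(pre\_values[i][j])$; $cur:=values[j]$; if $cur.seq<s\_table[i].seq$ then $SC(pre\_values[i][j],(cur.value,cur.seq))$. Finally, if $cur.proposed\neq NULL$, then $SC(values[j],(cur.proposed,NULL,c))$. * $UPDATE(j,v)$: do at most twice: $cur:=LL(values[j])$; if $cur.proposed=NULL$ and $SC(values[j],(cur.value,v,cur.seq))$ succeeds, then $ApplyUpdate(j)$ and stop; otherwise $ApplyUpdate(j)$. * $SCAN()$, which only processes $p\in\{0,\dots,\lambda-1\}$ may invoke: write $(seq,1)$ to $s\_table[p]$. Do three times: $c:=LL(seq)$; for each $i=0,\dots,\lambda-1$: $t:=LL(s\_table[i])$, and if $t.seq<seq+2$ and $t.write\_enable=1$ then $SC(s\_table[i],(seq+2,0))$; then $SC(seq,c+1)$. After that, for each $j=0,\dots,m-1$: $ApplyUpdate(j)$; $v_1:=values[j]$; $v_2:=pre\_values[p][j]$; if $v_1.seq<s\_table[p].seq$ then $view[j]:=v_1.value$, else $view[j]:=v_2.value$. Return $view$. **Theorem 2.** $\lambda$-Snap is a wait-free linearizable implementation of a $\lambda$-scanner snapshot object with $m$ components: 1. (wait-free) every operation of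 a process that does not crash responds after finitely many steps of that process; 2. (linearizable) in every finite or infinite execution one can assign to every operation that responds, and to some of those that do not, a linearization point in its execution interval, so that the responses are those of the sequential execution of the snapshot object in the order of the points; 3. ($\lambda$-scanner) all processes may invoke $UPDATE$ on every component, $\lambda$ predefined processes may invoke $SCAN$, and at most $\lambda$ $SCAN$s are active in any configuration. Moreover there is an absolute constant $C$, independent of $n$, $\lambda$, $m$ and the set of values, such that $\lambda$-Snap uses at most $C\lambda m$ LL/SC(-Write) registers, every $UPDATE$ makes at most $C\lambda$ accesses to shared registers, and every $SCAN$ makes at most $C\lambda m$. -/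

import Mathlib

/-! ## Asynchronous shared memory: base objects, programs, implementations, executions -/

/-- The base objects of a system: a set of `LL/SC` registers, the set of values that each of them
stores, and which of them are `LL/SC-Write` registers, i.e. support `Write` as well.
(Every register can be read.) -/
structure BaseObjects where
  Reg : Type
  decEq : DecidableEq Reg
  Val : Reg → Type
  Writable : Reg → Prop

attribute [instance] BaseObjects.decEq

/-- Sequential code run by one process. Every constructor other than `ret` is one atomic primitive
applied to one base object; local computation is free. -/
inductive Prog (M : BaseObjects) (α : Type) : Type where
  | ret (a : α) : Prog M α
  | read (r : M.Reg) (k : M.Val r → Prog M α) : Prog M α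
  | ll (r : M.Reg) (k : M.Val r → Prog M α) : Prog M α
  | sc (r : M.Reg) (v : M.Val r) (k : Bool → Prog M α) : Prog M α
  | write (r : M.Reg) (h : M.Writable r) (v : M.Val r) (k : Prog M α) : Prog M α

namespace Prog

variable {M : BaseObjects}

/-- Sequential composition of code. -/
def bind {α β : Type} : Prog M α → (α → Prog M β) → Prog M β
  | ret a, f => f a
  | read r k, f => read r fun x => (k x).bind f
  | ll r k, f => ll r fun x => (k x).bind f
  | sc r v k, f => sc r v fun b => (k b).bind f
  | write r h v k, f => write r h v (k.bind f)

instance : Monad (Prog M) where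
  pure := ret
  bind := bind

/-- `Read(r)`. -/
def doRead (r : M.Reg) : Prog M (M.Val r) := read r ret

/-- `LL(r)`. -/
def doLL (r : M.Reg) : Prog M (M.Val r) := ll r ret

/-- `SC(r, v)`. -/
def doSC (r : M.Reg) (v : M.Val r) : Prog M Bool := sc r v ret

/-- `Write(r, v)`. -/
def doWrite (r : M.Reg) (h : M.Writable r) (v : M.Val r) : Prog M Unit := write r h v (ret ())

end Prog

/-- An implementation, for `n` processes, of a shared object with operations `Op` and responses
`Resp`: base objects with their initial values, which process may invoke which operation, and the
code of every operation. -/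
structure Implementation (n : ℕ) (Op Resp : Type) where
  base : BaseObjects
  initVal : ∀ r : base.Reg, base.Val r
  Permitted : Fin n → Op → Prop
  code : ∀ (p : Fin n) (o : Op), Permitted p o → Prog base Resp

/-- Steps of processes: an invocation, a primitive on a base object, or a response. -/
inductive Event (n : ℕ) (Op Resp : Type) : Type where
  | invoke (p : Fin n) (o : Op) : Event n Op Resp
  | access (p : Fin n) : Event n Op Resp
  | respond (p : Fin n) (r : Resp) : Event n Op Resp

/-- The process that takes a step. -/
def Event.proc {n : ℕ} {Op Resp : Type} : Event n Op Resp → Fin n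
  | .invoke p _ => p
  | .access p => p
  | .respond p _ => p

namespace Implementation

variable {n : ℕ} {Op Resp : Type}

/-- A configuration: the value `mem r` of every register `r`; the set `linked r` of the processes
`p` that have executed an `LL(r)` since which `r` was not changed; and the state of every process,
which is `none` if the process is idle, and otherwise holds its active operation together with the
code that remains to be executed. -/
structure Config (I : Implementation n Op Resp) where
  mem : ∀ r : I.base.Reg, I.base.Val r
  linked : I.base.Reg → Set (Fin n)
  proc : Fin n → Option (Op × Prog I.base Resp)

/-- The initial configuration. -/
def initial (I : Implementation n Op Resp) : I.Config where
  mem := I.initVal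
  linked := fun _ => ∅
  proc := fun _ => none

/-- `I.Step c e c'`: the step `e` can be taken in `c` and results in `c'`. -/
inductive Step (I : Implementation n Op Resp) : I.Config → Event n Op Resp → I.Config → Prop where
  | invoke (c : I.Config) (p : Fin n) (o : Op) (hp : I.Permitted p o) (h : c.proc p = none) :
      I.Step c (.invoke p o)
        { c with proc := Function.update c.proc p (some (o, I.code p o hp)) }
  | read (c : I.Config) (p : Fin n) (o : Op) (r : I.base.Reg)
      (k : I.base.Val r → Prog I.base Resp) (h : c.proc p = some (o, .read r k)) :
      I.Step c (.access p)
        { c with proc := Function.update c.proc p (some (o, k (c.mem r))) }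
  | ll (c : I.Config) (p : Fin n) (o : Op) (r : I.base.Reg)
      (k : I.base.Val r → Prog I.base Resp) (h : c.proc p = some (o, .ll r k)) :
      I.Step c (.access p)
        { c with
          linked := Function.update c.linked r (insert p (c.linked r))
          proc := Function.update c.proc p (some (o, k (c.mem r))) }
  | scSuccess (c : I.Config) (p : Fin n) (o : Op) (r : I.base.Reg) (v : I.base.Val r)
      (k : Bool → Prog I.base Resp) (h : c.proc p = some (o, .sc r v k)) (hl : p ∈ c.linked r) :
      I.Step c (.access p)
        { mem := Function.update c.mem r v
          linked := Function.update c.linked r ∅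
          proc := Function.update c.proc p (some (o, k true)) }
  | scFailure (c : I.Config) (p : Fin n) (o : Op) (r : I.base.Reg) (v : I.base.Val r)
      (k : Bool → Prog I.base Resp) (h : c.proc p = some (o, .sc r v k)) (hl : p ∉ c.linked r) :
      I.Step c (.access p)
        { c with proc := Function.update c.proc p (some (o, k false)) }
  | write (c : I.Config) (p : Fin n) (o : Op) (r : I.base.Reg) (hw : I.base.Writable r)
      (v : I.base.Val r) (k : Prog I.base Resp) (h : c.proc p = some (o, .write r hw v k)) :
      I.Step c (.access p)
        { mem := Function.update c.mem r v
          linked := Function.update c.linked r ∅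
          proc := Function.update c.proc p (some (o, k)) }
  | respond (c : I.Config) (p : Fin n) (o : Op) (a : Resp) (h : c.proc p = some (o, .ret a)) :
      I.Step c (.respond p a) { c with proc := Function.update c.proc p none }

/-- A finite or infinite execution with `len` steps. Step number `t` (for `t < len`) is `ev t`; it
leads from configuration `conf t` to configuration `conf (t + 1)`. Later entries are irrelevant. -/
structure Execution (I : Implementation n Op Resp) where
  len : ℕ∞
  conf : ℕ → I.Config
  ev : ℕ → Event n Op Resp
  start : conf 0 = I.initial
  step : ∀ t : ℕ, (t : ℕ∞) < len → I.Step (conf t) (ev t) (conf (t + 1))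

namespace Execution

variable {I : Implementation n Op Resp}

/-- Step `t` is the invocation of `o` by `p`. Operations of an execution (instances of elements of
`Op`) are identified by the number of their invocation step. -/
def Invokes (a : I.Execution) (t : ℕ) (p : Fin n) (o : Op) : Prop :=
  (t : ℕ∞) < a.len ∧ a.ev t = .invoke p o

/-- The operation that `p` invoked at step `t` responds with `r` at step `l`. -/
def Responds (a : I.Execution) (t : ℕ) (p : Fin n) (l : ℕ) (r : Resp) : Prop :=
  t < l ∧ (l : ℕ∞) < a.len ∧ a.ev l = .respond p r ∧
    ∀ u, t < u → u < l → ∀ r', a.ev u ≠ .respond p r'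

/-- The steps that access base objects on behalf of the operation that `p` invoked at step `t`. -/
def accesses (a : I.Execution) (t : ℕ) (p : Fin n) : Set ℕ :=
  {u | t < u ∧ (u : ℕ∞) < a.len ∧ a.ev u = .access p ∧
    ∀ w, t < w → w < u → ∀ r', a.ev w ≠ .respond p r'}

end Execution

/-- Wait-freedom: a process with an active operation can always take a step, whatever the others
do, and every operation of a process that does not stop taking steps responds. -/
def WaitFree (I : Implementation n Op Resp) : Prop :=
  ∀ a : I.Execution,
    (∀ (t : ℕ) (p : Fin n), (t : ℕ∞) ≤ a.len → (a.conf t).proc p ≠ none →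
      ∃ (e : Event n Op Resp) (c : I.Config), e.proc = p ∧ I.Step (a.conf t) e c) ∧
    ∀ (t : ℕ) (p : Fin n) (o : Op), a.Invokes t p o →
      {u : ℕ | (u : ℕ∞) < a.len ∧ (a.ev u).proc = p}.Infinite →
      ∃ l r, a.Responds t p l r

/-- Step complexity of the operation `o`: the supremum, over all instances of `o` in all executions,
of the number of accesses to base objects that the instance makes. -/
noncomputable def stepComplexity (I : Implementation n Op Resp) (o : Op) : ℕ∞ :=
  ⨆ (a : I.Execution) (t : ℕ) (p : Fin n) (_ : a.Invokes t p o), (a.accesses t p).encard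

end Implementation

/-! ## Linearizability -/

/-- A sequential object: its states, its initial state, and the effect and response of every
operation in every state. -/
structure SeqObject (Op Resp : Type) where
  State : Type
  init : State
  apply : State → Op → State × Resp

namespace Implementation

variable {n : ℕ} {Op Resp : Type}

/-- A linearization of the execution `a`: a sequential execution of `S` with `size` operations, in
which the `k`-th operation is the one that is invoked at step `inv k` of `a`. It contains every
operation of `a` that responds, with the same response, and possibly some that do not. Operation
`k` has as its linearization point the configuration `point k` of `a`, which lies in its execution
interval, and the operations are performed in the order of their linearization points. -/
structure Linearization {I : Implementation n Op Resp} (a : I.Execution) (S : SeqObject Op Resp)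
    where
  size : ℕ∞
  inv : ℕ → ℕ
  state : ℕ → S.State
  point : ℕ → ℕ
  invoked : ∀ k : ℕ, (k : ℕ∞) < size → ∃ p o, a.Invokes (inv k) p o
  injective : ∀ k k' : ℕ, (k : ℕ∞) < size → (k' : ℕ∞) < size → inv k = inv k' → k = k'
  complete : ∀ t p o l r, a.Invokes t p o → a.Responds t p l r →
    ∃ k : ℕ, (k : ℕ∞) < size ∧ inv k = t
  state_zero : state 0 = S.init
  state_succ : ∀ k : ℕ, (k : ℕ∞) < size → ∀ p o, a.Invokes (inv k) p o →
    state (k + 1) = (S.apply (state k) o).1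
  response : ∀ k : ℕ, (k : ℕ∞) < size → ∀ p o, a.Invokes (inv k) p o →
    ∀ l r, a.Responds (inv k) p l r → r = (S.apply (state k) o).2
  after_invocation : ∀ k : ℕ, (k : ℕ∞) < size → inv k + 1 ≤ point k
  point_le_len : ∀ k : ℕ, (k : ℕ∞) < size → (point k : ℕ∞) ≤ a.len
  before_response : ∀ k : ℕ, (k : ℕ∞) < size → ∀ p o, a.Invokes (inv k) p o →
    ∀ l r, a.Responds (inv k) p l r → point k ≤ l + 1
  ordered : ∀ k k' : ℕ, k ≤ k' → (k' : ℕ∞) < size → point k ≤ point k'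

/-- All executions of `I` are linearizable with respect to `S`. -/
def Linearizable (I : Implementation n Op Resp) (S : SeqObject Op Resp) : Prop :=
  ∀ a : I.Execution, Nonempty (Linearization a S)

end Implementation

/-! ## Snapshot objects -/

/-- The operations of a snapshot object with `m` components. -/
inductive SnapOp (m : ℕ) (V : Type) : Type where
  | update (j : Fin m) (v : V) : SnapOp m V
  | scan : SnapOp m V

/-- Responses: an `UPDATE` returns nothing, a `SCAN` returns a vector of `m` values, where `none`
is `NULL`. -/
inductive SnapResp (m : ℕ) (V : Type) : Type where
  | ack : SnapResp m V
  | view (x : Fin m → Option V) : SnapResp m V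

/-- The sequential snapshot object with `m` components, which hold `NULL` initially. -/
def snapshot (m : ℕ) (V : Type) : SeqObject (SnapOp m V) (SnapResp m V) where
  State := Fin m → Option V
  init := fun _ => none
  apply := fun s o => match o with
    | .update j v => (Function.update s j (some v), .ack)
    | .scan => (s, .view s)

/-- A `lam`-scanner snapshot implementation: every process may `UPDATE` every component, `lam` of
the processes may `SCAN`, and there are never more than `lam` active `SCAN` operations. -/
def Implementation.IsScanner {n m : ℕ} {V : Type}
    (I : Implementation n (SnapOp m V) (SnapResp m V)) (lam : ℕ) : Prop :=
  (∀ p j v, I.Permitted p (.update j v)) ∧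
  {p | I.Permitted p .scan}.encard = lam ∧
  ∀ (a : I.Execution) (t : ℕ), (t : ℕ∞) ≤ a.len →
    {p | ∃ k, (a.conf t).proc p = some (.scan, k)}.encard ≤ lam

/-! ## The algorithm λ-Snap -/

namespace LSnap

/-- Contents of `values[j]`. -/
structure ValueStruct (V : Type) where
  value : Option V
  proposed : Option V
  seq : ℕ

/-- Contents of `pre_values[i][j]`. -/
structure PreValueStruct (V : Type) where
  value : Option V
  seq : ℕ

/-- Contents of `s_table[i]`. -/
structure ScanStruct where
  seq : ℕ
  writeEnable : Bool

/-- The shared registers. -/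
inductive Reg (lam m : ℕ) : Type where
  | seq : Reg lam m
  | values (j : Fin m) : Reg lam m
  | preValues (i : Fin lam) (j : Fin m) : Reg lam m
  | sTable (i : Fin lam) : Reg lam m
  deriving DecidableEq

/-- What the registers store. -/
abbrev Val {lam m : ℕ} (V : Type) : Reg lam m → Type
  | .seq => ℕ
  | .values _ => ValueStruct V
  | .preValues _ _ => PreValueStruct V
  | .sTable _ => ScanStruct

/-- Only the registers `s_table[i]` support `Write`. -/
abbrev Writable {lam m : ℕ} : Reg lam m → Prop
  | .sTable _ => True
  | _ => False

/-- The base objects of λ-Snap. -/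
abbrev base (lam m : ℕ) (V : Type) : BaseObjects where
  Reg := Reg lam m
  decEq := inferInstance
  Val := Val V
  Writable := Writable

/-- Initial values (a sequence number `NULL` is `0`). -/
def initVal {lam m : ℕ} (V : Type) : ∀ r : Reg lam m, Val V r
  | .seq => (0 : ℕ)
  | .values _ => ValueStruct.mk none none 0
  | .preValues _ _ => PreValueStruct.mk none 0
  | .sTable _ => ScanStruct.mk 0 false

variable {lam m : ℕ} {V : Type}

/-- Code of λ-Snap. -/
abbrev Code (lam m : ℕ) (V : Type) (α : Type) : Type := Prog (base lam m V) α

/-- One round of `ApplyUpdate(j)` for the scanner `i`: try to save the value of component `j` in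
`pre_values[i][j]`. It returns what was read from `values[j]`. -/
def saveRound (i : Fin lam) (j : Fin m) : Code lam m V (ValueStruct V) := do
  let _ ← Prog.doLL (M := base lam m V) (.preValues i j)
  let cur : ValueStruct V ← Prog.doRead (M := base lam m V) (.values j)
  let st : ScanStruct ← Prog.doRead (M := base lam m V) (.sTable i)
  if cur.seq < st.seq then
    let _ ← Prog.doSC (M := base lam m V) (.preValues i j) (PreValueStruct.mk cur.value cur.seq)
    pure cur
  else
    pure cur

/-- `ApplyUpdate(j)`. -/
def applyUpdate (j : Fin m) : Code lam m V Unit := do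
  let cur₀ : ValueStruct V ← Prog.doLL (M := base lam m V) (.values j)
  let curSeq : ℕ ← Prog.doRead (M := base lam m V) .seq
  let cur : ValueStruct V ← (List.finRange lam).foldlM
    (fun _ i => do
      let _ ← saveRound i j
      saveRound i j)
    cur₀
  match cur.proposed with
  | none => pure ()
  | some v => do
      let _ ← Prog.doSC (M := base lam m V) (.values j) (ValueStruct.mk (some v) none curSeq)
      pure ()

/-- At most `k` iterations of the main loop of `UPDATE(j, v)`. -/
def updateLoop (j : Fin m) (v : V) : ℕ → Code lam m V Unit
  | 0 => pure ()
  | k + 1 => do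
      let cur : ValueStruct V ← Prog.doLL (M := base lam m V) (.values j)
      match cur.proposed with
      | none => do
          let ok ← Prog.doSC (M := base lam m V) (.values j)
            (ValueStruct.mk cur.value (some v) cur.seq)
          if ok then
            applyUpdate j
          else do
            applyUpdate j
            updateLoop j v k
      | some _ => do
          applyUpdate j
          updateLoop j v k

/-- `UPDATE(j, v)`. -/
def update (j : Fin m) (v : V) : Code lam m V (SnapResp m V) := do
  updateLoop j v 2
  pure .ack

/-- `SCAN`: try to assign a sequence number to the `SCAN` of the scanner `i`, if there is one that
still needs it. -/
def helpScanner (i : Fin lam) : Code lam m V Unit := do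
  let cur : ScanStruct ← Prog.doLL (M := base lam m V) (.sTable i)
  let s : ℕ ← Prog.doRead (M := base lam m V) .seq
  if cur.seq < s + 2 ∧ cur.writeEnable = true then
    let s' : ℕ ← Prog.doRead (M := base lam m V) .seq
    let _ ← Prog.doSC (M := base lam m V) (.sTable i) (ScanStruct.mk (s' + 2) false)
    pure ()
  else
    pure ()

/-- `SCAN`: one iteration of the protocol that assigns sequence numbers and increments `seq`. -/
def seqRound : Code lam m V Unit := do
  let curSeq : ℕ ← Prog.doLL (M := base lam m V) .seq
  (List.finRange lam).forM helpScanner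
  let _ ← Prog.doSC (M := base lam m V) .seq (curSeq + 1 : ℕ)
  pure ()

/-- `SCAN` by the scanner `i`: determine the value of component `j`. -/
def collect (i : Fin lam) (j : Fin m) : Code lam m V (Option V) := do
  applyUpdate j
  let v₁ : ValueStruct V ← Prog.doRead (M := base lam m V) (.values j)
  let v₂ : PreValueStruct V ← Prog.doRead (M := base lam m V) (.preValues i j)
  let st : ScanStruct ← Prog.doRead (M := base lam m V) (.sTable i)
  pure (if v₁.seq < st.seq then v₁.value else v₂.value)

/-- `SCAN()` by the process with identifier `i`. -/
def scan (i : Fin lam) : Code lam m V (SnapResp m V) := do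
  let s : ℕ ← Prog.doRead (M := base lam m V) .seq
  Prog.doWrite (M := base lam m V) (.sTable i) trivial (ScanStruct.mk s true)
  seqRound
  seqRound
  seqRound
  let view : Fin m → Option V ← (List.finRange m).foldlM
    (fun view j => do
      let x ← collect i j
      pure (Function.update view j x))
    (fun _ => none)
  pure (.view view)

/-- λ-Snap for `n` processes `0, …, n - 1`, of which `0, …, lam - 1` are the scanners. -/
def impl (n lam m : ℕ) (V : Type) : Implementation n (SnapOp m V) (SnapResp m V) where
  base := base lam m V
  initVal := initVal V
  Permitted := fun p o => match o with
    | .update _ _ => True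
    | .scan => p.val < lam
  code := fun p o => match o with
    | .update j v => fun _ => update j v
    | .scan => fun h => scan ⟨p.val, h⟩

end LSnap

/-! ## Primitives, and properties of code -/

/-! The argument rests on one consequence of the `LL`/`SC` semantics: if an `SC` succeeds, its
register was still since the `LL`; if it fails, somebody changed the register in between. Either way
the register changes by the time of the `SC`, which is why helping works.

An `UPDATE` takes effect in two stages: an `SC` places a proposal in `values[j]`, and the `SC` of
some `ApplyUpdate` installs it at a step `α`, tagged with the number read from `seq` at a step `τ`
between `LL` and `SC`. It is linearized at `τ`. Since `values[j]` is still from that `LL` to `α`,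
every earlier change of `values[j]`, in particular the proposal, precedes `τ` (`Applies.lt_of_mod`).
So the `τ`s of one component are ordered like its `α`s, and the tags never decrease. A complete
`ApplyUpdate` does not leave a pending proposal in place (`exists_applies`), so `α` comes before the
proposer responds. An `UPDATE` that fails twice to propose sees another update of the same component
commit during its interval (`exists_applies_of_failedRound`), and is linearized immediately before
it, as an overwritten update.

A `SCAN` by `i` enables `s_table[i]`, and a helper assigns it the number `k = seq + 2`. The offset 2
guarantees that `seq` has not reached `k` when the assignment takes place: the round of increments
leading to `k` starts after the helper read `seq` and would itself have served `i`
(`Assigns.seq_lt`). The first of the three rounds forces the assignment and the other two drive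
`seq` up to `k`; the `SCAN` is linearized at the step `P` where `seq` becomes `k`
(`exists_scan_point`). An applied update then has a tag below `k` exactly if its `τ` is at most `P`,
so the `SCAN` must return, for each component, the last value with a tag below `k`. If `values[j]`
holds a tag below `k` after the scanner's own `ApplyUpdate`, no later application can commit before
`P`. Otherwise the first application with a tag at least `k` saved the overwritten value in
`pre_values[i][j]` beforehand; two attempts are made so that one uses a sufficiently recent link,
and later saves store the same value (`collects_eq`).

The operations are sorted by linearization point, ties being broken as overwritten updates,
overwriting update, scans (`linearizable`). Wait-freedom and the complexity bounds follow from a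
syntactic bound `CostLE` on the code. To separate the two sides, an execution is turned into a
`History` of register changes, and the code into statements about the timing of one process's
primitives. -/

/-- A primitive together with the register it is applied to and its argument. -/
inductive Act (M : BaseObjects) : Type where
  | read (r : M.Reg)
  | ll (r : M.Reg)
  | sc (r : M.Reg) (v : M.Val r)
  | write (r : M.Reg) (v : M.Val r)

namespace Prog

variable {M : BaseObjects} {α β : Type}

/-- The primitive that the code applies next. -/
def head : Prog M α → Option (Act M)
  | ret _ => none
  | read r _ => some (.read r)
  | ll r _ => some (.ll r)
  | sc r v _ => some (.sc r v)
  | write r _ v _ => some (.write r v)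

/-- Every primitive that the code may ever apply satisfies `P`. -/
def All (P : Act M → Prop) : Prog M α → Prop
  | ret _ => True
  | read r k => P (.read r) ∧ ∀ x, (k x).All P
  | ll r k => P (.ll r) ∧ ∀ x, (k x).All P
  | sc r v k => P (.sc r v) ∧ ∀ x, (k x).All P
  | write r _ v k => P (.write r v) ∧ k.All P

/-- The code applies at most `N` primitives. -/
def CostLE : Prog M α → ℕ → Prop
  | ret _, _ => True
  | read _ k, N => ∃ N', N' + 1 ≤ N ∧ ∀ x, (k x).CostLE N'
  | ll _ k, N => ∃ N', N' + 1 ≤ N ∧ ∀ x, (k x).CostLE N'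
  | sc _ _ k, N => ∃ N', N' + 1 ≤ N ∧ ∀ x, (k x).CostLE N'
  | write _ _ _ k, N => ∃ N', N' + 1 ≤ N ∧ k.CostLE N'

/-! ### Composition rules for the two predicates on code -/

theorem All.bind {P : Act M → Prop} {A : Prog M α} {K : α → Prog M β} (hA : A.All P)
    (hK : ∀ x, (K x).All P) : (A.bind K).All P := by
  induction A with
  | ret a => exact hK a
  | read r k ih => exact ⟨hA.1, fun x => ih x (hA.2 x)⟩
  | ll r k ih => exact ⟨hA.1, fun x => ih x (hA.2 x)⟩
  | sc r v k ih => exact ⟨hA.1, fun x => ih x (hA.2 x)⟩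
  | write r h v k ih => exact ⟨hA.1, ih hA.2⟩

theorem All.andThen {P : Act M → Prop} {A : Prog M α} {K : α → Prog M β} (hA : A.All P)
    (hK : ∀ x, (K x).All P) : (A >>= K).All P := hA.bind hK

theorem All.doRead {P : Act M → Prop} {r : M.Reg} (h : P (.read r)) :
    (Prog.doRead r).All P := ⟨h, fun _ => trivial⟩

theorem All.doLL {P : Act M → Prop} {r : M.Reg} (h : P (.ll r)) :
    (Prog.doLL r).All P := ⟨h, fun _ => trivial⟩

theorem All.doSC {P : Act M → Prop} {r : M.Reg} {v : M.Val r} (h : P (.sc r v)) :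
    (Prog.doSC r v).All P := ⟨h, fun _ => trivial⟩

theorem All.foldlM {ι : Type} {P : Act M → Prop} {f : α → ι → Prog M α}
    (hf : ∀ x i, (f x i).All P) (l : List ι) (x : α) : (l.foldlM f x).All P := by
  induction l generalizing x with
  | nil => exact trivial
  | cons i l ih => exact All.bind (hf x i) ih

theorem All.forM {ι : Type} {P : Act M → Prop} {f : ι → Prog M PUnit}
    (hf : ∀ i, (f i).All P) (l : List ι) : (l.forM f).All P := by
  induction l with
  | nil => exact trivial
  | cons i l ih => exact All.bind (hf i) fun _ => ih

theorem CostLE.mono {A : Prog M α} {N N' : ℕ} (h : A.CostLE N) (hN : N ≤ N') : A.CostLE N' := by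
  cases A with
  | ret a => trivial
  | read r k => obtain ⟨K, hK, h⟩ := h; exact ⟨K, hK.trans hN, h⟩
  | ll r k => obtain ⟨K, hK, h⟩ := h; exact ⟨K, hK.trans hN, h⟩
  | sc r v k => obtain ⟨K, hK, h⟩ := h; exact ⟨K, hK.trans hN, h⟩
  | write r h' v k => obtain ⟨K, hK, h⟩ := h; exact ⟨K, hK.trans hN, h⟩

theorem CostLE.bind {A : Prog M α} {K : α → Prog M β} {N N' : ℕ} (hA : A.CostLE N)
    (hK : ∀ x, (K x).CostLE N') : (A.bind K).CostLE (N + N') := by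
  induction A generalizing N with
  | ret a => exact (hK a).mono (Nat.le_add_left _ _)
  | read r k ih => obtain ⟨B, hB, h⟩ := hA; exact ⟨B + N', by omega, fun x => ih x (h x)⟩
  | ll r k ih => obtain ⟨B, hB, h⟩ := hA; exact ⟨B + N', by omega, fun x => ih x (h x)⟩
  | sc r v k ih => obtain ⟨B, hB, h⟩ := hA; exact ⟨B + N', by omega, fun x => ih x (h x)⟩
  | write r h' v k ih => obtain ⟨B, hB, h⟩ := hA; exact ⟨B + N', by omega, ih h⟩

theorem CostLE.andThen {A : Prog M α} {K : α → Prog M β} {N N' : ℕ} (hA : A.CostLE N)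
    (hK : ∀ x, (K x).CostLE N') : (A >>= K).CostLE (N + N') := hA.bind hK

theorem CostLE.doRead {r : M.Reg} : (Prog.doRead r).CostLE 1 := ⟨0, le_rfl, fun _ => trivial⟩

theorem CostLE.doLL {r : M.Reg} : (Prog.doLL r).CostLE 1 := ⟨0, le_rfl, fun _ => trivial⟩

theorem CostLE.doSC {r : M.Reg} {v : M.Val r} : (Prog.doSC r v).CostLE 1 :=
  ⟨0, le_rfl, fun _ => trivial⟩

theorem CostLE.doWrite {r : M.Reg} {h : M.Writable r} {v : M.Val r} :
    (Prog.doWrite r h v).CostLE 1 := ⟨0, le_rfl, trivial⟩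

theorem CostLE.foldlM {ι : Type} {f : α → ι → Prog M α} {N : ℕ}
    (hf : ∀ x i, (f x i).CostLE N) (l : List ι) (x : α) :
    (l.foldlM f x).CostLE (l.length * N) := by
  induction l generalizing x with
  | nil => exact trivial
  | cons i l ih =>
    exact (CostLE.bind (hf x i) ih).mono (by rw [List.length_cons, Nat.add_mul]; omega)

theorem CostLE.forM {ι : Type} {f : ι → Prog M PUnit} {N : ℕ}
    (hf : ∀ i, (f i).CostLE N) (l : List ι) : (l.forM f).CostLE (l.length * N) := by
  induction l with
  | nil => exact trivial
  | cons i l ih =>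
    exact (CostLE.bind (hf i) fun _ => ih).mono (by rw [List.length_cons, Nat.add_mul]; omega)

end Prog

/-! ## Histories: what happens to the registers in an execution -/

/-- The contents of the registers, the valid links, and the primitives that are applied. -/
structure RawHistory (n : ℕ) (M : BaseObjects) where
  mem : ℕ → ∀ r : M.Reg, M.Val r
  linked : ℕ → M.Reg → Set (Fin n)
  act : ℕ → Option (Fin n × Act M)

namespace RawHistory

variable {n : ℕ} {M : BaseObjects}

/-- Step `t` of process `p` writes `v` to the register `r`. -/
def ModBy (H : RawHistory n M) (r : M.Reg) (t : ℕ) (p : Fin n) (v : M.Val r) : Prop :=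
  (H.act t = some (p, .sc r v) ∧ p ∈ H.linked t r) ∨ H.act t = some (p, .write r v)

/-- Step `t` changes the register `r`. -/
def Mod (H : RawHistory n M) (r : M.Reg) (t : ℕ) : Prop := ∃ p v, H.ModBy r t p v

end RawHistory

/-- Histories that obey the semantics of `LL`, `SC` and `Write`. -/
structure History (n : ℕ) (M : BaseObjects) extends RawHistory n M where
  mem_of_modBy : ∀ {r t p v}, toRawHistory.ModBy r t p v → mem (t + 1) r = v
  mem_of_not_mod : ∀ {r t}, ¬ toRawHistory.Mod r t → mem (t + 1) r = mem t r
  linked_ll : ∀ {r t p}, act t = some (p, .ll r) → p ∈ linked (t + 1) r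
  linked_of_not_mod : ∀ {r t p}, p ∈ linked t r → ¬ toRawHistory.Mod r t → p ∈ linked (t + 1) r
  not_mod_of_linked : ∀ {r t p}, p ∈ linked (t + 1) r → ¬ toRawHistory.Mod r t
  linked_or_ll : ∀ {r t p}, p ∈ linked (t + 1) r → p ∈ linked t r ∨ act t = some (p, .ll r)

namespace History

/-! ### Links and changes of a register -/

variable {n : ℕ} {M : BaseObjects} (H : History n M)

theorem mem_eq {r : M.Reg} {s t : ℕ} (hst : s ≤ t) (h : ∀ u, s ≤ u → u < t → ¬ H.Mod r u) :
    H.mem t r = H.mem s r := by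
  induction t, hst using Nat.le_induction with
  | base => rfl
  | succ t hst ih =>
    rw [H.mem_of_not_mod (h t hst (Nat.lt_succ_self t))]
    exact ih fun u hu hut => h u hu (Nat.lt_succ_of_lt hut)

/-- The link created by the `LL` survives every step that leaves the register unchanged, so its
absence betrays a change. -/
theorem exists_mod_of_not_linked {r : M.Reg} {p : Fin n} {b e : ℕ}
    (hb : H.act b = some (p, .ll r)) (hbe : b < e) (he : p ∉ H.linked e r) :
    ∃ w, b < w ∧ w < e ∧ H.Mod r w := by
  by_contra! hc
  apply he
  clear he
  induction e, hbe using Nat.le_induction with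
  | base => exact H.linked_ll hb
  | succ t hst ih =>
    exact H.linked_of_not_mod (ih fun w h1 h2 => hc w h1 (by omega)) (hc t hst (by omega))

theorem not_mod_of_ll {r r' : M.Reg} {p : Fin n} {b : ℕ} (hb : H.act b = some (p, .ll r)) :
    ¬ H.Mod r' b := by
  rintro ⟨q, v, h | h⟩
  · rw [hb] at h; simp at h
  · rw [hb] at h; simp at h

/-- A change removes all links, and only another `LL` by `p` could restore the one of `p`. Excluding
such an `LL` is what ties a successful `SC` to this particular `LL`. -/
theorem not_mod_between {r : M.Reg} {p : Fin n} {b e : ℕ} (hb : H.act b = some (p, .ll r))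
    (he : p ∈ H.linked e r) (hll : ∀ s, b < s → s < e → H.act s ≠ some (p, .ll r)) :
    ∀ w, b ≤ w → w < e → ¬ H.Mod r w := by
  intro w hbw hwe hw
  rcases hbw.eq_or_lt with rfl | hbw
  · exact H.not_mod_of_ll hb hw
  have : ∀ s, w < s → s ≤ e → p ∉ H.linked s r := by
    intro s hs
    induction s, hs using Nat.le_induction with
    | base => exact fun _ hl => H.not_mod_of_linked hl hw
    | succ s hs ih =>
      intro hse hl
      rcases H.linked_or_ll hl with h | h
      · exact ih (by omega) h
      · exact hll s (by omega) (by omega) h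
  exact this e hwe le_rfl he

/-! ### Runs of code -/

/-- Process `p` executes the code `c` from configuration `t` on, and in configuration `u` it is
left with the code `d`. -/
inductive Path (p : Fin n) {α : Type} : ℕ → Prog M α → ℕ → Prog M α → Prop where
  | refl (t : ℕ) (c : Prog M α) : Path p t c t c
  | skip {t u : ℕ} {c d : Prog M α} (h : ∀ A, H.act t ≠ some (p, A)) :
      Path p (t + 1) c u d → Path p t c u d
  | read {t u : ℕ} {r : M.Reg} {k : M.Val r → Prog M α} {d : Prog M α}
      (h : H.act t = some (p, .read r)) :
      Path p (t + 1) (k (H.mem t r)) u d → Path p t (.read r k) u d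
  | ll {t u : ℕ} {r : M.Reg} {k : M.Val r → Prog M α} {d : Prog M α}
      (h : H.act t = some (p, .ll r)) :
      Path p (t + 1) (k (H.mem t r)) u d → Path p t (.ll r k) u d
  | sc {t u : ℕ} {r : M.Reg} {v : M.Val r} {k : Bool → Prog M α} {d : Prog M α} (b : Bool)
      (h : H.act t = some (p, .sc r v)) (hb : b = true ↔ p ∈ H.linked t r) :
      Path p (t + 1) (k b) u d → Path p t (.sc r v k) u d
  | write {t u : ℕ} {r : M.Reg} {hw : M.Writable r} {v : M.Val r} {k d : Prog M α}
      (h : H.act t = some (p, .write r v)) :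
      Path p (t + 1) k u d → Path p t (.write r hw v k) u d

/-- Process `p` executes all of the code `c` between the configurations `t` and `u`. -/
def Run (p : Fin n) {α : Type} (t : ℕ) (c : Prog M α) (u : ℕ) (x : α) : Prop :=
  H.Path p t c u (.ret x)

/-- Process `p`, which executes the code `c` from configuration `t` on, is about to apply the
primitive `A` in configuration `u`. -/
def At (p : Fin n) {α : Type} (t : ℕ) (c : Prog M α) (u : ℕ) (A : Act M) : Prop :=
  ∃ d, H.Path p t c u d ∧ d.head = some A

variable {H} {p : Fin n} {α β : Type} {t u : ℕ}

/-! ### Decomposing paths along the code -/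

theorem Path.le {c d : Prog M α} (h : H.Path p t c u d) : t ≤ u := by
  induction h <;> omega

theorem Run.le {c : Prog M α} {x : α} (h : H.Run p t c u x) : t ≤ u := Path.le h

theorem At.le {c : Prog M α} {A : Act M} (h : H.At p t c u A) : t ≤ u := h.choose_spec.1.le

theorem Path.bind_cases {A : Prog M α} {K : α → Prog M β} {d : Prog M β}
    (h : H.Path p t (A.bind K) u d) :
    (∃ A', H.Path p t A u A' ∧ d = A'.bind K) ∨
      ∃ x s, H.Run p t A s x ∧ H.Path p s (K x) u d := by
  generalize hc : A.bind K = c at h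
  induction h generalizing A with
  | refl t c => exact .inl ⟨A, .refl _ _, hc.symm⟩
  | skip h _ ih =>
    rcases ih hc with ⟨A', h1, h2⟩ | ⟨x, s, h1, h2⟩
    · exact .inl ⟨A', .skip h h1, h2⟩
    · exact .inr ⟨x, s, .skip h h1, h2⟩
  | read h hp ih =>
    cases A with
    | ret a => exact .inr ⟨a, _, .refl _ _, (show K a = _ from hc) ▸ .read h hp⟩
    | read r k =>
      simp only [Prog.bind, Prog.read.injEq] at hc
      obtain ⟨rfl, hc⟩ := hc
      obtain rfl := eq_of_heq hc
      rcases ih rfl with ⟨A', h1, h2⟩ | ⟨x, s, h1, h2⟩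
      · exact .inl ⟨A', .read h h1, h2⟩
      · exact .inr ⟨x, s, .read h h1, h2⟩
    | _ => simp [Prog.bind] at hc
  | ll h hp ih =>
    cases A with
    | ret a => exact .inr ⟨a, _, .refl _ _, (show K a = _ from hc) ▸ .ll h hp⟩
    | ll r k =>
      simp only [Prog.bind, Prog.ll.injEq] at hc
      obtain ⟨rfl, hc⟩ := hc
      obtain rfl := eq_of_heq hc
      rcases ih rfl with ⟨A', h1, h2⟩ | ⟨x, s, h1, h2⟩
      · exact .inl ⟨A', .ll h h1, h2⟩
      · exact .inr ⟨x, s, .ll h h1, h2⟩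
    | _ => simp [Prog.bind] at hc
  | sc b h hb hp ih =>
    cases A with
    | ret a => exact .inr ⟨a, _, .refl _ _, (show K a = _ from hc) ▸ .sc b h hb hp⟩
    | sc r v k =>
      simp only [Prog.bind, Prog.sc.injEq] at hc
      obtain ⟨rfl, hv, hc⟩ := hc
      obtain rfl := eq_of_heq hv
      obtain rfl := hc
      rcases ih rfl with ⟨A', h1, h2⟩ | ⟨x, s, h1, h2⟩
      · exact .inl ⟨A', .sc b h hb h1, h2⟩
      · exact .inr ⟨x, s, .sc b h hb h1, h2⟩
    | _ => simp [Prog.bind] at hc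
  | write h hp ih =>
    cases A with
    | ret a => exact .inr ⟨a, _, .refl _ _, (show K a = _ from hc) ▸ .write h hp⟩
    | write r hw v k =>
      simp only [Prog.bind, Prog.write.injEq] at hc
      obtain ⟨rfl, hv, hc⟩ := hc
      obtain rfl := eq_of_heq hv
      rcases ih hc with ⟨A', h1, h2⟩ | ⟨x, s, h1, h2⟩
      · exact .inl ⟨A', .write h h1, h2⟩
      · exact .inr ⟨x, s, .write h h1, h2⟩
    | _ => simp [Prog.bind] at hc

theorem Run.bind_cases {A : Prog M α} {K : α → Prog M β} {y : β}
    (h : H.Run p t (A >>= K) u y) : ∃ x s, H.Run p t A s x ∧ H.Run p s (K x) u y := by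
  rcases Path.bind_cases h with ⟨A', h1, h2⟩ | h
  · cases A' with
    | ret x => exact ⟨x, u, h1, (show _ = K x from h2) ▸ .refl _ _⟩
    | _ => simp [Prog.bind] at h2
  · exact h

theorem At.bind_cases {A : Prog M α} {K : α → Prog M β} {X : Act M}
    (h : H.At p t (A >>= K) u X) :
    H.At p t A u X ∨ ∃ x s, H.Run p t A s x ∧ H.At p s (K x) u X := by
  obtain ⟨d, hd, hX⟩ := h
  rcases Path.bind_cases hd with ⟨A', h1, rfl⟩ | ⟨x, s, h1, h2⟩
  · cases A' with
    | ret x => exact .inr ⟨x, u, h1, _, .refl _ _, hX⟩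
    | _ => exact .inl ⟨_, h1, hX⟩
  · exact .inr ⟨x, s, h1, d, h2, hX⟩

theorem Path.read_cases {r : M.Reg} {k : M.Val r → Prog M α} {d : Prog M α}
    (h : H.Path p t (.read r k) u d) : d = .read r k ∨
      ∃ s, t ≤ s ∧ s < u ∧ H.act s = some (p, .read r) ∧ H.Path p (s + 1) (k (H.mem s r)) u d := by
  generalize hc : Prog.read r k = c at h
  induction h with
  | refl => exact .inl rfl
  | skip _ _ ih =>
    rcases ih hc with h | ⟨s, h1, h⟩
    · exact .inl h
    · exact .inr ⟨s, by omega, h⟩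
  | read h hp _ =>
    simp only [Prog.read.injEq] at hc
    obtain ⟨rfl, hc⟩ := hc
    obtain rfl := eq_of_heq hc
    exact .inr ⟨_, le_rfl, hp.le, h, hp⟩
  | _ => simp at hc

/-- Besides the step itself, the conclusion records that `p` is idle before it. This is needed later
to account for every `SC` that an operation applies; the same clause appears for `SC`. -/
theorem Path.ll_cases {r : M.Reg} {k : M.Val r → Prog M α} {d : Prog M α}
    (h : H.Path p t (.ll r k) u d) : d = .ll r k ∨
      ∃ s, t ≤ s ∧ s < u ∧ H.act s = some (p, .ll r) ∧
        (∀ w, t ≤ w → w < s → ∀ A, H.act w ≠ some (p, A)) ∧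
        H.Path p (s + 1) (k (H.mem s r)) u d := by
  generalize hc : Prog.ll r k = c at h
  induction h with
  | refl => exact .inl rfl
  | skip hA _ ih =>
    rcases ih hc with h | ⟨s, h1, h2, h3, h5, h⟩
    · exact .inl h
    · refine .inr ⟨s, by omega, h2, h3, fun w hw hws => ?_, h⟩
      rcases hw.eq_or_lt with rfl | hw
      · exact hA
      · exact h5 w hw hws
  | ll h hp _ =>
    simp only [Prog.ll.injEq] at hc
    obtain ⟨rfl, hc⟩ := hc
    obtain rfl := eq_of_heq hc
    exact .inr ⟨_, le_rfl, hp.le, h, fun w _ _ => by omega, hp⟩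
  | _ => simp at hc

theorem Path.sc_cases {r : M.Reg} {v : M.Val r} {k : Bool → Prog M α} {d : Prog M α}
    (h : H.Path p t (.sc r v k) u d) :
    (d = .sc r v k ∧ ∀ w, t ≤ w → w < u → ∀ A, H.act w ≠ some (p, A)) ∨
      ∃ s b, t ≤ s ∧ s < u ∧ H.act s = some (p, .sc r v) ∧ (b = true ↔ p ∈ H.linked s r) ∧
        (∀ w, t ≤ w → w < s → ∀ A, H.act w ≠ some (p, A)) ∧ H.Path p (s + 1) (k b) u d := by
  generalize hc : Prog.sc r v k = c at h
  induction h with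
  | refl => exact .inl ⟨rfl, fun w _ _ => by omega⟩
  | skip hA _ ih =>
    rcases ih hc with ⟨h, h1⟩ | ⟨s, b, h1, h2, h3, h4, h5, h⟩
    · refine .inl ⟨h, fun w hw hwu => ?_⟩
      rcases hw.eq_or_lt with rfl | hw
      · exact hA
      · exact h1 w hw hwu
    · refine .inr ⟨s, b, by omega, h2, h3, h4, fun w hw hws => ?_, h⟩
      rcases hw.eq_or_lt with rfl | hw
      · exact hA
      · exact h5 w hw hws
  | sc b h hb hp _ =>
    simp only [Prog.sc.injEq] at hc
    obtain ⟨rfl, hv, hc⟩ := hc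
    obtain rfl := eq_of_heq hv
    obtain rfl := hc
    exact .inr ⟨_, b, le_rfl, hp.le, h, hb, fun w _ _ => by omega, hp⟩
  | _ => simp at hc

theorem Path.write_cases {r : M.Reg} {hw : M.Writable r} {v : M.Val r} {k d : Prog M α}
    (h : H.Path p t (.write r hw v k) u d) : d = .write r hw v k ∨
      ∃ s, t ≤ s ∧ s < u ∧ H.act s = some (p, .write r v) ∧ H.Path p (s + 1) k u d := by
  generalize hc : Prog.write r hw v k = c at h
  induction h with
  | refl => exact .inl rfl
  | skip _ _ ih =>
    rcases ih hc with h | ⟨s, h1, h⟩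
    · exact .inl h
    · exact .inr ⟨s, by omega, h⟩
  | write h hp _ =>
    simp only [Prog.write.injEq] at hc
    obtain ⟨rfl, hv, hc⟩ := hc
    obtain rfl := eq_of_heq hv
    subst hc
    exact .inr ⟨_, le_rfl, hp.le, h, hp⟩
  | _ => simp at hc

theorem Path.ret_cases {x : α} {d : Prog M α} (h : H.Path p t (.ret x) u d) : d = .ret x := by
  generalize hc : Prog.ret x = c at h
  induction h with
  | refl => exact rfl
  | skip _ _ ih => exact ih hc
  | _ => simp at hc

theorem Run.ret_eq {x y : α} (h : H.Run p t (.ret x) u y) : y = x := by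
  simpa using Path.ret_cases h

theorem At.not_ret {x : α} {X : Act M} : ¬ H.At p t (.ret x : Prog M α) u X := by
  rintro ⟨d, hd, hX⟩
  rw [hd.ret_cases] at hX
  simp [Prog.head] at hX

/-- Turns a syntactic property of code into one of the steps taken. It serves to exclude repeated
`LL`s before an `SC`, further writes in a `SCAN`, and proposals inside `applyUpdate`. -/
theorem Path.all {P : Act M → Prop} {c d : Prog M α} (h : H.Path p t c u d) (hc : c.All P) :
    d.All P ∧ ∀ s, t ≤ s → s < u → ∀ A, H.act s = some (p, A) → P A := by
  have key : ∀ {t u : ℕ} {R : Prop}, (∀ A, H.act t = some (p, A) → P A) →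
      (R ∧ ∀ s, t + 1 ≤ s → s < u → ∀ A, H.act s = some (p, A) → P A) →
      R ∧ ∀ s, t ≤ s → s < u → ∀ A, H.act s = some (p, A) → P A := by
    rintro t u R h1 ⟨h2, h3⟩
    refine ⟨h2, fun s hs hsu A hA => ?_⟩
    rcases hs.eq_or_lt with rfl | hs
    · exact h1 A hA
    · exact h3 s hs hsu A hA
  have one : ∀ {t : ℕ} {B : Act M}, H.act t = some (p, B) → P B →
      ∀ A, H.act t = some (p, A) → P A := by
    intro t B h hB A hA
    rw [h] at hA
    simp only [Option.some.injEq, Prod.mk.injEq, true_and] at hA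
    exact hA ▸ hB
  induction h with
  | refl t c => exact ⟨hc, fun s h1 h2 => by omega⟩
  | @skip t u c d h hp ih =>
    refine ⟨(ih hc).1, fun s hs hsu A hA => ?_⟩
    rcases hs.eq_or_lt with rfl | hs
    · exact (h A hA).elim
    · exact (ih hc).2 s hs hsu A hA
  | read h hp ih => exact key (one h hc.1) (ih (hc.2 _))
  | ll h hp ih => exact key (one h hc.1) (ih (hc.2 _))
  | sc b h hb hp ih => exact key (one h hc.1) (ih (hc.2 _))
  | write h hp ih => exact key (one h hc.1) (ih hc.2)

theorem Run.read_then {r : M.Reg} {K : M.Val r → Prog M α} {y : α}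
    (h : H.Run p t (Prog.doRead r >>= K) u y) :
    ∃ s, t ≤ s ∧ s < u ∧ H.act s = some (p, .read r) ∧ H.Run p (s + 1) (K (H.mem s r)) u y :=
  (Path.read_cases h).resolve_left (by simp)

theorem Run.ll_then {r : M.Reg} {K : M.Val r → Prog M α} {y : α}
    (h : H.Run p t (Prog.doLL r >>= K) u y) :
    ∃ s, t ≤ s ∧ s < u ∧ H.act s = some (p, .ll r) ∧
      (∀ w, t ≤ w → w < s → ∀ A, H.act w ≠ some (p, A)) ∧ H.Run p (s + 1) (K (H.mem s r)) u y :=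
  (Path.ll_cases h).resolve_left (by simp)

theorem Run.sc_then {r : M.Reg} {v : M.Val r} {K : Bool → Prog M α} {y : α}
    (h : H.Run p t (Prog.doSC r v >>= K) u y) :
    ∃ s b, t ≤ s ∧ s < u ∧ H.act s = some (p, .sc r v) ∧ (b = true ↔ p ∈ H.linked s r) ∧
      (∀ w, t ≤ w → w < s → ∀ A, H.act w ≠ some (p, A)) ∧ H.Run p (s + 1) (K b) u y :=
  (Path.sc_cases h).resolve_left (by simp)

theorem Run.write_then {r : M.Reg} {hw : M.Writable r} {v : M.Val r} {K : Unit → Prog M α} {y : α}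
    (h : H.Run p t (Prog.doWrite r hw v >>= K) u y) :
    ∃ s, t ≤ s ∧ s < u ∧ H.act s = some (p, .write r v) ∧ H.Run p (s + 1) (K ()) u y :=
  (Path.write_cases h).resolve_left (by simp)

theorem At.read_then {r : M.Reg} {K : M.Val r → Prog M α} {X : Act M}
    (h : H.At p t (Prog.doRead r >>= K) u X) : X = .read r ∨
    ∃ s, t ≤ s ∧ s < u ∧ H.act s = some (p, .read r) ∧ H.At p (s + 1) (K (H.mem s r)) u X := by
  obtain ⟨d, hd, hX⟩ := h
  rcases Path.read_cases hd with rfl | ⟨s, h1, h2, h3, h4⟩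
  · exact .inl (Option.some.inj hX).symm
  · exact .inr ⟨s, h1, h2, h3, d, h4, hX⟩

theorem At.ll_then {r : M.Reg} {K : M.Val r → Prog M α} {X : Act M}
    (h : H.At p t (Prog.doLL r >>= K) u X) : X = .ll r ∨
    ∃ s, t ≤ s ∧ s < u ∧ H.act s = some (p, .ll r) ∧
      (∀ w, t ≤ w → w < s → ∀ A, H.act w ≠ some (p, A)) ∧ H.At p (s + 1) (K (H.mem s r)) u X := by
  obtain ⟨d, hd, hX⟩ := h
  rcases Path.ll_cases hd with rfl | ⟨s, h1, h2, h3, h4, h5⟩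
  · exact .inl (Option.some.inj hX).symm
  · exact .inr ⟨s, h1, h2, h3, h4, d, h5, hX⟩

theorem At.sc_then {r : M.Reg} {v : M.Val r} {K : Bool → Prog M α} {X : Act M}
    (h : H.At p t (Prog.doSC r v >>= K) u X) : 
    (X = .sc r v ∧ ∀ w, t ≤ w → w < u → ∀ A, H.act w ≠ some (p, A)) ∨
    ∃ s b, t ≤ s ∧ s < u ∧ H.act s = some (p, .sc r v) ∧ (b = true ↔ p ∈ H.linked s r) ∧
      (∀ w, t ≤ w → w < s → ∀ A, H.act w ≠ some (p, A)) ∧ H.At p (s + 1) (K b) u X := by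
  obtain ⟨d, hd, hX⟩ := h
  rcases Path.sc_cases hd with ⟨rfl, h1⟩ | ⟨s, b, h1, h2, h3, h4, h5, h6⟩
  · exact .inl ⟨(Option.some.inj hX).symm, h1⟩
  · exact .inr ⟨s, b, h1, h2, h3, h4, h5, d, h6, hX⟩

theorem At.write_then {r : M.Reg} {hw : M.Writable r} {v : M.Val r} {K : Unit → Prog M α}
    {X : Act M} (h : H.At p t (Prog.doWrite r hw v >>= K) u X) : X = .write r v ∨
    ∃ s, t ≤ s ∧ s < u ∧ H.act s = some (p, .write r v) ∧ H.At p (s + 1) (K ()) u X := by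
  obtain ⟨d, hd, hX⟩ := h
  rcases Path.write_cases hd with rfl | ⟨s, h1, h2, h3, h4⟩
  · exact .inl (Option.some.inj hX).symm
  · exact .inr ⟨s, h1, h2, h3, d, h4, hX⟩

theorem At.foldlM_cases {ι : Type} {f : α → ι → Prog M α} {l : List ι} {x : α} {X : Act M}
    (h : H.At p t (l.foldlM f x) u X) : ∃ i ∈ l, ∃ y s, t ≤ s ∧ H.At p s (f y i) u X := by
  induction l generalizing x t with
  | nil => exact (At.not_ret h).elim
  | cons i l ih =>
    rcases At.bind_cases (A := f x i) (K := fun y => l.foldlM f y) h with h | ⟨y, s, h1, h2⟩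
    · exact ⟨i, by simp, x, t, le_rfl, h⟩
    · obtain ⟨i', hi', y', s', hs, h⟩ := ih h2
      exact ⟨i', by simp [hi'], y', s', h1.le.trans hs, h⟩

theorem At.forM_cases {ι : Type} {f : ι → Prog M PUnit} {l : List ι} {X : Act M}
    (h : H.At p t (l.forM f) u X) : ∃ i ∈ l, ∃ s, t ≤ s ∧ H.At p s (f i) u X := by
  induction l generalizing t with
  | nil => exact (At.not_ret h).elim
  | cons i l ih =>
    rcases At.bind_cases (A := f i) (K := fun _ => l.forM f) h with h | ⟨y, s, h1, h2⟩
    · exact ⟨i, by simp, t, le_rfl, h⟩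
    · obtain ⟨i', hi', s', hs, h⟩ := ih h2
      exact ⟨i', by simp [hi'], s', h1.le.trans hs, h⟩

theorem Run.forM_cases {ι : Type} {f : ι → Prog M PUnit} {l : List ι} {y : PUnit}
    (h : H.Run p t (l.forM f) u y) {i : ι} (hi : i ∈ l) :
    ∃ s s', t ≤ s ∧ s' ≤ u ∧ H.Run p s (f i) s' ⟨⟩ := by
  induction l generalizing t with
  | nil => simp at hi
  | cons i' l ih =>
    obtain ⟨y', s, h1, h2⟩ := Run.bind_cases (A := f i') (K := fun _ => l.forM f) h
    rcases List.mem_cons.1 hi with rfl | hi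
    · exact ⟨t, s, le_rfl, h2.le, h1⟩
    · obtain ⟨a, b, ha, hb, hr⟩ := ih h2 hi
      exact ⟨a, b, h1.le.trans ha, hb, hr⟩

/-- If every iteration of a loop establishes the property `Q` of its result, and the loop is not
empty, then the result of the loop has this property. -/
theorem Run.foldlM_result {ι : Type} {f : α → ι → Prog M α} {l : List ι} {x y : α}
    (h : H.Run p t (l.foldlM f x) u y) (hl : l ≠ []) :
    ∃ i ∈ l, ∃ z s s', t ≤ s ∧ s' ≤ u ∧ H.Run p s (f z i) s' y := by
  induction l generalizing t x with
  | nil => exact (hl rfl).elim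
  | cons i l ih =>
    obtain ⟨y', s, h1, h2⟩ := Run.bind_cases (A := f x i) (K := fun y => l.foldlM f y) h
    rcases eq_or_ne l [] with rfl | hl'
    · obtain rfl := Run.ret_eq h2
      exact ⟨i, by simp, x, t, s, le_rfl, h2.le, h1⟩
    · obtain ⟨i', hi', z, a, b, ha, hb, hr⟩ := ih h2 hl'
      exact ⟨i', by simp [hi'], z, a, b, h1.le.trans ha, hb, hr⟩

theorem Run.foldlM_cases {ι : Type} {f : α → ι → Prog M α} {l : List ι} {x y : α}
    (h : H.Run p t (l.foldlM f x) u y) {i : ι} (hi : i ∈ l) :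
    ∃ z z' s s', t ≤ s ∧ s' ≤ u ∧ H.Run p s (f z i) s' z' := by
  induction l generalizing t x with
  | nil => simp at hi
  | cons i' l ih =>
    obtain ⟨y', s, h1, h2⟩ := Run.bind_cases (A := f x i') (K := fun y => l.foldlM f y) h
    rcases List.mem_cons.1 hi with rfl | hi
    · exact ⟨x, y', t, s, le_rfl, h2.le, h1⟩
    · obtain ⟨z, z', a, b, ha, hb, hr⟩ := ih h2 hi
      exact ⟨z, z', a, b, h1.le.trans ha, hb, hr⟩

theorem Run.all {P : Act M → Prop} {c : Prog M α} {x : α} (h : H.Run p t c u x) (hc : c.All P)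
    {s : ℕ} (h1 : t ≤ s) (h2 : s < u) {A : Act M} (hA : H.act s = some (p, A)) : P A :=
  (Path.all h hc).2 s h1 h2 A hA

theorem At.all_before {P : Act M → Prop} {c : Prog M α} {A : Act M} (h : H.At p t c u A)
    (hc : c.All P) {s : ℕ} (h1 : t ≤ s) (h2 : s < u) {B : Act M} (hB : H.act s = some (p, B)) :
    P B := by
  obtain ⟨d, hd, -⟩ := h
  exact (hd.all hc).2 s h1 h2 B hB

open Classical in
/-- The primitives that are applied on a path are paid for by the cost of the code. -/
theorem Path.cost {c d : Prog M α} (h : H.Path p t c u d) {N : ℕ} (hc : c.CostLE N) :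
    ∃ N', d.CostLE N' ∧
      ((Finset.Ico t u).filter fun s => ∃ A, H.act s = some (p, A)).card + N' ≤ N := by
  have step : ∀ {t u K N' N : ℕ}, t < u → K + 1 ≤ N →
      ((Finset.Ico (t + 1) u).filter fun s => ∃ A, H.act s = some (p, A)).card + N' ≤ K →
      ((Finset.Ico t u).filter fun s => ∃ A, H.act s = some (p, A)).card + N' ≤ N := by
    intro t u K N' N htu hK h
    rw [← Finset.insert_Ico_add_one_left_eq_Ico htu, Finset.filter_insert]
    split_ifs
    · have := Finset.card_insert_le t
        ((Finset.Ico (t + 1) u).filter fun s => ∃ A, H.act s = some (p, A))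
      omega
    · omega
  induction h generalizing N with
  | refl t c => exact ⟨N, hc, by simp⟩
  | @skip t u c d h hp ih =>
    obtain ⟨N', h1, h2⟩ := ih hc
    refine ⟨N', h1, ?_⟩
    rw [← Finset.insert_Ico_add_one_left_eq_Ico hp.le, Finset.filter_insert,
      if_neg (by rintro ⟨A, hA⟩; exact h A hA)]
    exact h2
  | read h hp ih =>
    obtain ⟨K, hK, hc⟩ := hc
    obtain ⟨N', h1, h2⟩ := ih (hc _)
    exact ⟨N', h1, step hp.le hK h2⟩
  | ll h hp ih =>
    obtain ⟨K, hK, hc⟩ := hc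
    obtain ⟨N', h1, h2⟩ := ih (hc _)
    exact ⟨N', h1, step hp.le hK h2⟩
  | sc b h hb hp ih =>
    obtain ⟨K, hK, hc⟩ := hc
    obtain ⟨N', h1, h2⟩ := ih (hc _)
    exact ⟨N', h1, step hp.le hK h2⟩
  | write h hp ih =>
    obtain ⟨K, hK, hc⟩ := hc
    obtain ⟨N', h1, h2⟩ := ih hc
    exact ⟨N', h1, step hp.le hK h2⟩

end History

/-! ## The history of an execution -/

namespace Implementation

variable {n : ℕ} {Op Resp : Type} {I : Implementation n Op Resp}

/-- The primitive that the step `e` applies in the configuration `c`. -/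
def Config.act (c : I.Config) : Event n Op Resp → Option (Fin n × Act I.base)
  | .access p => (c.proc p).bind fun x => x.2.head.map fun A => (p, A)
  | _ => none

namespace Step

variable {c c' : I.Config} {e : Event n Op Resp}

theorem mem_of_sc (h : I.Step c e c') {r : I.base.Reg} {p : Fin n} {v : I.base.Val r}
    (ha : c.act e = some (p, .sc r v)) (hl : p ∈ c.linked r) : c'.mem r = v := by
  cases h with
  | scSuccess q o r' v' k h hl' =>
    simp only [Config.act, h, Prog.head, Option.bind_some, Option.map_some, Option.some.injEq,
      Prod.mk.injEq, Act.sc.injEq] at ha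
    obtain ⟨rfl, rfl, ha⟩ := ha
    obtain rfl := eq_of_heq ha
    simp
  | scFailure q o r' v' k h hl' =>
    simp only [Config.act, h, Prog.head, Option.bind_some, Option.map_some, Option.some.injEq,
      Prod.mk.injEq, Act.sc.injEq] at ha
    obtain ⟨rfl, rfl, ha⟩ := ha
    exact (hl' hl).elim
  | _ => simp_all [Config.act, Prog.head]

theorem mem_of_write (h : I.Step c e c') {r : I.base.Reg} {p : Fin n} {v : I.base.Val r}
    (ha : c.act e = some (p, .write r v)) : c'.mem r = v := by
  cases h with
  | write q o r' hw v' k h =>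
    simp only [Config.act, h, Prog.head, Option.bind_some, Option.map_some, Option.some.injEq,
      Prod.mk.injEq, Act.write.injEq] at ha
    obtain ⟨rfl, rfl, ha⟩ := ha
    obtain rfl := eq_of_heq ha
    simp
  | _ => simp_all [Config.act, Prog.head]

theorem unchanged (h : I.Step c e c') {r : I.base.Reg}
    (h1 : ∀ p v, c.act e = some (p, .sc r v) → p ∉ c.linked r)
    (h2 : ∀ p v, c.act e ≠ some (p, .write r v)) :
    c'.mem r = c.mem r ∧ c.linked r ⊆ c'.linked r := by
  cases h with
  | scSuccess q o r' v' k h hl' =>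
    have : r ≠ r' := by
      rintro rfl
      exact h1 q v' (by simp [Config.act, h, Prog.head]) hl'
    simp [Function.update_of_ne this]
  | write q o r' hw v' k h =>
    have : r ≠ r' := by
      rintro rfl
      exact h2 q v' (by simp [Config.act, h, Prog.head])
    simp [Function.update_of_ne this]
  | ll q o r' k h =>
    refine ⟨rfl, ?_⟩
    by_cases hr : r = r'
    · subst hr; simp
    · simp [Function.update_of_ne hr]
  | _ => exact ⟨rfl, subset_rfl⟩

theorem linked_of_ll (h : I.Step c e c') {r : I.base.Reg} {p : Fin n}
    (ha : c.act e = some (p, .ll r)) : p ∈ c'.linked r := by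
  cases h with
  | ll q o r' k h =>
    simp only [Config.act, h, Prog.head, Option.bind_some, Option.map_some, Option.some.injEq,
      Prod.mk.injEq, Act.ll.injEq] at ha
    obtain ⟨rfl, rfl⟩ := ha
    simp
  | _ => simp_all [Config.act, Prog.head]

theorem linked_cases (h : I.Step c e c') {r : I.base.Reg} {p : Fin n} (hp : p ∈ c'.linked r) :
    (p ∈ c.linked r ∨ c.act e = some (p, .ll r)) ∧
      (∀ q v, c.act e = some (q, .sc r v) → q ∉ c.linked r) ∧
      ∀ q v, c.act e ≠ some (q, .write r v) := by
  cases h with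
  | ll q o r' k h =>
    by_cases hr : r = r'
    · subst hr
      rcases (by simpa using hp : p = q ∨ p ∈ c.linked r) with rfl | hp
      · simp [Config.act, h, Prog.head]
      · simp [Config.act, h, Prog.head, hp]
    · dsimp only at hp
      rw [Function.update_of_ne hr] at hp
      simp [Config.act, h, Prog.head, hp]
  | scSuccess q o r' v' k h hl' =>
    by_cases hr : r = r'
    · subst hr; simp at hp
    · dsimp only at hp
      rw [Function.update_of_ne hr] at hp
      refine ⟨.inl hp, fun q v hq => ?_, by simp [Config.act, h, Prog.head]⟩
      simp only [Config.act, h, Prog.head, Option.bind_some, Option.map_some, Option.some.injEq,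
        Prod.mk.injEq, Act.sc.injEq] at hq
      exact (hr hq.2.1.symm).elim
  | scFailure q o r' v' k h hl' =>
    refine ⟨.inl hp, fun q v hq => ?_, by simp [Config.act, h, Prog.head]⟩
    simp only [Config.act, h, Prog.head, Option.bind_some, Option.map_some, Option.some.injEq,
      Prod.mk.injEq, Act.sc.injEq] at hq
    obtain ⟨rfl, rfl, -⟩ := hq
    exact hl'
  | write q o r' hw v' k h =>
    by_cases hr : r = r'
    · subst hr; simp at hp
    · dsimp only at hp
      rw [Function.update_of_ne hr] at hp
      refine ⟨.inl hp, by simp [Config.act, h, Prog.head], fun q v hq => ?_⟩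
      simp only [Config.act, h, Prog.head, Option.bind_some, Option.map_some, Option.some.injEq,
        Prod.mk.injEq, Act.write.injEq] at hq
      exact hr hq.2.1.symm
  | read q o r' k h => simp [Config.act, h, Prog.head, hp]
  | invoke q o hq h => simp [Config.act, hp]
  | respond q o a h => simp [Config.act, hp]

end Step

namespace Execution

variable (a : I.Execution)

open Classical in
/-- Configuration `t`, or the last configuration if the execution is over by then. -/
noncomputable def config (t : ℕ) : I.Config :=
  if (t : ℕ∞) ≤ a.len then a.conf t else a.conf a.len.toNat

open Classical in
/-- The history of an execution, before its laws are known. -/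
noncomputable def rawHistory : RawHistory n I.base where
  mem t := (a.config t).mem
  linked t := (a.config t).linked
  act t := if (t : ℕ∞) < a.len then (a.conf t).act (a.ev t) else none

variable {a}

theorem config_eq {t : ℕ} (h : (t : ℕ∞) ≤ a.len) : a.config t = a.conf t := if_pos h

/-- Beyond its end the execution is continued by a frozen configuration without primitives, so that
the laws of a `History` hold at all times and not only below `len`. -/
theorem step_or (a : I.Execution) (t : ℕ) :
    (a.rawHistory.act t = none ∧ a.config (t + 1) = a.config t) ∨
      (a.rawHistory.act t = (a.config t).act (a.ev t) ∧
        I.Step (a.config t) (a.ev t) (a.config (t + 1))) := by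
  by_cases h : (t : ℕ∞) < a.len
  · right
    have h' : ((t + 1 : ℕ) : ℕ∞) ≤ a.len := by
      simpa using Order.add_one_le_of_lt h
    rw [config_eq h.le, config_eq h']
    exact ⟨if_pos h, a.step t h⟩
  · left
    refine ⟨if_neg h, ?_⟩
    have h' : ¬ ((t + 1 : ℕ) : ℕ∞) ≤ a.len := fun h' =>
      h (lt_of_lt_of_le (by exact_mod_cast Nat.lt_succ_self t) h')
    rw [config, if_neg h', config]
    split_ifs with h2
    · rw [le_antisymm (not_lt.1 h) h2, ENat.toNat_natCast]
    · rfl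

variable (a) in
/-- The history of an execution. -/
noncomputable def history : History n I.base where
  toRawHistory := a.rawHistory
  mem_of_modBy {r t p v} h := by
    rcases a.step_or t with ⟨h1, -⟩ | ⟨h1, h2⟩
    · rcases h with ⟨h, -⟩ | h <;> simp [h1] at h
    · rcases h with ⟨h, hl⟩ | h
      · exact h2.mem_of_sc (h1 ▸ h) hl
      · exact h2.mem_of_write (h1 ▸ h)
  mem_of_not_mod {r t} h := by
    rcases a.step_or t with ⟨-, h1⟩ | ⟨h1, h2⟩
    · exact congrArg (fun c : I.Config => c.mem r) h1
    · exact (h2.unchanged (fun p v h' hl => h ⟨p, v, .inl ⟨h1.trans h', hl⟩⟩)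
        fun p v h' => h ⟨p, v, .inr (h1.trans h')⟩).1
  linked_ll {r t p} h := by
    rcases a.step_or t with ⟨h1, -⟩ | ⟨h1, h2⟩
    · simp [h1] at h
    · exact h2.linked_of_ll (h1 ▸ h)
  linked_of_not_mod {r t p} hl h := by
    rcases a.step_or t with ⟨-, h1⟩ | ⟨h1, h2⟩
    · exact (congrArg (fun c : I.Config => p ∈ c.linked r) h1).mpr hl
    · exact (h2.unchanged (fun p v h' hl => h ⟨p, v, .inl ⟨h1.trans h', hl⟩⟩)
        fun p v h' => h ⟨p, v, .inr (h1.trans h')⟩).2 hl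
  not_mod_of_linked {r t p} hl := by
    rintro ⟨q, v, h⟩
    rcases a.step_or t with ⟨h1, -⟩ | ⟨h1, h2⟩
    · rcases h with ⟨h, -⟩ | h <;> simp [h1] at h
    · obtain ⟨-, h3, h4⟩ := h2.linked_cases hl
      rcases h with ⟨h, hl⟩ | h
      · exact h3 q v (h1 ▸ h) hl
      · exact h4 q v (h1 ▸ h)
  linked_or_ll {r t p} hl := by
    rcases a.step_or t with ⟨-, h1⟩ | ⟨h1, h2⟩
    · exact .inl ((congrArg (fun c : I.Config => p ∈ c.linked r) h1).mp hl)
    · exact (h2.linked_cases hl).1.imp id fun h => h1.trans h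

theorem succ_le {t : ℕ} (h : (t : ℕ∞) < a.len) : ((t + 1 : ℕ) : ℕ∞) ≤ a.len := by
  simpa using Order.add_one_le_of_lt h

theorem lt_len_of_le {s t : ℕ} (hst : s ≤ t) (h : (t : ℕ∞) < a.len) : (s : ℕ∞) < a.len :=
  lt_of_le_of_lt (by exact_mod_cast hst) h

theorem lt_len_of_lt {s t : ℕ} (hst : s < t) (h : (t : ℕ∞) ≤ a.len) : (s : ℕ∞) < a.len :=
  lt_of_lt_of_le (by exact_mod_cast hst) h

theorem history_act {t : ℕ} (h : (t : ℕ∞) < a.len) :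
    a.history.act t = (a.conf t).act (a.ev t) := if_pos h

theorem history_mem {t : ℕ} (h : (t : ℕ∞) ≤ a.len) (r : I.base.Reg) :
    a.history.mem t r = (a.conf t).mem r := by
  change (a.config t).mem r = _
  rw [config_eq h]

theorem history_linked {t : ℕ} (h : (t : ℕ∞) ≤ a.len) (r : I.base.Reg) :
    a.history.linked t r = (a.conf t).linked r := by
  change (a.config t).linked r = _
  rw [config_eq h]

theorem history_mem_zero (r : I.base.Reg) : a.history.mem 0 r = I.initVal r := by
  rw [history_mem (by simp), a.start]; rfl

theorem lt_len_of_act {t : ℕ} {x : Fin n × Act I.base} (h : a.history.act t = some x) :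
    (t : ℕ∞) < a.len := by
  by_contra hc
  simp [history, rawHistory, hc] at h

theorem ev_of_act {t : ℕ} {p : Fin n} {A : Act I.base} (h : a.history.act t = some (p, A)) :
    a.ev t = .access p ∧ ∃ o c, (a.conf t).proc p = some (o, c) ∧ c.head = some A := by
  rw [history_act (lt_len_of_act h)] at h
  cases he : a.ev t with
  | access q =>
    rw [he] at h
    simp only [Config.act, Option.bind_eq_some_iff, Option.map_eq_some_iff] at h
    obtain ⟨⟨o, c⟩, h1, A', h2, h3⟩ := h
    cases h3
    exact ⟨rfl, o, c, h1, h2⟩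
  | _ => simp [he, Config.act] at h

theorem exists_act {t : ℕ} (ht : (t : ℕ∞) < a.len) {p : Fin n} (h : a.ev t = .access p) :
    ∃ A, a.history.act t = some (p, A) := by
  have hs := a.step t ht
  rw [history_act ht, h]
  rw [h] at hs
  generalize a.conf (t + 1) = c' at hs
  cases hs with
  | _ => simp_all [Config.act, Prog.head]

/-- As long as it does not respond, a process executes the code of its active operation. -/
theorem exists_path {t u : ℕ} {p : Fin n} {o : Op} {c : Prog I.base Resp} (htu : t ≤ u)
    (hu : (u : ℕ∞) ≤ a.len) (hc : (a.conf t).proc p = some (o, c))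
    (hno : ∀ w, t ≤ w → w < u → ∀ x, a.ev w ≠ .respond p x) :
    ∃ d, (a.conf u).proc p = some (o, d) ∧ a.history.Path p t c u d := by
  obtain ⟨k, rfl⟩ := Nat.exists_eq_add_of_le htu
  clear htu
  induction k generalizing t c with
  | zero => exact ⟨c, hc, .refl _ _⟩
  | succ k ih =>
    rw [show t + (k + 1) = t + 1 + k by omega] at *
    have ht : (t : ℕ∞) < a.len := lt_len_of_lt (by omega) hu
    have ih' : ∀ {c' : Prog I.base Resp}, (a.conf (t + 1)).proc p = some (o, c') →
        ∃ d, (a.conf (t + 1 + k)).proc p = some (o, d) ∧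
          a.history.Path p (t + 1) c' (t + 1 + k) d :=
      fun h => ih h hu fun w h1 h2 => hno w (by omega) h2
    have hs := a.step t ht
    have hact := history_act ht
    have hmem := fun r => history_mem (a := a) ht.le r
    have hlink := fun r => history_linked (a := a) ht.le r
    have hno' := hno t le_rfl (by omega)
    generalize a.ev t = e at hs hact hno'
    generalize a.conf (t + 1) = c' at hs ih'
    have other : ∀ {q : Fin n}, q ≠ p → (∀ A, (a.conf t).act e ≠ some (p, A)) →
        c'.proc p = (a.conf t).proc p → ∃ d, (a.conf (t + 1 + k)).proc p = some (o, d) ∧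
          a.history.Path p t c (t + 1 + k) d := by
      intro q hq hA hp
      obtain ⟨d, h1, h2⟩ := ih' (hp.trans hc)
      exact ⟨d, h1, .skip (fun A h => hA A (hact ▸ h)) h2⟩
    cases hs with
    | invoke q o' hq h =>
      by_cases hpq : q = p
      · subst hpq; rw [h] at hc; simp at hc
      · exact other hpq (by simp [Config.act]) (Function.update_of_ne (Ne.symm hpq) _ _)
    | read q o' r k h =>
      by_cases hpq : q = p
      · subst hpq
        rw [h] at hc
        obtain ⟨rfl, rfl⟩ := by simpa using hc
        obtain ⟨d, h1, h2⟩ := ih' (Function.update_self _ _ _)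
        refine ⟨d, h1, .read (by rw [hact]; simp [Config.act, h, Prog.head]) ?_⟩
        rwa [hmem]
      · refine other hpq (by simp [Config.act, h, hpq]) (Function.update_of_ne (Ne.symm hpq) _ _)
    | ll q o' r k h =>
      by_cases hpq : q = p
      · subst hpq
        rw [h] at hc
        obtain ⟨rfl, rfl⟩ := by simpa using hc
        obtain ⟨d, h1, h2⟩ := ih' (Function.update_self _ _ _)
        refine ⟨d, h1, .ll (by rw [hact]; simp [Config.act, h, Prog.head]) ?_⟩
        rwa [hmem]
      · refine other hpq (by simp [Config.act, h, hpq]) (Function.update_of_ne (Ne.symm hpq) _ _)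
    | scSuccess q o' r v k h hl =>
      by_cases hpq : q = p
      · subst hpq
        rw [h] at hc
        obtain ⟨rfl, rfl⟩ := by simpa using hc
        obtain ⟨d, h1, h2⟩ := ih' (Function.update_self _ _ _)
        exact ⟨d, h1, .sc true (by rw [hact]; simp [Config.act, h, Prog.head])
          (by simp [hlink, hl]) h2⟩
      · refine other hpq (by simp [Config.act, h, hpq]) (Function.update_of_ne (Ne.symm hpq) _ _)
    | scFailure q o' r v k h hl =>
      by_cases hpq : q = p
      · subst hpq
        rw [h] at hc
        obtain ⟨rfl, rfl⟩ := by simpa using hc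
        obtain ⟨d, h1, h2⟩ := ih' (Function.update_self _ _ _)
        exact ⟨d, h1, .sc false (by rw [hact]; simp [Config.act, h, Prog.head])
          (by simp [hlink, hl]) h2⟩
      · refine other hpq (by simp [Config.act, h, hpq]) (Function.update_of_ne (Ne.symm hpq) _ _)
    | write q o' r hw v k h =>
      by_cases hpq : q = p
      · subst hpq
        rw [h] at hc
        obtain ⟨rfl, rfl⟩ := by simpa using hc
        obtain ⟨d, h1, h2⟩ := ih' (Function.update_self _ _ _)
        exact ⟨d, h1, .write (by rw [hact]; simp [Config.act, h, Prog.head]) h2⟩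
      · refine other hpq (by simp [Config.act, h, hpq]) (Function.update_of_ne (Ne.symm hpq) _ _)
    | respond q o' x h =>
      by_cases hpq : q = p
      · subst hpq; exact (hno' x rfl).elim
      · exact other hpq (by simp [Config.act]) (Function.update_of_ne (Ne.symm hpq) _ _)

/-! ### Operations, their intervals and their accesses -/

variable (a) in
/-- Process `p` invokes `o` at step `i`, and does not respond at the steps before `u`. -/
def During (i : ℕ) (p : Fin n) (o : Op) (u : ℕ) : Prop :=
  a.Invokes i p o ∧ i < u ∧ ∀ w, i < w → w < u → ∀ x, a.ev w ≠ .respond p x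

theorem During.mono {i u u' : ℕ} {p : Fin n} {o : Op} (h : a.During i p o u) (hi : i < u')
    (hu : u' ≤ u) : a.During i p o u' :=
  ⟨h.1, hi, fun w h1 h2 => h.2.2 w h1 (by omega)⟩

theorem Responds.during {i l : ℕ} {p : Fin n} {o : Op} {x : Resp} (hi : a.Invokes i p o)
    (h : a.Responds i p l x) : a.During i p o l :=
  ⟨hi, h.1, h.2.2.2⟩

theorem Invokes.proc {i : ℕ} {p : Fin n} {o : Op} (h : a.Invokes i p o) :
    ∃ hp, (a.conf (i + 1)).proc p = some (o, I.code p o hp) := by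
  have hs := a.step i h.1
  rw [h.2] at hs
  generalize a.conf (i + 1) = c' at hs
  cases hs with
  | invoke _ _ hp h => exact ⟨hp, Function.update_self _ _ _⟩

theorem Invokes.unique {i : ℕ} {p p' : Fin n} {o o' : Op} (h : a.Invokes i p o)
    (h' : a.Invokes i p' o') : p' = p ∧ o' = o := by
  have := h'.2.symm.trans h.2
  simpa using this

theorem During.exists_path {i u : ℕ} {p : Fin n} {o : Op} (h : a.During i p o u)
    (hu : (u : ℕ∞) ≤ a.len) : ∃ hp d, (a.conf u).proc p = some (o, d) ∧
      a.history.Path p (i + 1) (I.code p o hp) u d := by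
  obtain ⟨hp, hc⟩ := h.1.proc
  obtain ⟨d, h1⟩ := Execution.exists_path h.2.1 hu hc fun w h1 h2 => h.2.2 w (by omega) h2
  exact ⟨hp, d, h1⟩

theorem Responds.run {i l : ℕ} {p : Fin n} {o : Op} {x : Resp} (hi : a.Invokes i p o)
    (h : a.Responds i p l x) : ∃ hp, a.history.Run p (i + 1) (I.code p o hp) l x := by
  obtain ⟨hp, d, h1, h2⟩ := (h.during hi).exists_path h.2.1.le
  refine ⟨hp, ?_⟩
  have hs := a.step l h.2.1
  rw [h.2.2.1] at hs
  generalize a.conf (l + 1) = c' at hs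
  cases hs with
  | respond _ o' _ h' =>
    rw [h'] at h1
    obtain ⟨rfl, rfl⟩ := by simpa using h1
    exact h2

theorem exists_during {t : ℕ} (ht : (t : ℕ∞) ≤ a.len) {p : Fin n} {o : Op}
    {c : Prog I.base Resp} (h : (a.conf t).proc p = some (o, c)) : ∃ i, a.During i p o t := by
  induction t generalizing c with
  | zero => simp [a.start, initial] at h
  | succ t ih =>
    have ht' : (t : ℕ∞) < a.len := lt_len_of_lt (Nat.lt_succ_self t) ht
    have hs := a.step t ht'
    by_cases hi : a.ev t = .invoke p o
    · exact ⟨t, ⟨ht', hi⟩, Nat.lt_succ_self t, fun w h1 h2 => by omega⟩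
    have key : (∃ c, (a.conf t).proc p = some (o, c)) ∧ ∀ x, a.ev t ≠ .respond p x := by
      generalize a.ev t = e at hs hi
      generalize a.conf (t + 1) = c' at hs h
      have upd : ∀ {q : Fin n} {x : Option (Op × Prog I.base Resp)}, q ≠ p →
          Function.update (a.conf t).proc q x p = some (o, c) →
          ∃ c, (a.conf t).proc p = some (o, c) := fun hq h => by
        rw [Function.update_of_ne (Ne.symm hq)] at h
        exact ⟨c, h⟩
      cases hs with
      | invoke q o' hq h' =>
        have hqp : q ≠ p := by
          rintro rfl
          dsimp only at h
          rw [Function.update_self] at h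
          simp only [Option.some.injEq, Prod.mk.injEq] at h
          exact hi (by rw [h.1])
        exact ⟨upd hqp h, by simp⟩
      | respond q o' x h' =>
        have hqp : q ≠ p := by
          rintro rfl
          dsimp only at h
          rw [Function.update_self] at h
          simp at h
        exact ⟨upd hqp h, by simp [hqp]⟩
      | _ q o' =>
        refine ⟨?_, by simp⟩
        by_cases hqp : q = p
        · subst hqp
          dsimp only at h
          rw [Function.update_self] at h
          simp only [Option.some.injEq, Prod.mk.injEq] at h
          obtain ⟨rfl, -⟩ := h
          exact ⟨_, ‹_›⟩
        · exact upd hqp h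
    obtain ⟨⟨c, hc⟩, hr⟩ := key
    obtain ⟨i, h1, h2, h3⟩ := ih ht'.le hc
    refine ⟨i, h1, by omega, fun w h4 h5 => ?_⟩
    rcases (show w ≤ t by omega).eq_or_lt with rfl | h5
    · exact hr
    · exact h3 w h4 h5

/-- Every primitive is applied on behalf of some operation. -/
theorem exists_at {u : ℕ} {p : Fin n} {A : Act I.base} (h : a.history.act u = some (p, A)) :
    ∃ i o hp, a.During i p o u ∧ a.history.At p (i + 1) (I.code p o hp) u A := by
  obtain ⟨-, o, c, h1, h2⟩ := ev_of_act h
  have hu := lt_len_of_act h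
  obtain ⟨i, hi⟩ := exists_during hu.le h1
  obtain ⟨hp, d, h3, h4⟩ := hi.exists_path hu.le
  rw [h1] at h3
  obtain ⟨-, rfl⟩ := by simpa using h3
  exact ⟨i, o, hp, hi, c, h4, h2⟩

/-- Operations of the same process do not overlap. -/
theorem During.unique {i i' u : ℕ} {p : Fin n} {o o' : Op} (h : a.During i p o u)
    (h' : a.During i' p o' u) : i = i' := by
  have key : ∀ {i i' : ℕ} {o o' : Op}, a.During i p o u → a.During i' p o' u → ¬ i < i' := by
    intro i i' o o' h h' hlt
    obtain ⟨hp, d, h1, -⟩ := (h.mono hlt h'.2.1.le).exists_path (le_of_lt h'.1.1)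
    have hs := a.step i' h'.1.1
    rw [h'.1.2] at hs
    generalize a.conf (i' + 1) = c' at hs
    cases hs with
    | invoke _ _ _ h2 => rw [h2] at h1; simp at h1
  have := key h h'
  have := key h' h
  omega

/-- The set of accesses might a priori be infinite. If it had more than `N` elements, `N + 1` of
them would occur on the finite path up to the last of these, which contradicts `Path.cost`. -/
theorem encard_accesses_le {t : ℕ} {p : Fin n} {o : Op} (h : a.Invokes t p o) {N : ℕ}
    (hN : ∀ hp, (I.code p o hp).CostLE N) : (a.accesses t p).encard ≤ N := by
  classical
  by_contra! hc
  obtain ⟨F, hF, hcard⟩ := Set.exists_subset_encard_eq (Order.add_one_le_of_lt hc)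
  have hfin : F.Finite := Set.finite_of_encard_eq_coe (k := N + 1) (by simpa using hcard)
  have hne : hfin.toFinset.Nonempty := by
    rw [Set.Finite.toFinset_nonempty, ← Set.encard_pos, hcard]
    simp
  set w := hfin.toFinset.max' hne
  have hw : w ∈ F := (Set.Finite.mem_toFinset hfin).1 (Finset.max'_mem _ _)
  obtain ⟨h1, h2, h3, h4⟩ := hF hw
  have hd : a.During t p o (w + 1) := ⟨h, by omega, fun u hu hu' x => by
    rcases (show u ≤ w by omega).eq_or_lt with rfl | hu'
    · simp [h3]
    · exact h4 u hu hu' x⟩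
  obtain ⟨hp, d, -, hpath⟩ := hd.exists_path (succ_le h2)
  obtain ⟨N', -, hcost⟩ := hpath.cost (hN hp)
  have hsub : hfin.toFinset ⊆
      (Finset.Ico (t + 1) (w + 1)).filter fun s => ∃ A, a.history.act s = some (p, A) := by
    intro s hs
    obtain ⟨hs1, hs2, hs3, -⟩ := hF ((Set.Finite.mem_toFinset hfin).1 hs)
    have := Finset.le_max' _ _ hs
    simp only [Finset.mem_filter, Finset.mem_Ico]
    exact ⟨⟨hs1, Nat.lt_succ_of_le this⟩, exists_act hs2 hs3⟩
  have := Finset.card_le_card hsub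
  have hcard' : hfin.toFinset.card = N + 1 := by
    rw [hfin.encard_eq_coe_toFinset_card] at hcard
    exact_mod_cast hcard
  omega

end Execution

theorem stepComplexity_le {o : Op} {N : ℕ} (hN : ∀ p hp, (I.code p o hp).CostLE N) :
    I.stepComplexity o ≤ N :=
  iSup_le fun _ => iSup_le fun _ => iSup_le fun p => iSup_le fun h =>
    Execution.encard_accesses_le h (hN p)

/-- The constructor at the head of the remaining code determines an enabled step. Without a
response, every step of `p` after the invocation is an access, and the cost bound allows only
finitely many of those. -/
theorem waitFree_of_costLE (h : ∀ o, ∃ N, ∀ p hp, (I.code p o hp).CostLE N) : I.WaitFree := by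
  intro a
  refine ⟨fun t p _ hp => ?_, fun t p o hi hinf => ?_⟩
  · obtain ⟨⟨o, c⟩, hc⟩ := Option.ne_none_iff_exists'.1 hp
    cases c with
    | ret x => exact ⟨_, _, rfl, .respond _ p o x hc⟩
    | read r k => exact ⟨_, _, rfl, .read _ p o r k hc⟩
    | ll r k => exact ⟨_, _, rfl, .ll _ p o r k hc⟩
    | sc r v k =>
      by_cases hl : p ∈ (a.conf t).linked r
      · exact ⟨_, _, rfl, .scSuccess _ p o r v k hc hl⟩
      · exact ⟨_, _, rfl, .scFailure _ p o r v k hc hl⟩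
    | write r hw v k => exact ⟨_, _, rfl, .write _ p o r hw v k hc⟩
  · obtain ⟨N, hN⟩ := h o
    by_cases hex : ∃ l, t < l ∧ (l : ℕ∞) < a.len ∧ ∃ x, a.ev l = .respond p x
    · classical
      obtain ⟨h1, h2, x, h3⟩ := Nat.find_spec hex
      refine ⟨_, x, h1, h2, h3, fun u hu hul x' hx' => Nat.find_min hex hul ⟨hu, ?_, x', hx'⟩⟩
      exact Execution.lt_len_of_le hul.le h2
    · exfalso
      refine hinf (((Set.finite_Iic t).union
        (Set.finite_of_encard_le_coe (Execution.encard_accesses_le hi (hN p)))).subset ?_)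
      rintro u ⟨hu, hup⟩
      rcases le_or_gt u t with hut | hut
      · exact .inl hut
      · right
        have hno : ∀ w, t < w → (w : ℕ∞) < a.len → ∀ x, a.ev w ≠ .respond p x :=
          fun w h1 h2 x hx => hex ⟨w, h1, h2, x, hx⟩
        have hno' : ∀ w, t < w → w < u → ∀ x, a.ev w ≠ .respond p x := fun w h1 h2 =>
          hno w h1 (Execution.lt_len_of_le h2.le hu)
        refine ⟨hut, hu, ?_, hno'⟩
        obtain ⟨_, d, h1, -⟩ := Execution.During.exists_path (u := u) ⟨hi, hut, hno'⟩ hu.le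
        have hs := a.step u hu
        have hu' := hno u hut hu
        generalize a.ev u = e at hs hup hu'
        generalize a.conf (u + 1) = c' at hs
        cases hs with
        | invoke q o' _ h' =>
          obtain rfl : q = p := hup
          rw [h'] at h1; simp at h1
        | respond q o' x _ =>
          obtain rfl : q = p := hup
          exact (hu' x rfl).elim
        | _ q =>
          obtain rfl : q = p := hup
          rfl

end Implementation

/-! ## Runs of the code of λ-Snap -/

namespace LSnap

variable {n lam m : ℕ} {V : Type}

section

variable (H : History n (base lam m V))

/-- The value of `seq`. -/
def seqAt (t : ℕ) : ℕ := H.mem t .seq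

/-- The value of `values[j]`. -/
def valAt (j : Fin m) (t : ℕ) : ValueStruct V := H.mem t (.values j)

/-- The value of `pre_values[i][j]`. -/
def preAt (i : Fin lam) (j : Fin m) (t : ℕ) : PreValueStruct V := H.mem t (.preValues i j)

/-- The value of `s_table[i]`. -/
def tableAt (i : Fin lam) (t : ℕ) : ScanStruct := H.mem t (.sTable i)

/-- Process `p` executes `saveRound i j` within `[t, u)`. -/
def Saves (p : Fin n) (i : Fin lam) (j : Fin m) (t u : ℕ) : Prop :=
  ∃ b x z, t ≤ b ∧ b < x ∧ x < z ∧ z < u ∧ H.act b = some (p, .ll (.preValues i j)) ∧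
    ((valAt H j x).seq < (tableAt H i z).seq → ∃ e, z < e ∧ e < u ∧
      H.act e = some (p, .sc (.preValues i j) ⟨(valAt H j x).value, (valAt H j x).seq⟩))

/-- Process `p` is about to apply the `SC` of `saveRound i j`. -/
def SaveSC (p : Fin n) (i : Fin lam) (j : Fin m) (u : ℕ) (X : Act (base lam m V)) : Prop :=
  ∃ b x z, b < x ∧ x < z ∧ z < u ∧ H.act b = some (p, .ll (.preValues i j)) ∧
    (∀ s, b < s → s < u → H.act s ≠ some (p, .ll (.preValues i j))) ∧
    (valAt H j x).seq < (tableAt H i z).seq ∧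
    X = .sc (.preValues i j) ⟨(valAt H j x).value, (valAt H j x).seq⟩

/-- Process `p` is about to apply the `SC` on `values[j]` of `applyUpdate j`. -/
def ApplySC (p : Fin n) (j : Fin m) (u : ℕ) (X : Act (base lam m V)) : Prop :=
  ∃ l τ x w, l < τ ∧ τ < x ∧ x < u ∧ H.act l = some (p, .ll (.values j)) ∧
    (∀ s, l < s → s < u → H.act s ≠ some (p, .ll (.values j))) ∧
    (valAt H j x).proposed = some w ∧ X = .sc (.values j) ⟨some w, none, seqAt H τ⟩ ∧
    ∀ i, ∃ s, Saves H p i j (τ + 1) s ∧ Saves H p i j s u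

/-- A property of all complete runs of `applyUpdate j` within `[t, u)`: a proposal that is found is
not left in place. -/
def Completes (j : Fin m) (t u : ℕ) : Prop :=
  ∃ l, t ≤ l ∧ l < u ∧ ((valAt H j l).proposed = none ∨ ∃ w, l < w ∧ w < u ∧ H.Mod (.values j) w)

/-- Process `p` is about to apply the `SC` on `values[j]` of `update j v`. -/
def ProposeSC (p : Fin n) (j : Fin m) (v : V) (u : ℕ) (X : Act (base lam m V)) : Prop :=
  ∃ l, l < u ∧ H.act l = some (p, .ll (.values j)) ∧
    (∀ s, l < s → s < u → H.act s ≠ some (p, .ll (.values j))) ∧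
    (valAt H j l).proposed = none ∧
    X = .sc (.values j) ⟨(valAt H j l).value, some v, (valAt H j l).seq⟩

/-- An iteration of the main loop of `update j v` within `[t, u)` in which the proposal fails. -/
def FailedRound (j : Fin m) (t u : ℕ) : Prop :=
  ∃ b x, t ≤ b ∧ b < x ∧ x ≤ u ∧
    ((valAt H j b).proposed ≠ none ∨ ∃ w, b < w ∧ w < x ∧ H.Mod (.values j) w) ∧
    Completes H j x u

/-- A property of all complete runs of `helpScanner i` within `[t, u)`: if the scanner `i` needs a
sequence number, then it gets one. -/
def Helps (i : Fin lam) (t u : ℕ) : Prop :=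
  ∃ b x, t ≤ b ∧ b < x ∧ x < u ∧ (seqAt H x + 2 ≤ (tableAt H i b).seq ∨
    (tableAt H i b).writeEnable = false ∨ ∃ w, b < w ∧ w < u ∧ H.Mod (.sTable i) w)

/-- Process `p` is about to apply the `SC` of `helpScanner i`. -/
def HelpSC (p : Fin n) (i : Fin lam) (u : ℕ) (X : Act (base lam m V)) : Prop :=
  ∃ b z, b < z ∧ z < u ∧ H.act b = some (p, .ll (.sTable i)) ∧
    (∀ s, b < s → s < u → H.act s ≠ some (p, .ll (.sTable i))) ∧
    (tableAt H i b).writeEnable = true ∧ X = .sc (.sTable i) ⟨seqAt H z + 2, false⟩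

/-- Process `p` is about to apply the `SC` on `seq` of `seqRound`. -/
def SeqSC (p : Fin n) (u : ℕ) (X : Act (base lam m V)) : Prop :=
  ∃ l, l < u ∧ H.act l = some (p, .ll .seq) ∧
    (∀ s, l < s → s < u → H.act s ≠ some (p, .ll .seq)) ∧
    (∀ i, Helps H i (l + 1) u) ∧ X = .sc .seq (seqAt H l + 1 : ℕ)

/-- A property of all complete runs of `seqRound` within `[t, u)`. -/
def Advances (t u : ℕ) : Prop :=
  ∃ l w, t ≤ l ∧ l ≤ w ∧ w < u ∧ H.Mod .seq w ∧ ∀ i, Helps H i l u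

/-- A property of all complete runs of `collect i j` within `[t, u)` that return `x`. -/
def Collects (i : Fin lam) (j : Fin m) (t u : ℕ) (x : Option V) : Prop :=
  ∃ s d₁ d₂ d₃, Completes H j t s ∧ s ≤ d₁ ∧ d₁ < d₂ ∧ d₂ < d₃ ∧ d₃ < u ∧
    x = if (valAt H j d₁).seq < (tableAt H i d₃).seq then (valAt H j d₁).value
      else (preAt H i j d₂).value

end

/-! ### What complete and partial runs of each procedure do -/

variable {H : History n (base lam m V)} {p : Fin n} {t u : ℕ}

/-- The helping principle: a successful `SC` is itself the change, and a failed one is due to an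
earlier change. -/
theorem exists_mod_of_sc {r : Reg lam m} {v : Val V r} {b e : ℕ}
    (hb : H.act b = some (p, .ll r)) (hbe : b < e) (he : H.act e = some (p, .sc r v)) :
    ∃ w, b < w ∧ w ≤ e ∧ H.Mod r w := by
  by_cases hl : p ∈ H.linked e r
  · exact ⟨e, hbe, le_rfl, p, v, .inl ⟨he, hl⟩⟩
  · obtain ⟨w, h1, h2, h3⟩ := H.exists_mod_of_not_linked hb hbe hl
    exact ⟨w, h1, h2.le, h3⟩

theorem all_saveRound {P : Act (base lam m V) → Prop} {i : Fin lam} {j : Fin m}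
    (h1 : P (.ll (.preValues i j))) (h2 : P (.read (.values j))) (h3 : P (.read (.sTable i)))
    (h4 : ∀ v, P (.sc (.preValues i j) v)) : (saveRound (V := V) i j).All P := by
  unfold saveRound
  refine .andThen (.doLL h1) fun _ => .andThen (.doRead h2) fun cur => .andThen (.doRead h3)
    fun st => ?_
  split
  · exact .andThen (.doSC (h4 _)) fun _ => trivial
  · trivial

theorem all_applyUpdate {P : Act (base lam m V) → Prop} {j : Fin m}
    (h0 : P (.ll (.values j)))
    (h1 : ∀ i, P (.ll (.preValues i j))) (h2 : ∀ r, P (.read r))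
    (h4 : ∀ i v, P (.sc (.preValues i j) v)) (h5 : ∀ v s, P (.sc (.values j) ⟨some v, none, s⟩)) :
    (applyUpdate (lam := lam) (V := V) j).All P := by
  unfold applyUpdate
  refine .andThen (.doLL h0) fun _ => .andThen (.doRead (h2 _)) fun s =>
    .andThen (.foldlM (fun _ i => .andThen (all_saveRound (h1 i) (h2 _) (h2 _) (h4 i)) fun _ =>
      all_saveRound (h1 i) (h2 _) (h2 _) (h4 i)) _ _) fun cur => ?_
  split
  · trivial
  · exact .andThen (.doSC (h5 _ _)) fun _ => trivial

theorem run_saveRound {i : Fin lam} {j : Fin m} {y : ValueStruct V}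
    (h : H.Run p t (saveRound i j) u y) :
    Saves H p i j t u ∧ ∃ x, t ≤ x ∧ x < u ∧ y = valAt H j x := by
  unfold saveRound at h
  obtain ⟨b, hb1, hb2, hb, -, h⟩ := h.ll_then
  obtain ⟨x, hx1, hx2, hx, h⟩ := h.read_then
  obtain ⟨z, hz1, hz2, hz, h⟩ := h.read_then
  split at h
  · obtain ⟨e, _, he1, he2, he, -, -, h⟩ := h.sc_then
    exact ⟨⟨b, x, z, by omega, by omega, by omega, by omega, hb,
      fun _ => ⟨e, by omega, by omega, he⟩⟩, x, by omega, by omega, h.ret_eq⟩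
  · exact ⟨⟨b, x, z, by omega, by omega, by omega, by omega, hb, fun hc => absurd hc ‹_›⟩,
      x, by omega, by omega, h.ret_eq⟩

/-- Only primitives that may change a register matter, hence the exclusion of `read` and `ll` in
this and the following lemmas of this kind. The absence of a further `LL` is what `not_mod_between`
will ask for. -/
theorem at_saveRound {i : Fin lam} {j : Fin m} {X : Act (base lam m V)} (hX : ∀ r, X ≠ .read r)
    (hX' : ∀ r, X ≠ .ll r) (h : H.At p t (saveRound i j) u X) : SaveSC H p i j u X := by
  unfold saveRound at h
  obtain ⟨b, hb1, hb2, hb, -, h⟩ := h.ll_then.resolve_left (hX' _)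
  have hno : ∀ s, b < s → s < u → H.act s ≠ some (p, .ll (.preValues i j)) := by
    intro s h1 h2 hs
    refine h.all_before (P := fun A => A ≠ .ll (Reg.preValues i j)) ?_ h1 h2 hs rfl
    refine .andThen (.doRead (by simp)) fun cur => .andThen (.doRead (by simp)) fun st => ?_
    split
    · exact .andThen (.doSC (by simp)) fun _ => trivial
    · trivial
  obtain ⟨x, hx1, hx2, hx, h⟩ := h.read_then.resolve_left (hX _)
  obtain ⟨z, hz1, hz2, hz, h⟩ := h.read_then.resolve_left (hX _)
  split at h
  · rcases h.sc_then with ⟨rfl, -⟩ | ⟨e, _, -, -, -, -, -, h⟩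
    · exact ⟨b, x, z, by omega, by omega, by omega, hb, hno, ‹_›, rfl⟩
    · exact (h.not_ret).elim
  · exact (h.not_ret).elim

/-- Suppose that the `LL` sees a proposal. If the last read of the loop no longer finds it, the
register has changed; otherwise an `SC` is applied, and `exists_mod_of_sc` gives a change. Since `0
< lam`, the final `cur` really comes from a read inside the loop. -/
theorem run_applyUpdate (hlam : 0 < lam) {j : Fin m} {y : Unit}
    (h : H.Run p t (applyUpdate (lam := lam) j) u y) : Completes H j t u := by
  unfold applyUpdate at h
  obtain ⟨l, hl1, hl2, hl, -, h⟩ := h.ll_then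
  obtain ⟨τ, hτ1, hτ2, hτ, h⟩ := h.read_then
  obtain ⟨cur, s, h1, h⟩ := h.bind_cases
  obtain ⟨i, -, z, s1, s2, hs1, hs2, h1⟩ := h1.foldlM_result (by
    rw [Ne, ← List.length_eq_zero_iff, List.length_finRange]; omega)
  obtain ⟨_, s3, h3, h2⟩ := h1.bind_cases
  obtain ⟨-, x, hx1, hx2, rfl⟩ := run_saveRound h2
  have h3' := h3.le
  have hu := h.le
  by_cases hp : (valAt H j l).proposed = none
  · exact ⟨l, hl1, hl2, .inl hp⟩
  refine ⟨l, hl1, hl2, .inr ?_⟩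
  split at h
  · rename_i heq
    by_contra! hc
    exact hp ((congrArg ValueStruct.proposed (H.mem_eq (r := .values j) (show l ≤ x by omega)
      fun w h1 h2 hw => (h1.eq_or_lt.elim (fun h => H.not_mod_of_ll hl (h ▸ hw))
        fun h1 => hc w h1 (by omega) hw))).symm.trans heq)
  · obtain ⟨e, _, he1, he2, he, -, -, h⟩ := h.sc_then
    obtain ⟨w, h1, h2, h3⟩ := exists_mod_of_sc hl (by omega) he
    exact ⟨w, h1, by omega, h3⟩

theorem at_applyUpdate (hlam : 0 < lam) {j : Fin m} {X : Act (base lam m V)}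
    (hX : ∀ r, X ≠ .read r) (hX' : ∀ r, X ≠ .ll r)
    (h : H.At p t (applyUpdate (lam := lam) j) u X) :
    (∃ i, SaveSC H p i j u X) ∨ ApplySC H p j u X := by
  unfold applyUpdate at h
  obtain ⟨l, hl1, hl2, hl, -, h⟩ := h.ll_then.resolve_left (hX' _)
  have hno : ∀ s, l < s → s < u → H.act s ≠ some (p, .ll (.values j)) := by
    intro s h1 h2 hs
    refine h.all_before (P := fun A => A ≠ .ll (Reg.values j)) ?_ h1 h2 hs rfl
    refine .andThen (.doRead (by simp)) fun s => .andThen (.foldlM (fun _ i =>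
      .andThen (all_saveRound (by simp) (by simp) (by simp) (by simp)) fun _ =>
        all_saveRound (by simp) (by simp) (by simp) (by simp)) _ _) fun cur => ?_
    split
    · trivial
    · exact .andThen (.doSC (by simp)) fun _ => trivial
  obtain ⟨τ, hτ1, hτ2, hτ, h⟩ := h.read_then.resolve_left (hX _)
  rcases h.bind_cases with h | ⟨cur, s, h1, h⟩
  · left
    obtain ⟨i, -, y, s, hs, h⟩ := h.foldlM_cases
    rcases h.bind_cases with h | ⟨_, s, -, h⟩
    · exact ⟨i, at_saveRound hX hX' h⟩
    · exact ⟨i, at_saveRound hX hX' h⟩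
  · right
    have hu := h.le
    obtain ⟨i, -, z, s1, s2, hs1, hs2, h2⟩ := h1.foldlM_result (by
      rw [Ne, ← List.length_eq_zero_iff, List.length_finRange]; omega)
    obtain ⟨_, s3, h3, h2⟩ := h2.bind_cases
    obtain ⟨-, x, hx1, hx2, rfl⟩ := run_saveRound h2
    have h3' := h3.le
    split at h
    · exact h.not_ret.elim
    · rename_i v heq
      rcases h.sc_then with ⟨rfl, -⟩ | ⟨e, _, -, -, -, -, -, h⟩
      · refine ⟨l, τ, x, v, by omega, by omega, by omega, hl, hno, heq, rfl, fun i => ?_⟩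
        obtain ⟨z, z', s1, s2, hs1, hs2, h2⟩ := h1.foldlM_cases (List.mem_finRange i)
        obtain ⟨_, s3, h3, h2⟩ := h2.bind_cases
        obtain ⟨b, x, z, h4, h5, h6, h7, h8, h9⟩ := (run_saveRound h3).1
        obtain ⟨b', x', z', h4', h5', h6', h7', h8', h9'⟩ := (run_saveRound h2).1
        refine ⟨s3, ⟨b, x, z, by omega, h5, h6, h7, h8, h9⟩,
          b', x', z', h4', h5', h6', by omega, h8', fun hc => ?_⟩
        obtain ⟨e, he1, he2, he⟩ := h9' hc
        exact ⟨e, he1, by omega, he⟩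
      · exact h.not_ret.elim

/-- No `SC` of `applyUpdate` proposes a value. -/
def NoProposal (j : Fin m) (A : Act (base lam m V)) : Prop :=
  ∀ x v s, A ≠ .sc (.values j) ⟨x, some v, s⟩

theorem noProposal_applyUpdate {j j' : Fin m} :
    (applyUpdate (lam := lam) (V := V) j).All (NoProposal j') :=
  all_applyUpdate (by simp [NoProposal]) (by simp [NoProposal]) (by simp [NoProposal])
    (by simp [NoProposal]) (by
      rintro v s x w s' h
      simp only [Act.sc.injEq, Reg.values.injEq] at h
      obtain ⟨rfl, h⟩ := h
      simp at h)

/-- Either the proposal succeeds, or the iteration fails. In the second case the clause on links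
says that no proposal of `p` took effect in this iteration, which keeps performed and overwritten
updates apart. -/
theorem run_updateLoop_succ (hlam : 0 < lam) {j : Fin m} {v : V} {k : ℕ} {y : Unit}
    (h : H.Run p t (updateLoop (lam := lam) j v (k + 1)) u y) :
    (∃ π, t ≤ π ∧ π < u ∧ Completes H j (π + 1) u ∧
      ∃ x s, H.ModBy (.values j) π p ⟨x, some v, s⟩) ∨
    ∃ s, t ≤ s ∧ FailedRound H j t s ∧ (∀ s', t ≤ s' → s' < s → ∀ x w q,
      H.act s' = some (p, .sc (.values j) ⟨x, some w, q⟩) → p ∉ H.linked s' (.values j)) ∧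
      H.Run p s (updateLoop (lam := lam) j v k) u y := by
  unfold updateLoop at h
  obtain ⟨b, hb1, hb2, hb, idle, h⟩ := h.ll_then
  have upto : ∀ s, t ≤ s → s ≤ b → ∀ x w q,
      H.act s ≠ some (p, .sc (.values j) ⟨x, some w, q⟩) := by
    intro s h1 h2 x w q
    rcases h2.eq_or_lt with rfl | h2
    · rw [hb]; simp
    · exact idle s h1 h2 _
  split at h
  · obtain ⟨e, ok, he1, he2, he, hok, idle', h⟩ := h.sc_then
    split at h
    · exact .inl ⟨e, by omega, he2, run_applyUpdate hlam h, _, _, .inl ⟨he, hok.1 ‹_›⟩⟩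
    · right
      obtain ⟨_, s, h1, h⟩ := h.bind_cases
      obtain ⟨w, hw1, hw2, hw⟩ := exists_mod_of_sc hb (by omega) he
      have := h1.le
      refine ⟨s, by omega, ⟨b, e + 1, hb1, by omega, h1.le, .inr ⟨w, hw1, by omega, hw⟩,
        run_applyUpdate hlam h1⟩, fun s' h2 h3 x w q hq => ?_, h⟩
      rcases le_or_gt s' b with h4 | h4
      · exact (upto s' h2 h4 x w q hq).elim
      rcases lt_or_ge s' e with h5 | h5
      · exact (idle' s' h4 h5 _ hq).elim
      rcases h5.eq_or_lt with rfl | h5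
      · simpa [hok] using ‹¬ ok = true›
      · exact (h1.all (noProposal_applyUpdate (j' := j)) h5 h3 hq x w q rfl).elim
  · right
    rename_i heq
    obtain ⟨_, s, h1, h⟩ := h.bind_cases
    have := h1.le
    refine ⟨s, by omega, ⟨b, b + 1, hb1, by omega, h1.le, .inl ?_, run_applyUpdate hlam h1⟩,
      fun s' h2 h3 x w q hq => ?_, h⟩
    · rw [Ne, show (valAt H j b).proposed = _ from heq]
      simp
    · rcases le_or_gt s' b with h4 | h4
      · exact (upto s' h2 h4 x w q hq).elim
      · exact (h1.all (noProposal_applyUpdate (j' := j)) h4 h3 hq x w q rfl).elim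

/-- The extra clause for `ProposeSC` holds because after a successful proposal only `applyUpdate`
remains, which never proposes. It makes the effective proposal of an operation unique. -/
theorem at_updateLoop (hlam : 0 < lam) {j : Fin m} {v : V} {k : ℕ} {X : Act (base lam m V)}
    (hX : ∀ r, X ≠ .read r) (hX' : ∀ r, X ≠ .ll r)
    (h : H.At p t (updateLoop (lam := lam) j v k) u X) :
    (∃ i, SaveSC H p i j u X) ∨ ApplySC H p j u X ∨ ProposeSC H p j v u X ∧
      ∀ s, t ≤ s → s < u → ∀ x w q, H.act s = some (p, .sc (.values j) ⟨x, some w, q⟩) →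
        p ∉ H.linked s (.values j) := by
  induction k generalizing t with
  | zero => exact h.not_ret.elim
  | succ k ih =>
    unfold updateLoop at h
    obtain ⟨b, hb1, hb2, hb, idle, h⟩ := h.ll_then.resolve_left (hX' _)
    have upto : ∀ s, t ≤ s → s ≤ b → ∀ x w q,
        H.act s ≠ some (p, .sc (.values j) ⟨x, some w, q⟩) := by
      intro s h1 h2 x w q
      rcases h2.eq_or_lt with rfl | h2
      · rw [hb]; simp
      · exact idle s h1 h2 _
    -- Common continuation of the two failing branches (a foreign proposal was seen, or the `SC`
    -- failed); `c` is where `applyUpdate` starts.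
    have rest : ∀ {c : ℕ}, b < c → (∀ s, b < s → s < c → s < u → ∀ x w q,
          H.act s = some (p, .sc (.values j) ⟨x, some w, q⟩) → p ∉ H.linked s (.values j)) →
        H.At p c (applyUpdate (lam := lam) j >>= fun _ => updateLoop (lam := lam) j v k) u X →
        (∃ i, SaveSC H p i j u X) ∨ ApplySC H p j u X ∨ ProposeSC H p j v u X ∧
      ∀ s, t ≤ s → s < u → ∀ x w q, H.act s = some (p, .sc (.values j) ⟨x, some w, q⟩) →
        p ∉ H.linked s (.values j) := by
      intro c hbc hc h
      rcases h.bind_cases with h | ⟨_, s1, h1, h⟩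
      · exact (at_applyUpdate hlam hX hX' h).imp_right .inl
      · refine (ih h).imp_right (.imp_right (.imp_right fun hs s hts hsu x w q hq => ?_))
        rcases le_or_gt s b with h2 | h2
        · exact (upto s hts h2 x w q hq).elim
        rcases lt_or_ge s c with h3 | h3
        · exact hc s h2 h3 hsu x w q hq
        rcases lt_or_ge s s1 with h4 | h4
        · exact (h1.all (noProposal_applyUpdate (j' := j)) h3 h4 hq x w q rfl).elim
        · exact hs s h4 hsu x w q hq
    split at h
    · rename_i heq
      rcases h.sc_then with ⟨rfl, idle'⟩ | ⟨e, ok, he1, he2, he, hok, idle', h'⟩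
      · refine .inr (.inr ⟨⟨b, hb2, hb, fun s h1 h2 hs => ?_, heq, rfl⟩,
          fun s h1 h2 x w q hq => ?_⟩)
        · exact idle' s h1 h2 _ hs
        · rcases le_or_gt s b with h3 | h3
          · exact (upto s h1 h3 x w q hq).elim
          · exact (idle' s h3 h2 _ hq).elim
      · clear h
        split at h'
        · exact (at_applyUpdate hlam hX hX' h').imp_right .inl
        · refine rest (by omega) (fun s h1 h2 hsu x w q hq => ?_) h'
          rcases (show s ≤ e by omega).eq_or_lt with rfl | h2
          · simpa [hok] using ‹¬ ok = true›
          · exact (idle' s h1 h2 _ hq).elim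
    · exact rest (Nat.lt_succ_self b) (fun s h1 h2 => by omega) h

theorem run_helpScanner {i : Fin lam} {y : Unit}
    (h : H.Run p t (helpScanner (m := m) (V := V) i) u y) : Helps H i t u := by
  unfold helpScanner at h
  obtain ⟨b, hb1, hb2, hb, -, h⟩ := h.ll_then
  obtain ⟨x, hx1, hx2, hx, h⟩ := h.read_then
  split at h
  · obtain ⟨z, hz1, hz2, hz, h⟩ := h.read_then
    obtain ⟨e, _, he1, he2, he, -, -, h⟩ := h.sc_then
    obtain ⟨w, h1, h2, h3⟩ := exists_mod_of_sc hb (by omega) he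
    exact ⟨b, x, hb1, by omega, hx2, .inr (.inr ⟨w, h1, by omega, h3⟩)⟩
  · rename_i hc
    change ¬ ((tableAt H i b).seq < seqAt H x + 2 ∧ (tableAt H i b).writeEnable = true) at hc
    refine ⟨b, x, hb1, by omega, hx2, ?_⟩
    by_cases hw : (tableAt H i b).writeEnable = true
    · exact .inl (Nat.le_of_not_lt fun h => hc ⟨h, hw⟩)
    · exact .inr (.inl (by simpa using hw))

theorem at_helpScanner {i : Fin lam} {X : Act (base lam m V)}
    (hX : ∀ r, X ≠ .read r) (hX' : ∀ r, X ≠ .ll r)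
    (h : H.At p t (helpScanner i) u X) : HelpSC H p i u X := by
  unfold helpScanner at h
  obtain ⟨b, hb1, hb2, hb, -, h⟩ := h.ll_then.resolve_left (hX' _)
  have hno : ∀ s, b < s → s < u → H.act s ≠ some (p, .ll (.sTable i)) := by
    intro s h1 h2 hs
    refine h.all_before (P := fun A => A ≠ .ll (Reg.sTable i)) ?_ h1 h2 hs rfl
    refine .andThen (.doRead (by simp)) fun cur => ?_
    split
    · exact .andThen (.doRead (by simp)) fun _ => .andThen (.doSC (by simp)) fun _ => trivial
    · trivial
  obtain ⟨x, hx1, hx2, hx, h⟩ := h.read_then.resolve_left (hX _)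
  split at h
  · rename_i hc
    obtain ⟨z, hz1, hz2, hz, h⟩ := h.read_then.resolve_left (hX _)
    rcases h.sc_then with ⟨rfl, -⟩ | ⟨e, _, -, -, -, -, -, h⟩
    · exact ⟨b, z, by omega, by omega, hb, hno, hc.2, rfl⟩
    · exact h.not_ret.elim
  · exact h.not_ret.elim

/-- `seq` changes during the round no matter whether the final `SC` on it succeeds. -/
theorem run_seqRound {y : Unit} (h : H.Run p t seqRound u y) : Advances H t u := by
  unfold seqRound at h
  obtain ⟨l, hl1, hl2, hl, -, h⟩ := h.ll_then
  obtain ⟨_, s, h1, h⟩ := h.bind_cases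
  obtain ⟨e, _, he1, he2, he, -, -, h⟩ := h.sc_then
  obtain ⟨w, h2, h3, h4⟩ := exists_mod_of_sc hl (by have := h1.le; omega) he
  refine ⟨l, w, hl1, h2.le, by omega, h4, fun i => ?_⟩
  obtain ⟨s1, s2, hs1, hs2, h5⟩ := h1.forM_cases (List.mem_finRange i)
  obtain ⟨b, x, h6, h7, h8, h9⟩ := run_helpScanner h5
  refine ⟨b, x, by omega, h7, by omega, h9.imp_right (.imp_right ?_)⟩
  rintro ⟨w, h10, h11, h12⟩
  exact ⟨w, h10, by omega, h12⟩

theorem at_seqRound {X : Act (base lam m V)} (hX : ∀ r, X ≠ .read r) (hX' : ∀ r, X ≠ .ll r)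
    (h : H.At p t seqRound u X) : (∃ i, HelpSC H p i u X) ∨ SeqSC H p u X := by
  unfold seqRound at h
  obtain ⟨l, hl1, hl2, hl, -, h⟩ := h.ll_then.resolve_left (hX' _)
  have hno : ∀ s, l < s → s < u → H.act s ≠ some (p, .ll .seq) := by
    intro s h1 h2 hs
    refine h.all_before (P := fun A => A ≠ .ll Reg.seq) ?_ h1 h2 hs rfl
    refine .andThen (.forM (fun i => ?_) _) fun _ => .andThen (.doSC (by simp)) fun _ => trivial
    unfold helpScanner
    refine .andThen (.doLL (by simp)) fun cur => .andThen (.doRead (by simp)) fun _ => ?_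
    split
    · exact .andThen (.doRead (by simp)) fun _ => .andThen (.doSC (by simp)) fun _ => trivial
    · trivial
  rcases h.bind_cases with h | ⟨_, s, h1, h⟩
  · obtain ⟨i, -, s, -, h⟩ := h.forM_cases
    exact .inl ⟨i, at_helpScanner hX hX' h⟩
  · have hsu := h.le
    rcases h.sc_then with ⟨rfl, -⟩ | ⟨e, _, -, -, -, -, -, h⟩
    · refine .inr ⟨l, hl2, hl, hno, fun i => ?_, rfl⟩
      obtain ⟨s1, s2, hs1, hs2, h5⟩ := h1.forM_cases (List.mem_finRange i)
      obtain ⟨b, x, h6, h7, h8, h9⟩ := run_helpScanner h5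
      refine ⟨b, x, by omega, h7, by omega, h9.imp_right (.imp_right ?_)⟩
      rintro ⟨w, h10, h11, h12⟩
      exact ⟨w, h10, by omega, h12⟩
    · exact h.not_ret.elim

theorem run_collect (hlam : 0 < lam) {i : Fin lam} {j : Fin m} {y : Option V}
    (h : H.Run p t (collect i j) u y) : Collects H i j t u y := by
  unfold collect at h
  obtain ⟨_, s, h1, h⟩ := h.bind_cases
  obtain ⟨d₁, h2, h3, -, h⟩ := h.read_then
  obtain ⟨d₂, h4, h5, -, h⟩ := h.read_then
  obtain ⟨d₃, h6, h7, -, h⟩ := h.read_then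
  exact ⟨s, d₁, d₂, d₃, run_applyUpdate hlam h1, h2, by omega, by omega, h7, h.ret_eq⟩

theorem at_collect (hlam : 0 < lam) {i : Fin lam} {j : Fin m} {X : Act (base lam m V)}
    (hX : ∀ r, X ≠ .read r) (hX' : ∀ r, X ≠ .ll r) (h : H.At p t (collect i j) u X) :
    (∃ i, SaveSC H p i j u X) ∨ ApplySC H p j u X := by
  unfold collect at h
  rcases h.bind_cases with h | ⟨_, s, h1, h⟩
  · exact at_applyUpdate hlam hX hX' h
  obtain ⟨d₁, -, -, -, h⟩ := h.read_then.resolve_left (hX _)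
  obtain ⟨d₂, -, -, -, h⟩ := h.read_then.resolve_left (hX _)
  obtain ⟨d₃, -, -, -, h⟩ := h.read_then.resolve_left (hX _)
  exact h.not_ret.elim

/-- The entry of a component is the one stored by the last iteration for it, so the list need not be
free of duplicates. -/
theorem run_collectAll (hlam : 0 < lam) {i : Fin lam} {l : List (Fin m)}
    {x y : Fin m → Option V}
    (h : H.Run p t (l.foldlM (fun view j => do
      let x ← collect i j
      pure (Function.update view j x)) x) u y) (j : Fin m) :
    (j ∈ l → ∃ s s', t ≤ s ∧ s' ≤ u ∧ Collects H i j s s' (y j)) ∧ (j ∉ l → y j = x j) := by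
  induction l generalizing t x with
  | nil =>
    obtain rfl := History.Run.ret_eq h
    simp
  | cons j' l ih =>
    obtain ⟨z, s, h1, h⟩ := History.Run.bind_cases h
    have hsu := h.le
    obtain ⟨c, s', h2, h3⟩ := h1.bind_cases
    have hss := h3.le
    obtain rfl := History.Run.ret_eq h3
    obtain ⟨ih1, ih2⟩ := ih h
    have hts := h1.le
    refine ⟨fun hj => ?_, fun hj => ?_⟩
    · by_cases hjl : j ∈ l
      · obtain ⟨a, b, ha, hb, hc⟩ := ih1 hjl
        exact ⟨a, b, by omega, hb, hc⟩
      · obtain rfl : j = j' := by simpa [hjl] using hj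
        rw [ih2 hjl, Function.update_self]
        exact ⟨t, s', le_rfl, by omega, run_collect hlam h2⟩
    · simp only [List.mem_cons, not_or] at hj
      rw [ih2 hj.2, Function.update_of_ne hj.1]

/-- No primitive is a `Write`. -/
def NoWrite (A : Act (base lam m V)) : Prop := ∀ r v, A ≠ .write r v

theorem noWrite_seqRound : (seqRound (lam := lam) (m := m) (V := V)).All NoWrite := by
  unfold seqRound
  refine .andThen (.doLL (by simp [NoWrite])) fun _ => .andThen (.forM (fun i => ?_) _) fun _ =>
    .andThen (.doSC (by simp [NoWrite])) fun _ => trivial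
  unfold helpScanner
  refine .andThen (.doLL (by simp [NoWrite])) fun cur =>
    .andThen (.doRead (by simp [NoWrite])) fun _ => ?_
  split
  · exact .andThen (.doRead (by simp [NoWrite])) fun _ =>
      .andThen (.doSC (by simp [NoWrite])) fun _ => trivial
  · trivial

theorem noWrite_collect {i : Fin lam} {j : Fin m} : (collect (V := V) i j).All NoWrite := by
  unfold collect
  exact .andThen (all_applyUpdate (by simp [NoWrite]) (by simp [NoWrite]) (by simp [NoWrite])
    (by simp [NoWrite]) (by simp [NoWrite])) fun _ => .andThen (.doRead (by simp [NoWrite]))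
    fun _ => .andThen (.doRead (by simp [NoWrite])) fun _ => .andThen (.doRead (by simp [NoWrite]))
    fun _ => trivial

/-- The uniqueness of the write at `w` matters: afterwards `s_table[i]` can change only through
helpers until the `SCAN` is over. -/
theorem run_scan (hlam : 0 < lam) {i : Fin lam} {y : SnapResp m V} (h : H.Run p t (scan i) u y) :
    ∃ x w s₁ s₂ s₃, t ≤ x ∧ x < w ∧ H.act w = some (p, .write (.sTable i) ⟨seqAt H x, true⟩) ∧
      (∀ s, w < s → s < u → ∀ r v, H.act s ≠ some (p, .write r v)) ∧
      Advances H (w + 1) s₁ ∧ Advances H s₁ s₂ ∧ Advances H s₂ s₃ ∧ s₃ ≤ u ∧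
      ∃ view : Fin m → Option V, y = .view view ∧
        ∀ j, ∃ c c', s₃ ≤ c ∧ c' ≤ u ∧ Collects H i j c c' (view j) := by
  unfold scan at h
  obtain ⟨x, hx1, hx2, -, h⟩ := h.read_then
  obtain ⟨w, hw1, hw2, hw, h⟩ := h.write_then
  have hno : ∀ s, w < s → s < u → ∀ r v, H.act s ≠ some (p, .write r v) := by
    intro s h1 h2 r v hs
    refine h.all (P := NoWrite) ?_ h1 h2 hs r v rfl
    exact .andThen noWrite_seqRound fun _ => .andThen noWrite_seqRound fun _ =>
      .andThen noWrite_seqRound fun _ => .andThen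
        (.foldlM (fun _ _ => by exact .andThen noWrite_collect fun _ => trivial) _ _)
      fun _ => trivial
  obtain ⟨_, s₁, h1, h⟩ := h.bind_cases
  obtain ⟨_, s₂, h2, h⟩ := h.bind_cases
  obtain ⟨_, s₃, h3, h⟩ := h.bind_cases
  obtain ⟨view, s, h4, h⟩ := h.bind_cases
  have hsu := h.le
  have hs := h4.le
  refine ⟨x, w, s₁, s₂, s₃, hx1, hw1, hw, hno, run_seqRound h1, run_seqRound h2, run_seqRound h3,
    by omega, view, h.ret_eq, fun j => ?_⟩
  obtain ⟨a, b, ha, hb, hc⟩ := (run_collectAll hlam h4 j).1 (List.mem_finRange j)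
  exact ⟨a, b, ha, by omega, hc⟩

theorem at_scan (hlam : 0 < lam) {i : Fin lam} {X : Act (base lam m V)} (hX : ∀ r, X ≠ .read r)
    (hX' : ∀ r, X ≠ .ll r) (h : H.At p t (scan i) u X) :
    (∃ x, t ≤ x ∧ x < u ∧ X = .write (.sTable i) ⟨seqAt H x, true⟩) ∨ (∃ i, HelpSC H p i u X) ∨
      SeqSC H p u X ∨ ∃ j, (∃ i, SaveSC H p i j u X) ∨ ApplySC H p j u X := by
  unfold scan at h
  obtain ⟨x, hx1, hx2, -, h⟩ := h.read_then.resolve_left (hX _)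
  rcases h.write_then with rfl | ⟨w, hw1, hw2, -, h⟩
  · exact .inl ⟨x, hx1, hx2, rfl⟩
  have round : ∀ {s}, H.At p s seqRound u X → _ := fun {s} h =>
    Or.imp_right (Or.inl (b := ∃ j, (∃ i, SaveSC H p i j u X) ∨ ApplySC H p j u X))
      (at_seqRound hX hX' h)
  right
  rcases h.bind_cases with h | ⟨_, s₁, -, h⟩
  · exact round h
  rcases h.bind_cases with h | ⟨_, s₂, -, h⟩
  · exact round h
  rcases h.bind_cases with h | ⟨_, s₃, -, h⟩
  · exact round h
  rcases h.bind_cases with h | ⟨_, s₄, -, h⟩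
  · obtain ⟨j, -, _, s, -, h⟩ := h.foldlM_cases
    rcases h.bind_cases with h | ⟨_, s₃, -, h⟩
    · exact .inr (.inr ⟨j, at_collect hlam hX hX' h⟩)
    · exact h.not_ret.elim
  · exact h.not_ret.elim

theorem run_update (hlam : 0 < lam) {j : Fin m} {v : V} {y : SnapResp m V}
    (h : H.Run p t (update (lam := lam) j v) u y) : y = .ack ∧
    ((∃ π, t ≤ π ∧ π < u ∧ Completes H j (π + 1) u ∧
      ∃ x s, H.ModBy (.values j) π p ⟨x, some v, s⟩) ∨
    (∃ s, FailedRound H j t s ∧ FailedRound H j s u) ∧ ∀ s', t ≤ s' → s' < u → ∀ x w q,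
      H.act s' = some (p, .sc (.values j) ⟨x, some w, q⟩) → p ∉ H.linked s' (.values j)) := by
  unfold update at h
  obtain ⟨_, s₀, h1, h⟩ := h.bind_cases
  have hsu := h.le
  have mono : ∀ {a b : ℕ}, Completes H j a b → b ≤ u → Completes H j a u := by
    rintro a b ⟨l, h1, h2, h3⟩ hb
    refine ⟨l, h1, by omega, h3.imp_right ?_⟩
    rintro ⟨w, h4, h5, h6⟩
    exact ⟨w, h4, by omega, h6⟩
  refine ⟨h.ret_eq, ?_⟩
  rcases run_updateLoop_succ hlam h1 with ⟨π, h2, h3, h4, h5⟩ | ⟨s, h2, h3, f1, h1⟩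
  · exact .inl ⟨π, h2, by omega, mono h4 hsu, h5⟩
  · rcases run_updateLoop_succ hlam h1 with ⟨π, h4, h5, h6, h7⟩ | ⟨s', h4, h5, f2, h1⟩
    · exact .inl ⟨π, by omega, by omega, mono h6 hsu, h7⟩
    · have hs' := h1.le
      obtain ⟨b, x, h6, h7, h8, h9, h10⟩ := h5
      refine .inr ⟨⟨s, h3, b, x, h6, h7, by omega, h9, mono h10 (by omega)⟩,
        fun r h11 h12 x w q hq => ?_⟩
      rcases lt_or_ge r s with h13 | h13
      · exact f1 r h11 h13 x w q hq
      rcases lt_or_ge r s' with h14 | h14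
      · exact f2 r h13 h14 x w q hq
      rcases lt_or_ge r s₀ with h15 | h15
      · exact (h1.all (P := fun _ => False) trivial h14 h15 hq).elim
      · exact (h.all (P := fun _ => False) trivial h15 h12 hq).elim

theorem at_update (hlam : 0 < lam) {j : Fin m} {v : V} {X : Act (base lam m V)}
    (hX : ∀ r, X ≠ .read r) (hX' : ∀ r, X ≠ .ll r)
    (h : H.At p t (update (lam := lam) j v) u X) :
    (∃ i, SaveSC H p i j u X) ∨ ApplySC H p j u X ∨ ProposeSC H p j v u X ∧
      ∀ s, t ≤ s → s < u → ∀ x w q, H.act s = some (p, .sc (.values j) ⟨x, some w, q⟩) →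
        p ∉ H.linked s (.values j) := by
  unfold update at h
  rcases h.bind_cases with h | ⟨_, s, -, h⟩
  · exact at_updateLoop hlam hX hX' h
  · exact h.not_ret.elim

/-! ### Numbers of steps -/

theorem cost_saveRound {i : Fin lam} {j : Fin m} : (saveRound (V := V) i j).CostLE 4 := by
  unfold saveRound
  refine .andThen (N := 1) (N' := 3) .doLL fun _ => .andThen (N := 1) (N' := 2) .doRead fun _ =>
    .andThen (N := 1) (N' := 1) .doRead fun _ => ?_
  split
  · exact .andThen (N := 1) (N' := 0) .doSC fun _ => trivial
  · trivial

/-- Two rounds of at most 4 primitives for each scanner, plus the `LL`, the read of `seq` and the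
final `SC`. -/
theorem cost_applyUpdate {j : Fin m} :
    (applyUpdate (lam := lam) (V := V) j).CostLE (3 + 8 * lam) := by
  unfold applyUpdate
  refine .mono (.andThen (N := 1) (N' := 2 + 8 * lam) .doLL fun _ =>
    .mono (.andThen (N := 1) (N' := 1 + 8 * lam) .doRead fun _ => ?_) (by omega)) (by omega)
  refine .mono (.andThen (.foldlM (N := 8) (fun _ i => .andThen (N := 4) (N' := 4) cost_saveRound
    fun _ => cost_saveRound) _ _) fun cur => (?_ : Prog.CostLE _ 1))
      (by rw [List.length_finRange]; omega)
  split
  · trivial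
  · exact .andThen (N := 1) (N' := 0) .doSC fun _ => trivial

theorem cost_updateLoop {j : Fin m} {v : V} (k : ℕ) :
    (updateLoop (lam := lam) j v k).CostLE (k * (5 + 8 * lam)) := by
  induction k with
  | zero => exact trivial
  | succ k ih =>
    unfold updateLoop
    have h : (k + 1) * (5 + 8 * lam) = 1 + (1 + (3 + 8 * lam + k * (5 + 8 * lam))) := by ring
    rw [h]
    refine .andThen .doLL fun _ => ?_
    have h' := Prog.CostLE.andThen (cost_applyUpdate (lam := lam) (V := V) (j := j)) fun _ => ih
    split
    · refine .andThen .doSC fun ok => ?_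
      split
      · exact cost_applyUpdate.mono (by omega)
      · exact h'
    · exact h'.mono (by omega)

theorem cost_update (hlam : 0 < lam) {j : Fin m} {v : V} :
    (update (lam := lam) j v).CostLE (40 * lam) := by
  unfold update
  exact .mono (.andThen (N' := 0) (cost_updateLoop 2) fun _ => trivial) (by omega)

theorem cost_seqRound : (seqRound (lam := lam) (m := m) (V := V)).CostLE (2 + 4 * lam) := by
  unfold seqRound
  refine .mono (.andThen (N := 1) (N' := 1 + 4 * lam) .doLL fun _ => .mono (.andThen
    (.forM (N := 4) (fun i => ?_) _) fun _ => .andThen (N := 1) (N' := 0) .doSC fun _ => trivial)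
      (by rw [List.length_finRange]; omega)) (by omega)
  unfold helpScanner
  refine .andThen (N := 1) (N' := 3) .doLL fun _ => .andThen (N := 1) (N' := 2) .doRead fun _ => ?_
  split
  · exact .andThen (N := 1) (N' := 1) .doRead fun _ =>
      .andThen (N := 1) (N' := 0) .doSC fun _ => trivial
  · trivial

theorem cost_collect {i : Fin lam} {j : Fin m} : (collect (V := V) i j).CostLE (6 + 8 * lam) := by
  unfold collect
  exact .mono (.andThen (N' := 3) cost_applyUpdate fun _ => .andThen (N := 1) (N' := 2) .doRead
    fun _ => .andThen (N := 1) (N' := 1) .doRead fun _ => .andThen (N := 1) (N' := 0) .doRead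
    fun _ => trivial) (by omega)

theorem cost_scan (hlam : 0 < lam) (hm : 0 < m) {i : Fin lam} :
    (scan (m := m) (V := V) i).CostLE (40 * lam * m) := by
  unfold scan
  refine .mono (.andThen (N := 1) .doRead fun _ => .andThen (N := 1) .doWrite fun _ =>
    .andThen cost_seqRound fun _ => .andThen cost_seqRound fun _ => .andThen cost_seqRound fun _ =>
    .andThen (N' := 0) (.foldlM (N := 6 + 8 * lam + 0)
      (fun _ j => by exact .andThen cost_collect fun _ => trivial) _ _)
      fun _ => trivial) ?_
  rw [List.length_finRange]
  have h1 : lam ≤ lam * m := Nat.le_mul_of_pos_right _ hm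
  have h2 : m ≤ lam * m := Nat.le_mul_of_pos_left _ hlam
  have h3 : m * (6 + 8 * lam + 0) = 6 * m + 8 * (lam * m) := by ring
  rw [h3, Nat.mul_assoc]
  omega

end LSnap

/-! ## Correctness of λ-Snap in terms of histories -/

namespace History

variable {n : ℕ} {M : BaseObjects} (H : History n M)

/-- The register `r` is not changed within `[s, t)`. -/
def Still (r : M.Reg) (s t : ℕ) : Prop := ∀ w, s ≤ w → w < t → ¬ H.Mod r w

variable {H}

theorem Still.mem_eq {r : M.Reg} {s t : ℕ} (h : H.Still r s t) (hst : s ≤ t) :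
    H.mem t r = H.mem s r := H.mem_eq hst h

theorem exists_first_mod {r : M.Reg} {s t : ℕ} (h : ∃ w, s ≤ w ∧ w < t ∧ H.Mod r w) :
    ∃ w, s ≤ w ∧ w < t ∧ H.Mod r w ∧ H.Still r s w := by
  classical
  obtain ⟨h1, h2, h3⟩ := Nat.find_spec h
  exact ⟨Nat.find h, h1, h2, h3, fun w hw hwf hm => Nat.find_min h hwf ⟨hw, by omega, hm⟩⟩

theorem exists_last_mod {r : M.Reg} {w t : ℕ} (hw : w < t) (h : H.Mod r w) :
    ∃ e, w ≤ e ∧ e < t ∧ H.Mod r e ∧ H.Still r (e + 1) t := by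
  induction t, hw using Nat.le_induction with
  | base => exact ⟨w, le_rfl, Nat.lt_succ_self w, h, fun x _ _ => by omega⟩
  | succ t ht ih =>
    by_cases hm : H.Mod r t
    · exact ⟨t, (Nat.lt_of_succ_le ht).le, Nat.lt_succ_self t, hm, fun x _ _ => by omega⟩
    · obtain ⟨e, h1, h2, h3, h4⟩ := ih
      refine ⟨e, h1, by omega, h3, fun x hx hxt => ?_⟩
      rcases (show x ≤ t by omega).eq_or_lt with rfl | hxt
      · exact hm
      · exact h4 x hx hxt

end History

namespace LSnap

variable {n lam m : ℕ} {V : Type}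

/-- Process `p` is about to apply, at step `u`, a primitive `X` of the code of λ-Snap that may
change a register. -/
def Explained (H : History n (base lam m V)) (p : Fin n) (u : ℕ) (X : Act (base lam m V)) : Prop :=
  (∃ i x, x < u ∧ X = .write (.sTable i) ⟨seqAt H x, true⟩) ∨ (∃ i, HelpSC H p i u X) ∨
    SeqSC H p u X ∨ (∃ i j, SaveSC H p i j u X) ∨ (∃ j, ApplySC H p j u X) ∨
    ∃ j v, ProposeSC H p j v u X

/-- Histories of λ-Snap. -/
structure SnapHistory (n lam m : ℕ) (V : Type) extends History n (base lam m V) where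
  init : ∀ r, mem 0 r = initVal V r
  explained : ∀ p u X, (∀ r, X ≠ .read r) → (∀ r, X ≠ .ll r) → act u = some (p, X) →
    Explained toHistory p u X

section

variable (H : SnapHistory n lam m V)

/-- Step `α` applies an update of component `j`, with the value `seq` that was read at step `τ`. -/
def Applies (j : Fin m) (α τ : ℕ) : Prop :=
  H.Mod (.values j) α ∧ ∃ l p w, l < τ ∧ τ < α ∧ H.Still (.values j) l α ∧
    (valAt H.toHistory j α).proposed = some w ∧
    valAt H.toHistory j (α + 1) = ⟨some w, none, seqAt H.toHistory τ⟩ ∧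
    ∀ i, ∃ s, Saves H.toHistory p i j (τ + 1) s ∧ Saves H.toHistory p i j s α

/-- Step `u` assigns to the scanner `i` the sequence number determined at step `z`. -/
def Assigns (i : Fin lam) (u z : ℕ) : Prop :=
  ∃ b, b < z ∧ z < u ∧ H.Still (.sTable i) b u ∧
    (tableAt H.toHistory i b).writeEnable = true ∧
    tableAt H.toHistory i (u + 1) = ⟨seqAt H.toHistory z + 2, false⟩

end

variable {H : SnapHistory n lam m V}

local notation "sq" => seqAt H.toHistory
local notation "val" => valAt H.toHistory
local notation "pre" => preAt H.toHistory
local notation "tab" => tableAt H.toHistory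

/-! ### The possible changes of each kind of register -/

theorem SnapHistory.explained_of_modBy {r : Reg lam m} {u : ℕ} {p : Fin n} {v : Val V r}
    (h : H.ModBy r u p v) : (Explained H.toHistory p u (.sc r v) ∧ p ∈ H.linked u r) ∨
      H.act u = some (p, .write r v) ∧ Explained H.toHistory p u (.write r v) :=
  h.imp (fun h => ⟨H.explained _ _ _ (by simp) (by simp) h.1, h.2⟩)
    (fun h => ⟨h, H.explained _ _ _ (by simp) (by simp) h⟩)

/-- Only the `SC` ending a `seqRound` touches `seq`. Its success means that `seq` was still since
the `LL`, so the new value is exactly one more, and all scanners were served in between. -/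
theorem mod_seq {u : ℕ} (h : H.Mod .seq u) : ∃ l, l < u ∧ H.Still .seq l u ∧
    sq (u + 1) = sq l + 1 ∧ ∀ i, Helps H.toHistory i (l + 1) u := by
  obtain ⟨p, v, h⟩ := h
  have hv : sq (u + 1) = v := H.mem_of_modBy h
  rcases SnapHistory.explained_of_modBy h with ⟨h, hl⟩ | ⟨hact, h⟩
  · rcases h with ⟨_, _, _, h⟩ | ⟨_, _, _, _, _, _, _, _, h⟩ | ⟨l, h1, h2, h3, h4, h⟩ |
      ⟨_, _, _, _, _, _, _, _, _, _, _, h⟩ | ⟨_, _, _, _, _, _, _, _, _, _, _, h, _⟩ |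
      ⟨_, _, _, _, _, _, _, h⟩
    · simp at h
    · simp at h
    · refine ⟨l, h1, H.not_mod_between h2 hl h3, ?_, h4⟩
      rw [hv]
      simpa using h
    all_goals simp at h
  · rcases h with ⟨_, _, _, h⟩ | ⟨_, _, _, _, _, _, _, _, h⟩ | ⟨l, h1, h2, h3, h4, h⟩ |
      ⟨_, _, _, _, _, _, _, _, _, _, _, h⟩ | ⟨_, _, _, _, _, _, _, _, _, _, _, h, _⟩ |
      ⟨_, _, _, _, _, _, _, h⟩
    all_goals simp at h

theorem mod_table {i : Fin lam} {u : ℕ} (h : H.Mod (.sTable i) u) :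
    (∃ p v, H.act u = some (p, .write (.sTable i) v) ∧
      ∃ x, x < u ∧ tab i (u + 1) = ⟨sq x, true⟩) ∨ ∃ z, Assigns H i u z := by
  obtain ⟨p, v, h⟩ := h
  have hv : tab i (u + 1) = v := H.mem_of_modBy h
  rcases SnapHistory.explained_of_modBy h with ⟨h, hl⟩ | ⟨hact, h⟩
  · rcases h with ⟨_, _, _, h⟩ | ⟨_, b, z, h1, h2, h3, h4, h5, h⟩ | ⟨l, h1, h2, h3, h4, h⟩ |
      ⟨_, _, _, _, _, _, _, _, _, _, _, h⟩ | ⟨_, _, _, _, _, _, _, _, _, _, _, h, _⟩ |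
      ⟨_, _, _, _, _, _, _, h⟩
    · simp at h
    · simp only [Act.sc.injEq, Reg.sTable.injEq] at h
      obtain ⟨rfl, h⟩ := h
      exact .inr ⟨z, b, h1, h2, H.not_mod_between h3 hl h4, h5, hv.trans (eq_of_heq h)⟩
    all_goals simp at h
  · rcases h with ⟨_, x, hx, h⟩ | ⟨_, _, _, _, _, _, _, _, h⟩ | ⟨l, h1, h2, h3, h4, h⟩ |
      ⟨_, _, _, _, _, _, _, _, _, _, _, h⟩ | ⟨_, _, _, _, _, _, _, _, _, _, _, h, _⟩ |
      ⟨_, _, _, _, _, _, _, h⟩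
    · simp only [Act.write.injEq, Reg.sTable.injEq] at h
      obtain ⟨rfl, h⟩ := h
      obtain rfl := eq_of_heq h
      exact .inl ⟨p, _, hact, x, hx, hv⟩
    all_goals simp at h

theorem mod_pre {i : Fin lam} {j : Fin m} {u : ℕ} (h : H.Mod (.preValues i j) u) :
    ∃ b x z, b < x ∧ x < z ∧ z < u ∧ H.Still (.preValues i j) b u ∧
      (val j x).seq < (tab i z).seq ∧ pre i j (u + 1) = ⟨(val j x).value, (val j x).seq⟩ := by
  obtain ⟨p, v, h⟩ := h
  have hv : pre i j (u + 1) = v := H.mem_of_modBy h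
  rcases SnapHistory.explained_of_modBy h with ⟨h, hl⟩ | ⟨hact, h⟩
  · rcases h with ⟨_, _, _, h⟩ | ⟨_, _, _, _, _, _, _, _, h⟩ | ⟨l, h1, h2, h3, h4, h⟩ |
      ⟨_, _, b, x, z, h1, h2, h3, h4, h5, h6, h⟩ | ⟨_, _, _, _, _, _, _, _, _, _, _, h, _⟩ |
      ⟨_, _, _, _, _, _, _, h⟩
    iterate 3 simp at h
    · simp only [Act.sc.injEq, Reg.preValues.injEq] at h
      obtain ⟨⟨rfl, rfl⟩, h⟩ := h
      exact ⟨b, x, z, h1, h2, h3, H.not_mod_between h4 hl h5, h6, hv.trans (eq_of_heq h)⟩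
    all_goals simp at h
  · rcases h with ⟨_, _, _, h⟩ | ⟨_, _, _, _, _, _, _, _, h⟩ | ⟨l, h1, h2, h3, h4, h⟩ |
      ⟨_, _, _, _, _, _, _, _, _, _, _, h⟩ | ⟨_, _, _, _, _, _, _, _, _, _, _, h, _⟩ |
      ⟨_, _, _, _, _, _, _, h⟩
    all_goals simp at h

/-- Only the `SC`s of `applyUpdate` and of the loop of `update` change `values[j]`. As they succeed,
what was read after the `LL` is still the content at step `u`. -/
theorem mod_val {j : Fin m} {u : ℕ} (h : H.Mod (.values j) u) : (∃ τ, Applies H j u τ) ∨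
    (val j u).proposed = none ∧
      ∃ v, val j (u + 1) = ⟨(val j u).value, some v, (val j u).seq⟩ := by
  have hm := h
  obtain ⟨p, v, h⟩ := h
  have hv : val j (u + 1) = v := H.mem_of_modBy h
  rcases SnapHistory.explained_of_modBy h with ⟨h, hl⟩ | ⟨hact, h⟩
  · rcases h with ⟨_, _, _, h⟩ | ⟨_, _, _, _, _, _, _, _, h⟩ | ⟨l, h1, h2, h3, h4, h⟩ |
      ⟨_, _, _, _, _, _, _, _, _, _, _, h⟩ | ⟨_, l, τ, x, w, h1, h2, h3, h4, h5, h6, h, h7⟩ |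
      ⟨_, w, l, h1, h2, h3, h4, h⟩
    iterate 4 simp at h
    · simp only [Act.sc.injEq, Reg.values.injEq] at h
      obtain ⟨rfl, h⟩ := h
      have still := H.not_mod_between h4 hl h5
      refine .inl ⟨τ, hm, l, p, w, h1, h2.trans h3, still, ?_, hv.trans (eq_of_heq h), h7⟩
      -- The proposal is known at the last read `x`; stillness carries it to the step of the `SC`.
      rw [← h6]
      exact congrArg ValueStruct.proposed
        (H.mem_eq h3.le fun w h8 h9 => still w (by omega) h9)
    · simp only [Act.sc.injEq, Reg.values.injEq] at h
      obtain ⟨rfl, h⟩ := h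
      have eq : val j u = val j l := H.mem_eq h1.le (H.not_mod_between h2 hl h3)
      exact .inr ⟨eq ▸ h4, w, by rw [hv.trans (eq_of_heq h), eq]⟩
  · rcases h with ⟨_, _, _, h⟩ | ⟨_, _, _, _, _, _, _, _, h⟩ | ⟨l, h1, h2, h3, h4, h⟩ |
      ⟨_, _, _, _, _, _, _, _, _, _, _, h⟩ | ⟨_, _, _, _, _, _, _, _, _, _, _, h, _⟩ |
      ⟨_, _, _, _, _, _, _, h⟩
    all_goals simp at h

/-! ### Sequence numbers -/

theorem seq_step (t : ℕ) : sq (t + 1) = sq t ∨ sq (t + 1) = sq t + 1 := by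
  by_cases h : H.Mod .seq t
  · obtain ⟨l, h1, h2, h3, -⟩ := mod_seq h
    right
    rw [h3, show sq t = sq l from h2.mem_eq h1.le]
  · exact .inl (H.mem_of_not_mod h)

theorem seq_mono : Monotone sq :=
  monotone_nat_of_le_succ fun t => by rcases seq_step (H := H) t with h | h <;> omega

theorem exists_seq_step {a b k : ℕ} (hab : a ≤ b) (ha : sq a ≤ k) (hb : k < sq b) :
    ∃ u, a ≤ u ∧ u < b ∧ H.Mod .seq u ∧ sq u = k ∧ sq (u + 1) = k + 1 := by
  induction b, hab using Nat.le_induction with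
  | base => omega
  | succ b hab ih =>
    by_cases h : k < sq b
    · obtain ⟨u, h1, h2, h3⟩ := ih h
      exact ⟨u, h1, by omega, h3⟩
    · have := seq_step (H := H) b
      refine ⟨b, hab, Nat.lt_succ_self b, by_contra fun hm => ?_, by omega, by omega⟩
      have : sq (b + 1) = sq b := H.mem_of_not_mod hm
      omega

/-- The scanner writes a number read from `seq` earlier, a helper such a number plus 2 while
disabling the entry; `seq` only grows. -/
theorem table_bound (i : Fin lam) (t : ℕ) : (tab i t).seq ≤ sq t + 2 ∧
    ((tab i t).writeEnable = true → (tab i t).seq ≤ sq t) := by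
  induction t with
  | zero =>
    have : tab i 0 = ⟨0, false⟩ := H.init (.sTable i)
    simp [this]
  | succ t ih =>
    have hs := seq_mono (H := H) (Nat.le_add_right t 1)
    by_cases h : H.Mod (.sTable i) t
    · rcases mod_table h with ⟨_, _, _, x, hx, h⟩ | ⟨z, b, _, hz, _, _, h⟩
      · have := seq_mono (H := H) hx.le
        rw [h]
        exact ⟨by dsimp only; omega, fun _ => by dsimp only; omega⟩
      · have := seq_mono (H := H) hz.le
        rw [h]
        exact ⟨by dsimp only; omega, fun h => by simp at h⟩
    · rw [show tab i (t + 1) = tab i t from H.mem_of_not_mod h]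
      exact ⟨by omega, fun h => by have := ih.2 h; omega⟩

/-- By `table_bound`, an enabled entry always passes the helper's test on sequence numbers, so that
alternative disappears. -/
theorem helps_cases {i : Fin lam} {s u : ℕ} (h : Helps H.toHistory i s u) :
    ∃ b, s ≤ b ∧ b < u ∧
      ((tab i b).writeEnable = false ∨ ∃ w, b < w ∧ w < u ∧ H.Mod (.sTable i) w) := by
  obtain ⟨b, x, h1, h2, h3, h4⟩ := h
  refine ⟨b, h1, by omega, ?_⟩
  rcases h4 with h4 | h4
  · left
    by_contra hw
    have := (table_bound (H := H) i b).2 (by simpa using hw)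
    have := seq_mono (H := H) h2.le
    omega
  · exact h4

/-- A sequence number is assigned before `seq` reaches it. -/
theorem Assigns.seq_lt {i : Fin lam} {u z : ℕ} (h : Assigns H i u z) : sq u < sq z + 2 := by
  obtain ⟨b, h1, h2, still, hb, -⟩ := h
  by_contra! hc
  -- If the claim fails, `seq` passes from `sq z + 1` to `sq z + 2` at a step `v` between `z` and
  -- `u`.
  obtain ⟨v, h3, h4, h5, h6, -⟩ := exists_seq_step (H := H) (k := sq z + 1) h2.le
    (by omega) (by omega)
  obtain ⟨l, h7, h8, h9, h10⟩ := mod_seq h5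
  have hl : sq l = sq z + 1 := by rw [← h6]; exact (h8.mem_eq h7.le).symm
  -- The round responsible for `v` read a value greater than `sq z`, hence began after `z`. Its
  -- helper for `i` then finds the entry enabled and forces a change of a register that is supposed
  -- to be still.
  have hzl : z < l := by
    by_contra! hlz
    have := seq_mono (H := H) hlz
    omega
  obtain ⟨b', h11, h12, h13⟩ := helps_cases (h10 i)
  rcases h13 with h13 | ⟨w, h13, h14, h15⟩
  · have : tab i b' = tab i b := H.mem_eq (by omega) fun w h1 h2 => still w h1 (by omega)
    rw [this, hb] at h13
    simp at h13
  · exact still w (by omega) (by omega) h15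

/-- During a `SCAN` by the scanner `i` that writes to `s_table[i]` at step `w`, `seq` reaches the
sequence number that is assigned to the `SCAN`. -/
theorem exists_scan_point {i : Fin lam} {w s₁ s₂ s₃ u : ℕ} (hw : H.Mod (.sTable i) w)
    (hen : (tab i (w + 1)).writeEnable = true)
    (hno : ∀ s, w < s → s < u → ∀ p v, H.act s ≠ some (p, .write (.sTable i) v))
    (h₁ : Advances H.toHistory (w + 1) s₁) (h₂ : Advances H.toHistory s₁ s₂)
    (h₃ : Advances H.toHistory s₂ s₃) (hu : s₃ ≤ u) :
    ∃ P, w < P ∧ P < s₃ ∧ sq (P + 1) = sq P + 1 ∧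
      (∀ t, P < t → t ≤ u → (tab i t).seq = sq (P + 1)) ∧
      ∀ t, t ≤ u → (tab i t).seq ≤ sq (P + 1) := by
  obtain ⟨l₁, w₁, h11, h12, h13, -, h14⟩ := h₁
  obtain ⟨l₂, w₂, h21, h22, h23, h24, -⟩ := h₂
  obtain ⟨l₃, w₃, h31, h32, h33, h34, -⟩ := h₃
  have help : ∀ s, w < s → s < u → H.Mod (.sTable i) s → ∃ z, Assigns H i s z := by
    intro s h1 h2 hs
    rcases mod_table hs with ⟨p, v, hp, -⟩ | h
    · exact (hno s h1 h2 p v hp).elim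
    · exact h
  -- If nothing changed the entry during the first round, the helper in that round would find it
  -- enabled and cause a change.
  have hex : ∃ e, w + 1 ≤ e ∧ e < s₁ ∧ H.Mod (.sTable i) e := by
    obtain ⟨b, h1, h2, h3 | ⟨e, h3, h4, h5⟩⟩ := helps_cases (h14 i)
    · by_contra! hc
      have : tab i b = tab i (w + 1) := H.mem_eq (by omega) fun e h4 h5 => hc e h4 (by omega)
      rw [this, hen] at h3
      simp at h3
    · exact ⟨e, by omega, by omega, h5⟩
  obtain ⟨e, he1, he2, he3, he4⟩ := History.exists_first_mod hex
  obtain ⟨z, hz⟩ := help e he1 (by omega) he3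
  have hlt := hz.seq_lt
  obtain ⟨b, hz1, hz2, hz3, hz4, hz5⟩ := hz
  have hbw : w < b := by
    by_contra! hbw
    exact hz3 w hbw (by omega) hw
  -- A second helper that succeeds must have performed its `LL` after `e`, where the entry is
  -- already disabled, so it would not have tried.
  have after : ∀ t, e < t → t ≤ u → tab i t = ⟨sq z + 2, false⟩ := by
    intro t ht htu
    rw [← hz5]
    refine H.mem_eq ht ?_
    by_contra! hc
    obtain ⟨f, hf1, hf2, hf3⟩ := hc
    obtain ⟨g, hg1, hg2, hg3, hg4⟩ := History.exists_first_mod ⟨f, hf1, hf2, hf3⟩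
    obtain ⟨z', b', h1, h2, h3, h4, -⟩ := help g (by omega) (by omega) hg3
    have heb : e < b' := by
      by_contra! hbe
      exact h3 e hbe (by omega) he3
    have : tab i b' = tab i (e + 1) := H.mem_eq heb fun w h1 h2 => hg4 w h1 (by omega)
    rw [this, hz5] at h4
    simp at h4
  have step : ∀ {x}, H.Mod .seq x → sq (x + 1) = sq x + 1 := fun {x} hx => by
    obtain ⟨l, h1, h2, h3, -⟩ := mod_seq hx
    rw [h3, show sq x = sq l from h2.mem_eq h1.le]
  -- The second and third rounds each contain an increment of `seq`, and both come after `z`.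
  have hs₃ : sq z + 2 ≤ sq s₃ := by
    have h1 := step h24
    have h2 := step h34
    have h3 := seq_mono (H := H) (show z ≤ w₂ by omega)
    have h4 := seq_mono (H := H) (show w₂ + 1 ≤ w₃ by omega)
    have h5 := seq_mono (H := H) (show w₃ + 1 ≤ s₃ by omega)
    omega
  -- At `e`, `seq` is at most `sq z + 1` by `Assigns.seq_lt`; `P` is the step that reaches the
  -- assigned number.
  obtain ⟨P, hP1, hP2, -, hP3, hP4⟩ := exists_seq_step (H := H) (k := sq z + 1) (a := e) (b := s₃)
    (by omega) (by omega) (by omega)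
  refine ⟨P, by omega, hP2, by omega, fun t h1 h2 => ?_, fun t ht => ?_⟩
  · rw [after t (by omega) h2, hP4]
  · rcases lt_or_ge e t with h | h
    · rw [after t h ht, hP4]
    · rw [hP4]
      rcases le_or_gt t w with htw | htw
      · have := (table_bound (H := H) i t).1
        have := seq_mono (H := H) (show t ≤ z by omega)
        omega
      · rw [show tab i t = tab i (w + 1) from H.mem_eq htw fun x h1 h2 => he4 x h1 (by omega)]
        have := (table_bound (H := H) i (w + 1)).1
        have := seq_mono (H := H) (show w + 1 ≤ z by omega)
        omega

/-! ### The components -/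

theorem Applies.lt {j : Fin m} {α τ : ℕ} (h : Applies H j α τ) : τ < α := by
  obtain ⟨-, l, p, w, h1, h2, -⟩ := h
  exact h2

theorem Applies.seq_eq {j : Fin m} {α τ : ℕ} (h : Applies H j α τ) :
    (val j (α + 1)).seq = sq τ := by
  obtain ⟨-, l, p, w, h1, h2, h3, h4, h5, -⟩ := h
  rw [h5]

/-- The register is still from an `LL` before `τ` up to `α`, so an earlier change lies even before
that `LL`. This orders commit steps and places them after their proposals. -/
theorem Applies.lt_of_mod {j : Fin m} {π α τ : ℕ} (h : Applies H j α τ)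
    (hπ : H.Mod (.values j) π) (hlt : π < α) : π < τ := by
  obtain ⟨-, l, p, w, h1, h2, h3, -⟩ := h
  by_contra! hc
  exact h3 π (by omega) hlt hπ

theorem val_seq_le (j : Fin m) (t : ℕ) : (val j t).seq ≤ sq t := by
  induction t with
  | zero =>
    have : val j 0 = ⟨none, none, 0⟩ := H.init (.values j)
    simp [this]
  | succ t ih =>
    have hs := seq_mono (H := H) (Nat.le_add_right t 1)
    by_cases h : H.Mod (.values j) t
    · rcases mod_val h with ⟨τ, h⟩ | ⟨-, v, h⟩
      · have := seq_mono (H := H) h.lt.le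
        rw [h.seq_eq]
        omega
      · rw [h]
        exact ih.trans hs
    · rw [show val j (t + 1) = val j t from H.mem_of_not_mod h]
      omega

/-- A new tag is read from `seq` after the `LL`, when the old tag was already present and bounded by
`seq`; proposals keep the tag. -/
theorem val_seq_mono (j : Fin m) : Monotone fun t => (val j t).seq := by
  refine monotone_nat_of_le_succ fun t => ?_
  by_cases h : H.Mod (.values j) t
  · rcases mod_val h with ⟨τ, h⟩ | ⟨-, v, h⟩
    · rw [h.seq_eq]
      obtain ⟨-, l, p, w, h1, h2, h3, -⟩ := h
      have h4 := val_seq_le (H := H) j l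
      have h5 := seq_mono (H := H) h1.le
      rw [show val j t = val j l from h3.mem_eq (by omega)]
      omega
    · rw [h]
  · rw [show val j (t + 1) = val j t from H.mem_of_not_mod h]

/-- A value that is about to be overwritten has been saved for the scanners that need it. -/
theorem Applies.exists_saved {i : Fin lam} {j : Fin m} {α τ : ℕ} (h : Applies H j α τ)
    (hs : ∀ t, τ < t → t < α → (val j α).seq < (tab i t).seq) :
    ∃ e b x z, e < α ∧ τ < b ∧ b < x ∧ x < z ∧ z < e ∧ H.Mod (.preValues i j) e ∧
      H.Still (.preValues i j) b e ∧ (val j x).seq < (tab i z).seq ∧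
      pre i j (e + 1) = ⟨(val j x).value, (val j x).seq⟩ := by
  obtain ⟨-, l, p, w, h1, h2, still, -, -, h3⟩ := h
  obtain ⟨s, ⟨b₁, x₁, z₁, h11, h12, h13, h14, h15, h16⟩,
    b₂, x₂, z₂, h21, h22, h23, h24, h25, h26⟩ := h3 i
  have eq : ∀ x, l ≤ x → x ≤ α → val j x = val j α := fun x h4 h5 =>
    (H.mem_eq h5 fun w h6 h7 => still w (by omega) h7).symm
  have hsα : s ≤ α := by omega
  -- Both rounds read the value about to be overwritten, and the hypothesis makes both pass the
  -- test.
  obtain ⟨e₁, h17, h18, h19⟩ := h16 (by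
    rw [eq x₁ (by omega) (by omega)]
    exact hs _ (by omega) (by omega))
  obtain ⟨e₂, h27, h28, h29⟩ := h26 (by
    rw [eq x₂ (by omega) (by omega)]
    exact hs _ (by omega) (by omega))
  obtain ⟨w₁, h4, h5, h6⟩ := exists_mod_of_sc h15 (by omega) h19
  obtain ⟨w₂, h7, h8, h9⟩ := exists_mod_of_sc h25 (by omega) h29
  obtain ⟨b, x, z, h31, h32, h33, h34, h35, h36⟩ := mod_pre h9
  refine ⟨w₂, b, x, z, by omega, ?_, h31, h32, h33, h9, h34, h35, h36⟩
  -- Here the second attempt is needed. The change `w₂` may stem from another process, but its `LL`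
  -- cannot precede the change `w₁`, and `w₁` comes after `τ`; so the value it saves was also read
  -- after `τ`.
  by_contra! hc
  exact h34 w₁ (by omega) (by omega) h6

/-- What a `SCAN` with the linearization point `P` returns for the component `j`: the value that
`values[j]` holds between the updates that are linearized before `P` and those after `P`. -/
theorem collects_eq {i : Fin lam} {j : Fin m} {P c c' u : ℕ} {x : Option V} (hP : P < c)
    (hcu : c' ≤ u) (hstep : sq (P + 1) = sq P + 1)
    (htab : ∀ t, P < t → t ≤ u → (tab i t).seq = sq (P + 1))
    (htab' : ∀ t, t ≤ u → (tab i t).seq ≤ sq (P + 1))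
    (h : Collects H.toHistory i j c c' x) :
    ∃ z, x = (val j z).value ∧ ∀ α τ, Applies H j α τ → (α < z → τ ≤ P) ∧ (z ≤ α → P < τ) := by
  obtain ⟨s, d₁, d₂, d₃, ⟨l, hl1, hl2, hl3⟩, h1, h2, h3, h4, hx⟩ := h
  rw [htab d₃ (by omega) (by omega)] at hx
  -- As `seq` is raised at step `P`, comparing a number read at `τ` with `sq (P + 1)` amounts to
  -- comparing `τ` with `P`.
  have hle : ∀ {τ}, sq τ < sq (P + 1) → τ ≤ P := fun {τ} hτ => by
    by_contra! hc
    have := seq_mono (H := H) (show P + 1 ≤ τ from hc)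
    omega
  have hgt : ∀ {τ}, sq (P + 1) ≤ sq τ → P < τ := fun {τ} hτ => by
    by_contra! hc
    have := seq_mono (H := H) hc
    omega
  split_ifs at hx with hc
  · refine ⟨d₁, hx, fun α τ h => ⟨fun hα => hle ?_, fun hα => ?_⟩⟩
    · rw [← h.seq_eq]
      exact (val_seq_mono j hα).trans_lt hc
    · obtain ⟨-, l', p, w, h5, h6, h7, h8, -⟩ := h
      -- Otherwise `values[j]` is still from before `P` until `α ≥ d₁`, with the proposal pending.
      -- The scanner's own `applyUpdate` ran in between and would have removed it.
      by_contra! hτ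
      have eq : val j α = val j l := H.mem_eq (by omega) fun w h9 h10 => h7 w (by omega) h10
      rcases hl3 with hl3 | ⟨w', h9, h10, h11⟩
      · rw [eq, hl3] at h8
        simp at h8
      · exact h7 w' (by omega) (by omega) h11
  · push Not at hc
    -- The tag is already too large; the witness is the step `a` at which it first becomes so, which
    -- must be an application.
    have hex : ∃ t, sq (P + 1) ≤ (val j t).seq := ⟨d₁, hc⟩
    classical
    have hspec := Nat.find_spec hex
    have hmin := fun t => Nat.find_min hex (m := t)
    have hd₁ := Nat.find_min' hex hc
    generalize Nat.find hex = t at hspec hmin hd₁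
    obtain _ | a := t
    · have : val j 0 = ⟨none, none, 0⟩ := H.init (.values j)
      rw [this] at hspec
      simp at hspec
      omega
    have ha := hmin a (Nat.lt_succ_self a)
    push Not at ha
    have hmod : H.Mod (.values j) a := by
      by_contra hm
      rw [show val j (a + 1) = val j a from H.mem_of_not_mod hm] at hspec
      omega
    obtain ⟨τ, hτ⟩ : ∃ τ, Applies H j a τ := by
      refine (mod_val hmod).resolve_right ?_
      rintro ⟨-, v, hv⟩
      rw [hv] at hspec
      dsimp only at hspec
      omega
    have hPτ : P < τ := hgt (by rw [← hτ.seq_eq]; exact hspec)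
    refine ⟨a, ?_, fun α τ' h => ⟨fun hα => hle ?_, fun hα => hgt ?_⟩⟩
    · obtain ⟨e, b, x, z, h5, h6, h7, h8, h9, h10, h11, h12, h13⟩ :=
        hτ.exists_saved (i := i) fun t h5 h6 => by rw [htab t (by omega) (by omega)]; exact ha
      -- `e'` is the save that the scanner gets to see. If it is not the one found above, its `LL`
      -- comes after that one; in either case the saved value was read after `τ`.
      obtain ⟨e', h14, h15, h16, h17⟩ := History.exists_last_mod (t := d₂) (by omega) h10
      obtain ⟨x', z', hb', h23, h25, h26⟩ : ∃ x' z', τ < x' ∧ z' < e' ∧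
          (val j x').seq < (tab i z').seq ∧
          pre i j (e' + 1) = ⟨(val j x').value, (val j x').seq⟩ := by
        rcases h14.eq_or_lt with rfl | h14
        · exact ⟨x, z, by omega, h9, h12, h13⟩
        · obtain ⟨b', x', z', h21, h22, h23, h24, h25, h26⟩ := mod_pre h16
          refine ⟨x', z', ?_, h23, h25, h26⟩
          by_contra! hx'
          exact h24 e (by omega) h14 h10
      -- Values after `a` have tags of at least `sq (P + 1)` and fail the test for saving.
      have hx'a : x' ≤ a := by
        by_contra! hax
        have h27 := htab' z' (by omega)
        have h28 := val_seq_mono (H := H) j (show a + 1 ≤ x' from hax)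
        dsimp only at h28
        omega
      have eq : val j x' = val j a := by
        obtain ⟨-, l', p, w, h5, h6, h7, -⟩ := hτ
        exact (H.mem_eq hx'a fun w h8 h9 => h7 w (by omega) h9).symm
      rw [hx, show pre i j d₂ = pre i j (e' + 1) from h17.mem_eq h15, h26, eq]
    · rw [← h.seq_eq]
      have := hmin (α + 1) (by omega)
      omega
    · rw [← h.seq_eq]
      exact hspec.trans (val_seq_mono j (show a + 1 ≤ α + 1 by omega))

/-! ### Proposals -/

/-- A proposal is applied by the next complete run of `applyUpdate`. -/
theorem exists_applies {j : Fin m} {π x y : ℕ}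
    (hp : (val j (π + 1)).proposed ≠ none) (hx : π < x) (h : Completes H.toHistory j x y) :
    ∃ α, (∃ τ, Applies H j α τ) ∧ π < α ∧ α < y ∧ H.Still (.values j) (π + 1) α := by
  obtain ⟨l, h1, h2, h3⟩ := h
  have hex : ∃ w, π + 1 ≤ w ∧ w < y ∧ H.Mod (.values j) w := by
    rcases h3 with h3 | ⟨w, h4, h5, h6⟩
    · by_contra! hc
      have : val j l = val j (π + 1) := H.mem_eq (by omega) fun w h4 h5 => hc w h4 (by omega)
      exact hp (this ▸ h3)
    · exact ⟨w, by omega, h5, h6⟩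
  obtain ⟨α, h4, h5, h6, h7⟩ := History.exists_first_mod hex
  have eq : val j α = val j (π + 1) := h7.mem_eq h4
  obtain ⟨τ, hτ⟩ := (mod_val h6).resolve_right fun h => hp (eq ▸ h.1)
  exact ⟨α, ⟨τ, hτ⟩, h4, h5, h7⟩

/-- An application presupposes a pending proposal, so the first change from a state without one is a
proposal. -/
theorem exists_proposal {j : Fin m} {b w x : ℕ} (hb : (val j b).proposed = none) (hw : b ≤ w)
    (hwx : w < x) (h : H.Mod (.values j) w) :
    ∃ π, b ≤ π ∧ π < x ∧ H.Mod (.values j) π ∧ (val j (π + 1)).proposed ≠ none := by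
  obtain ⟨π, h1, h2, h3, h4⟩ := History.exists_first_mod ⟨w, hw, hwx, h⟩
  refine ⟨π, h1, h2, h3, ?_⟩
  have eq : val j π = val j b := h4.mem_eq h1
  rcases mod_val h3 with ⟨τ, -, l, p, w, -, -, -, h5, -⟩ | ⟨-, v, h5⟩
  · rw [eq, hb] at h5
    simp at h5
  · rw [h5]
    simp

/-- While an `UPDATE` fails twice to propose its value, another `UPDATE` of the same component is
performed. -/
theorem exists_applies_of_failedRound {j : Fin m} {t s u : ℕ}
    (h₁ : FailedRound H.toHistory j t s) (h₂ : FailedRound H.toHistory j s u) :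
    ∃ α, (∃ τ, Applies H j α τ) ∧ α < u ∧ ∀ τ, Applies H j α τ → t ≤ τ := by
  obtain ⟨b₁, x₁, h11, h12, h13, h14, h15⟩ := h₁
  obtain ⟨b₂, x₂, h21, h22, h23, h24, h25⟩ := h₂
  -- A proposal made after `t` and applied before `u` suffices, since its commit step lies after it.
  have key : ∀ {b w x y : ℕ}, (val j b).proposed = none → t ≤ b → b ≤ w → w < x → y ≤ u →
      H.Mod (.values j) w → Completes H.toHistory j x y →
      ∃ α, (∃ τ, Applies H j α τ) ∧ α < u ∧ ∀ τ, Applies H j α τ → t ≤ τ := by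
    intro b w x y hb htb hbw hwx hyu hw hc
    obtain ⟨π, h1, h2, h3, h4⟩ := exists_proposal hb hbw hwx hw
    obtain ⟨α, h5, h6, h7, -⟩ := exists_applies h4 h2 hc
    exact ⟨α, h5, by omega, fun τ hτ => by have := hτ.lt_of_mod h3 h6; omega⟩
  by_cases hb₁ : (val j b₁).proposed = none
  · obtain ⟨w, h1, h2, h3⟩ := h14.resolve_left (fun h => h hb₁)
    exact key hb₁ h11 h1.le h2 (by omega) h3 h15
  obtain ⟨w, h1, h2, h3⟩ : ∃ w, b₁ ≤ w ∧ w < s ∧ H.Mod (.values j) w := by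
    obtain ⟨l, h1, h2, h3 | ⟨w, h4, h5, h6⟩⟩ := h15
    · by_contra! hc
      have : val j l = val j b₁ := H.mem_eq (by omega) fun w h4 h5 => hc w h4 (by omega)
      exact hb₁ (this ▸ h3)
    · exact ⟨w, by omega, h5, h6⟩
  by_cases hb₂ : (val j b₂).proposed = none
  · obtain ⟨w', h4, h5, h6⟩ := h24.resolve_left (fun h => h hb₂)
    exact key hb₂ (by omega) h4.le h5 le_rfl h6 h25
  -- Both iterations met a pending proposal. The first one was removed during its iteration, so the
  -- second was made after `b₁`, and the last change before `b₂` is that proposal.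
  · obtain ⟨π, h4, h5, h6, h7⟩ := History.exists_last_mod (t := b₂) (by omega) h3
    have eq : val j b₂ = val j (π + 1) := h7.mem_eq h5
    obtain ⟨α, h8, h9, h10, -⟩ := exists_applies (eq ▸ hb₂) (show π < x₂ by omega) h25
    exact ⟨α, h8, h10, fun τ hτ => by have := hτ.lt_of_mod h6 h9; omega⟩

/-- The value of a component is the one of the last update that has been applied. -/
theorem value_cases (j : Fin m) (z : ℕ) :
    ((∀ α τ, Applies H j α τ → ¬ α < z) ∧ (val j z).value = none) ∨
      ∃ α τ w, Applies H j α τ ∧ α < z ∧ (val j α).proposed = some w ∧ (val j z).value = some w ∧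
        ∀ α' τ', Applies H j α' τ' → α' < z → α' ≤ α := by
  induction z with
  | zero =>
    have : val j 0 = ⟨none, none, 0⟩ := H.init (.values j)
    simp [this]
  | succ z ih =>
    by_cases hz : ∃ τ, Applies H j z τ
    · obtain ⟨τ, hτ⟩ := hz
      obtain ⟨-, l, p, w, -, -, -, h1, h2, -⟩ := id hτ
      exact .inr ⟨z, τ, w, hτ, Nat.lt_succ_self z, h1, by rw [h2],
        fun _ _ _ h => Nat.le_of_lt_succ h⟩
    · have eq : (val j (z + 1)).value = (val j z).value := by
        by_cases hm : H.Mod (.values j) z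
        · obtain ⟨-, v, h⟩ := (mod_val hm).resolve_left hz
          rw [h]
        · rw [show val j (z + 1) = val j z from H.mem_of_not_mod hm]
      have hlt : ∀ α τ, Applies H j α τ → α < z + 1 → α < z := by
        intro α τ h hα
        rcases (Nat.le_of_lt_succ hα).eq_or_lt with rfl | h'
        · exact (hz ⟨τ, h⟩).elim
        · exact h'
      rw [eq]
      rcases ih with ⟨h1, h2⟩ | ⟨α, τ, w, h1, h2, h3, h4, h5⟩
      · exact .inl ⟨fun α τ h hα => h1 α τ h (hlt α τ h hα), h2⟩
      · exact .inr ⟨α, τ, w, h1, by omega, h3, h4, fun α' τ' h hα => h5 α' τ' h (hlt α' τ' h hα)⟩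

end LSnap

/-! ## Linearization -/

/-- A set of natural numbers can be enumerated in the order of any keys. -/
theorem exists_enumeration (L : Set ℕ) (key : ℕ → ℕ) (hkey : Set.InjOn key L) :
    ∃ (size : ℕ∞) (f : ℕ → ℕ), (∀ k : ℕ, (k : ℕ∞) < size → f k ∈ L) ∧
      (∀ i ∈ L, ∃ k : ℕ, (k : ℕ∞) < size ∧ f k = i) ∧
      ∀ k k' : ℕ, k < k' → (k' : ℕ∞) < size → key (f k) < key (f k') := by
  classical
  let p : ℕ → Prop := fun x => x ∈ key '' L
  have hsize : ∀ k : ℕ, (k : ℕ∞) < (key '' L).encard ↔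
      ∀ hf : (Set.ofPred p).Finite, k < hf.toFinset.card := by
    intro k
    change _ ↔ ∀ hf : (key '' L).Finite, k < hf.toFinset.card
    by_cases hf : (key '' L).Finite
    · rw [hf.encard_eq_coe_toFinset_card]
      exact ⟨fun h _ => by exact_mod_cast h, fun h => by exact_mod_cast h hf⟩
    · rw [Set.Infinite.encard_eq hf]
      exact ⟨fun _ h => (hf h).elim, fun _ => ENat.natCast_lt_top k⟩
  have hmem : ∀ k : ℕ, (k : ℕ∞) < (key '' L).encard → ∃ i ∈ L, key i = Nat.nth p k :=
    fun k hk => Nat.nth_mem k ((hsize k).1 hk)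
  refine ⟨(key '' L).encard,
    -- The `k`-th smallest key is pulled back to `L`; the default `0` occurs only for indices beyond
    -- `size`.
    fun k => if h : ∃ i ∈ L, key i = Nat.nth p k then h.choose else 0, fun k hk => ?_,
    fun i hi => ?_, fun k k' hkk hk' => ?_⟩
  · dsimp only
    rw [dif_pos (hmem k hk)]
    exact (hmem k hk).choose_spec.1
  · obtain ⟨k, hk, h⟩ := Nat.exists_lt_card_nth_eq (p := p) (x := key i) ⟨i, hi, rfl⟩
    have hk' := (hsize k).2 hk
    refine ⟨k, hk', ?_⟩
    dsimp only
    rw [dif_pos (hmem k hk')]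
    exact hkey (hmem k hk').choose_spec.1 hi ((hmem k hk').choose_spec.2.trans h)
  · have hk : (k : ℕ∞) < (key '' L).encard := lt_trans (by exact_mod_cast hkk) hk'
    dsimp only
    rw [dif_pos (hmem k hk), dif_pos (hmem k' hk'), (hmem k hk).choose_spec.2,
      (hmem k' hk').choose_spec.2]
    exact Nat.nth_lt_nth' hkk ((hsize k').1 hk')

theorem Implementation.Execution.Responds.unique {n : ℕ} {Op Resp : Type}
    {I : Implementation n Op Resp} {a : I.Execution} {i l l' : ℕ} {p : Fin n} {x x' : Resp}
    (h : a.Responds i p l x) (h' : a.Responds i p l' x') : l' = l ∧ x' = x := by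
  rcases lt_trichotomy l l' with hl | rfl | hl
  · exact (h'.2.2.2 l h.1 hl x h.2.2.1).elim
  · have := h'.2.2.1.symm.trans h.2.2.1
    simpa using this
  · exact (h.2.2.2 l' h'.1 hl x' h'.2.2.1).elim

namespace LSnap

open Implementation Execution

variable {n lam m : ℕ} {V : Type}

/-- Every primitive that may change a register is applied by the code of some operation. -/
theorem act_cases (hlam : 0 < lam) (a : (impl n lam m V).Execution) (p : Fin n) (u : ℕ)
    (X : Act (base lam m V)) (hX : ∀ r, X ≠ .read r) (hX' : ∀ r, X ≠ .ll r)
    (h : a.history.act u = some (p, X)) :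
    (∃ i j v, a.During i p (.update j v) u ∧ ((∃ i, SaveSC a.history p i j u X) ∨
      ApplySC a.history p j u X ∨ ProposeSC a.history p j v u X ∧
      ∀ s, i < s → s < u → ∀ x w q, a.history.act s = some (p, .sc (.values j) ⟨x, some w, q⟩) →
        p ∉ a.history.linked s (.values j))) ∨
    ∃ hp : p.val < lam, (∃ x, x < u ∧ X = .write (.sTable ⟨p.val, hp⟩) ⟨seqAt a.history x, true⟩) ∨
      (∃ i, HelpSC a.history p i u X) ∨ SeqSC a.history p u X ∨
      ∃ j, (∃ i, SaveSC a.history p i j u X) ∨ ApplySC a.history p j u X := by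
  obtain ⟨i, o, hp, hd, h⟩ := exists_at h
  cases o with
  | update j v => exact .inl ⟨i, j, v, hd, at_update hlam hX hX' h⟩
  | scan =>
    refine .inr ⟨hp, (at_scan hlam hX hX' h).imp_left ?_⟩
    rintro ⟨x, -, h⟩
    exact ⟨x, h⟩

theorem explained_of_act (hlam : 0 < lam) (a : (impl n lam m V).Execution) (p : Fin n) (u : ℕ)
    (X : Act (base lam m V)) (hX : ∀ r, X ≠ .read r) (hX' : ∀ r, X ≠ .ll r)
    (h : a.history.act u = some (p, X)) : Explained a.history p u X := by
  rcases act_cases hlam a p u X hX hX' h with ⟨i, j, v, -, ⟨i, h⟩ | h | ⟨h, -⟩⟩ |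
    ⟨hp, ⟨x, hx, h⟩ | h | h | ⟨j, ⟨i, h⟩ | h⟩⟩
  · exact .inr (.inr (.inr (.inl ⟨i, j, h⟩)))
  · exact .inr (.inr (.inr (.inr (.inl ⟨j, h⟩))))
  · exact .inr (.inr (.inr (.inr (.inr ⟨j, v, h⟩))))
  · exact .inl ⟨_, x, hx, h⟩
  · exact .inr (.inl h)
  · exact .inr (.inr (.inl h))
  · exact .inr (.inr (.inr (.inl ⟨i, j, h⟩)))
  · exact .inr (.inr (.inr (.inr (.inl ⟨j, h⟩))))

/-- The history of an execution of λ-Snap. -/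
noncomputable def snapHistory (hlam : 0 < lam) (a : (impl n lam m V).Execution) :
    SnapHistory n lam m V where
  toHistory := a.history
  init r := history_mem_zero (a := a) r
  explained p u X := explained_of_act hlam a p u X

/-- Every scanner writes only to its own register. -/
theorem write_sTable (hlam : 0 < lam) {a : (impl n lam m V).Execution} {p : Fin n} {i : Fin lam}
    {u : ℕ} {v : ScanStruct}
    (h : (snapHistory hlam a).act u = some (p, .write (.sTable i) v)) : p.val = i.val := by
  rcases act_cases hlam a p u (.write (.sTable i) v) (by simp) (by simp) h with
    ⟨_, _, _, -, ⟨_, _, _, _, _, _, _, _, _, _, h⟩ |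
      ⟨_, _, _, _, _, _, _, _, _, _, h, _⟩ | ⟨⟨_, _, _, _, _, h⟩, -⟩⟩ |
    ⟨hp, ⟨x, hx, h⟩ | ⟨_, _, _, _, _, _, _, _, h⟩ | ⟨_, _, _, _, _, h⟩ |
      ⟨_, ⟨_, _, _, _, _, _, _, _, _, _, h⟩ | ⟨_, _, _, _, _, _, _, _, _, _, h, _⟩⟩⟩
  iterate 3 simp at h
  · simp only [Act.write.injEq, Reg.sTable.injEq] at h
    rw [h.1]
  all_goals simp at h

theorem lt_len_of_mod (hlam : 0 < lam) {a : (impl n lam m V).Execution} {r : Reg lam m} {u : ℕ}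
    (h : (snapHistory hlam a).Mod r u) : (u : ℕ∞) < a.len := by
  obtain ⟨p, v, ⟨h, -⟩ | h⟩ := h
  · exact lt_len_of_act (a := a) (x := (p, .sc r v)) h
  · exact lt_len_of_act (a := a) (x := (p, .write r v)) h

/-! ### Proposals and the operations that make them -/

/-- Step `π` proposes the value `v` for the component `j` on behalf of the operation of `p` that
is invoked at step `i`. -/
def Proposes (hlam : 0 < lam) (a : (impl n lam m V).Execution) (i : ℕ) (p : Fin n) (j : Fin m)
    (v : V) (π : ℕ) : Prop :=
  a.During i p (.update j v) π ∧ ∃ x s, (snapHistory hlam a).ModBy (.values j) π p ⟨x, some v, s⟩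

theorem exists_proposes (hlam : 0 < lam) {a : (impl n lam m V).Execution} {j : Fin m} {π : ℕ}
    {v : V} (hπ : (snapHistory hlam a).Mod (.values j) π)
    (hv : (valAt (snapHistory hlam a).toHistory j (π + 1)).proposed = some v) :
    ∃ i p, Proposes hlam a i p j v π := by
  obtain ⟨p, ⟨x, w, s⟩, hmod⟩ := hπ
  have hval : valAt (snapHistory hlam a).toHistory j (π + 1) = ⟨x, w, s⟩ :=
    (snapHistory hlam a).mem_of_modBy hmod
  rw [hval] at hv
  obtain rfl : w = some v := hv
  rcases id hmod with ⟨hact, -⟩ | hact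
  · rcases act_cases hlam a p π (.sc (.values j) ⟨x, some v, s⟩) (by simp) (by simp) hact with
    ⟨i, j', v', hd, ⟨_, _, _, _, _, _, _, _, _, _, h⟩ |
      ⟨_, _, _, _, _, _, _, _, _, _, h, _⟩ | ⟨⟨_, _, _, _, _, h⟩, -⟩⟩ |
    ⟨hp, ⟨_, _, h⟩ | ⟨_, _, _, _, _, _, _, _, h⟩ | ⟨_, _, _, _, _, h⟩ |
      ⟨_, ⟨_, _, _, _, _, _, _, _, _, _, h⟩ | ⟨_, _, _, _, _, _, _, _, _, _, h, _⟩⟩⟩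
    · simp at h
    · simp only [Act.sc.injEq, Reg.values.injEq] at h
      obtain ⟨rfl, h⟩ := h
      simp at h
    · simp only [Act.sc.injEq, Reg.values.injEq] at h
      obtain ⟨rfl, h⟩ := h
      simp only [heq_eq_eq, ValueStruct.mk.injEq, Option.some.injEq] at h
      obtain ⟨-, rfl, -⟩ := h
      exact ⟨i, p, hd, x, s, hmod⟩
    iterate 4 simp at h
    simp only [Act.sc.injEq, Reg.values.injEq] at h
    obtain ⟨rfl, h⟩ := h
    simp at h
  · rcases act_cases hlam a p π (.write (.values j) ⟨x, some v, s⟩) (by simp) (by simp) hact with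
    ⟨i, j', v', hd, ⟨_, _, _, _, _, _, _, _, _, _, h⟩ |
      ⟨_, _, _, _, _, _, _, _, _, _, h, _⟩ | ⟨⟨_, _, _, _, _, h⟩, -⟩⟩ |
    ⟨hp, ⟨_, _, h⟩ | ⟨_, _, _, _, _, _, _, _, h⟩ | ⟨_, _, _, _, _, h⟩ |
      ⟨_, ⟨_, _, _, _, _, _, _, _, _, _, h⟩ | ⟨_, _, _, _, _, _, _, _, _, _, h, _⟩⟩⟩
    all_goals simp at h

theorem Proposes.mod {hlam : 0 < lam} {a : (impl n lam m V).Execution} {i : ℕ} {p : Fin n}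
    {j : Fin m} {v : V} {π : ℕ} (h : Proposes hlam a i p j v π) :
    (snapHistory hlam a).Mod (.values j) π := by
  obtain ⟨-, x, s, h⟩ := h
  exact ⟨p, _, h⟩

theorem Proposes.proposed {hlam : 0 < lam} {a : (impl n lam m V).Execution} {i : ℕ} {p : Fin n}
    {j : Fin m} {v : V} {π : ℕ} (h : Proposes hlam a i p j v π) :
    (valAt (snapHistory hlam a).toHistory j (π + 1)).proposed = some v := by
  obtain ⟨-, x, s, h⟩ := h
  exact congrArg ValueStruct.proposed ((snapHistory hlam a).mem_of_modBy h)

theorem Proposes.act {hlam : 0 < lam} {a : (impl n lam m V).Execution} {i : ℕ} {p : Fin n}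
    {j : Fin m} {v : V} {π : ℕ} (h : Proposes hlam a i p j v π) :
    ∃ x s, (snapHistory hlam a).act π = some (p, .sc (.values j) ⟨x, some v, s⟩) ∧
      p ∈ (snapHistory hlam a).linked π (.values j) := by
  obtain ⟨-, x, s, h | h⟩ := h
  · exact ⟨x, s, h⟩
  · rcases (snapHistory hlam a).explained _ _ _ (by simp) (by simp) h with
      ⟨_, _, _, h⟩ | ⟨_, _, _, _, _, _, _, _, h⟩ | ⟨l, h1, h2, h3, h4, h⟩ |
      ⟨_, _, _, _, _, _, _, _, _, _, _, h⟩ | ⟨_, _, _, _, _, _, _, _, _, _, _, h, _⟩ |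
      ⟨_, _, _, _, _, _, _, h⟩
    all_goals simp at h

/-- Of two effective proposals by one operation, the later would contradict the clause in
`at_update` that all previous attempts failed. -/
theorem Proposes.unique {hlam : 0 < lam} {a : (impl n lam m V).Execution} {i : ℕ} {p p' : Fin n}
    {j j' : Fin m} {v v' : V} {π π' : ℕ} (h : Proposes hlam a i p j v π)
    (h' : Proposes hlam a i p' j' v' π') : p' = p ∧ j' = j ∧ v' = v ∧ π' = π := by
  obtain ⟨rfl, ho⟩ := h.1.1.unique h'.1.1
  obtain ⟨rfl, rfl⟩ : j' = j ∧ v' = v := by simpa using ho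
  refine ⟨rfl, rfl, rfl, ?_⟩
  have key : ∀ {π π'}, Proposes hlam a i p' j' v' π → Proposes hlam a i p' j' v' π' →
      ¬ π < π' := by
    intro π π' h h' hlt
    obtain ⟨x, s, hact, hl⟩ := h.act
    obtain ⟨x', s', hact', -⟩ := h'.act
    rcases act_cases hlam a p' π' (.sc (.values j') ⟨x', some v', s'⟩) (by simp) (by simp)
        hact' with
      ⟨i', j'', v'', hd, ⟨_, _, _, _, _, _, _, _, _, _, h1⟩ |
        ⟨_, _, _, _, _, _, _, _, _, _, h1, _⟩ | ⟨⟨_, _, _, _, _, h2⟩, h1⟩⟩ |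
      ⟨hp, ⟨_, _, h1⟩ | ⟨_, _, _, _, _, _, _, _, h1⟩ | ⟨_, _, _, _, _, h1⟩ |
        ⟨_, ⟨_, _, _, _, _, _, _, _, _, _, h1⟩ | ⟨_, _, _, _, _, _, _, _, _, _, h1, _⟩⟩⟩
    · simp at h1
    · simp only [Act.sc.injEq, Reg.values.injEq] at h1
      obtain ⟨rfl, h1⟩ := h1
      simp at h1
    · obtain rfl := h'.1.unique hd
      simp only [Act.sc.injEq, Reg.values.injEq] at h2
      obtain ⟨rfl, -⟩ := h2
      exact h1 π h.1.2.1 hlt x v' s hact hl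
    iterate 4 simp at h1
    simp only [Act.sc.injEq, Reg.values.injEq] at h1
    obtain ⟨rfl, h1⟩ := h1
    simp at h1
  have := key h h'
  have := key h' h
  omega

/-! ### Commit steps and linearization points -/

/-- The step of the execution at which the update that is applied at step `α` takes effect. -/
noncomputable def commit (H : SnapHistory n lam m V) (j : Fin m) (α : ℕ) : ℕ :=
  -- `Applies` does not force `τ` to be unique, so one is fixed by choice; the default `0` is never
  -- used.
  open Classical in if h : ∃ τ, Applies H j α τ then h.choose else 0

theorem applies_commit {H : SnapHistory n lam m V} {j : Fin m} {α : ℕ}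
    (h : ∃ τ, Applies H j α τ) : Applies H j α (commit H j α) := by
  rw [commit, dif_pos h]
  exact h.choose_spec

theorem commit_lt {H : SnapHistory n lam m V} {j : Fin m} {α α' : ℕ}
    (h : ∃ τ, Applies H j α τ) (h' : ∃ τ, Applies H j α' τ) (hlt : α < α') :
    commit H j α < commit H j α' :=
  (applies_commit h).lt.trans ((applies_commit h').lt_of_mod (applies_commit h).1 hlt)

/-- The operation that is invoked at step `i` proposes the value `v` for the component `j`, and this
proposal is applied at step `α`. -/
def Performed (hlam : 0 < lam) (a : (impl n lam m V).Execution) (i : ℕ) (j : Fin m) (v : V)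
    (α : ℕ) : Prop :=
  ∃ p π, Proposes hlam a i p j v π ∧ π < α ∧ (∃ τ, Applies (snapHistory hlam a) j α τ) ∧
    (snapHistory hlam a).Still (.values j) (π + 1) α

theorem Performed.unique {hlam : 0 < lam} {a : (impl n lam m V).Execution} {i : ℕ} {j j' : Fin m}
    {v v' : V} {α α' : ℕ} (h : Performed hlam a i j v α) (h' : Performed hlam a i j' v' α') :
    j' = j ∧ α' = α := by
  obtain ⟨p, π, h1, h2, h3, h4⟩ := h
  obtain ⟨p', π', h1', h2', h3', h4'⟩ := h'
  obtain ⟨rfl, rfl, rfl, rfl⟩ := h1.unique h1'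
  refine ⟨rfl, ?_⟩
  rcases lt_trichotomy α α' with h | h | h
  · exact (h4' α h2 h (applies_commit h3).1).elim
  · exact h.symm
  · exact (h4 α' h2' h (applies_commit h3').1).elim

/-- Both proposals are the last change before `α`, hence the same step, which belongs to one process
and one operation of it. -/
theorem Performed.eq {hlam : 0 < lam} {a : (impl n lam m V).Execution} {i i' : ℕ} {j : Fin m}
    {v v' : V} {α : ℕ} (h : Performed hlam a i j v α) (h' : Performed hlam a i' j v' α) :
    i' = i := by
  obtain ⟨p, π, h1, h2, h3, h4⟩ := h
  obtain ⟨p', π', h1', h2', h3', h4'⟩ := h'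
  obtain rfl : π' = π := by
    rcases lt_trichotomy π π' with h | h | h
    · exact (h4 π' h h2' h1'.mod).elim
    · exact h.symm
    · exact (h4' π h h2 h1.mod).elim
  obtain ⟨x, s, h5, -⟩ := h1.act
  obtain ⟨x', s', h5', -⟩ := h1'.act
  obtain rfl : p = p' := congrArg Prod.fst (Option.some.inj (h5.symm.trans h5'))
  exact h1'.1.unique h1.1

theorem exists_performed (hlam : 0 < lam) {a : (impl n lam m V).Execution} {j : Fin m} {α : ℕ}
    {w : V} (h : ∃ τ, Applies (snapHistory hlam a) j α τ)
    (hw : (valAt (snapHistory hlam a).toHistory j α).proposed = some w) :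
    ∃ i p, a.Invokes i p (.update j w) ∧ Performed hlam a i j w α := by
  have hex : ∃ x, x < α ∧ (snapHistory hlam a).Mod (.values j) x := by
    by_contra! hc
    have h0 : valAt (snapHistory hlam a).toHistory j 0 = ⟨none, none, 0⟩ :=
      (snapHistory hlam a).init (.values j)
    have : valAt (snapHistory hlam a).toHistory j α = valAt (snapHistory hlam a).toHistory j 0 :=
      (snapHistory hlam a).mem_eq (Nat.zero_le α) fun x _ h => hc x h
    rw [this, h0] at hw
    simp at hw
  obtain ⟨x, hx, hm⟩ := hex
  obtain ⟨π, -, h1, h2, h3⟩ := History.exists_last_mod hx hm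
  have eq : valAt (snapHistory hlam a).toHistory j α =
    valAt (snapHistory hlam a).toHistory j (π + 1) := h3.mem_eq h1
  obtain ⟨i, p, h4⟩ := exists_proposes hlam h2 (eq ▸ hw)
  exact ⟨i, p, h4.1.1, p, π, h4, h1, h, h3⟩

/-- The operation that is invoked at step `i` can be linearized at the configuration `pt`. The
number `b` determines the order of the operations that are linearized at the same configuration:
first the overwritten updates, then the update that overwrites them, and then the scans. -/
def LinPoint (hlam : 0 < lam) (a : (impl n lam m V).Execution) (i pt b : ℕ) : Prop :=
  (∃ p j v α, a.Invokes i p (.update j v) ∧ Performed hlam a i j v α ∧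
    pt = commit (snapHistory hlam a) j α + 1 ∧ b = 1) ∨
  (∃ p j v α l r, a.Invokes i p (.update j v) ∧ (∀ j v α, ¬ Performed hlam a i j v α) ∧
    a.Responds i p l r ∧ (∃ τ, Applies (snapHistory hlam a) j α τ) ∧
    i < commit (snapHistory hlam a) j α ∧ α < l ∧
    pt = commit (snapHistory hlam a) j α + 1 ∧ b = 0) ∨
  ∃ p l P view, a.Invokes i p .scan ∧ a.Responds i p l (.view view) ∧ i < P ∧ P < l ∧
    (∀ j, ∃ z, view j = (valAt (snapHistory hlam a).toHistory j z).value ∧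
      ∀ α τ, Applies (snapHistory hlam a) j α τ → (α < z → τ ≤ P) ∧ (z ≤ α → P < τ)) ∧
    pt = P + 1 ∧ b = 2

/-- The alternatives for an update that responds. -/
theorem update_cases (hlam : 0 < lam) {a : (impl n lam m V).Execution} {i l : ℕ} {p : Fin n}
    {j : Fin m} {v : V} {r : SnapResp m V} (hi : a.Invokes i p (.update j v))
    (hr : a.Responds i p l r) : r = .ack ∧
    ((∃ α, α < l ∧ Performed hlam a i j v α) ∨
      (∀ j v α, ¬ Performed hlam a i j v α) ∧
      ∃ α, (∃ τ, Applies (snapHistory hlam a) j α τ) ∧ α < l ∧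
        i < commit (snapHistory hlam a) j α) := by
  obtain ⟨hp, hrun⟩ := hr.run hi
  obtain ⟨h1, h2⟩ := run_update hlam hrun
  refine ⟨h1, ?_⟩
  rcases h2 with ⟨π, h2, h3, h4, h5⟩ | ⟨⟨s, h2, h3⟩, h4⟩
  · left
    have hprop : Proposes hlam a i p j v π := ⟨(hr.during hi).mono h2 h3.le, h5⟩
    obtain ⟨α, h6, h7, h8, h9⟩ := exists_applies (H := snapHistory hlam a)
      (by rw [hprop.proposed]; simp) (Nat.lt_succ_self π) h4
    exact ⟨α, h8, p, π, hprop, h7, h6, h9⟩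
  · right
    refine ⟨?_, ?_⟩
    -- A proposal would be a linked `SC` within the interval of the operation, where all its
    -- proposing `SC`s are known to fail.
    · rintro j' v' α ⟨p', π, h5, -⟩
      obtain ⟨rfl, ho⟩ := h5.1.1.unique hi
      obtain ⟨rfl, rfl⟩ : j = j' ∧ v = v' := by simpa using ho
      obtain ⟨x, s', h6, h7⟩ := h5.act
      refine h4 π h5.1.2.1 ?_ x v s' h6 h7
      by_contra! hc
      rcases hc.eq_or_lt with rfl | hc
      · have := (ev_of_act (a := a) h6).1
        rw [hr.2.2.1] at this
        simp at this
      · exact h5.1.2.2 l hr.1 hc r hr.2.2.1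
    · obtain ⟨α, h5, h6, h7⟩ := exists_applies_of_failedRound (H := snapHistory hlam a) h2 h3
      exact ⟨α, h5, h6, h7 _ (applies_commit h5)⟩

theorem scan_linPoint (hlam : 0 < lam) {a : (impl n lam m V).Execution} {i l : ℕ} {p : Fin n}
    {r : SnapResp m V} (hi : a.Invokes i p .scan) (hr : a.Responds i p l r) :
    ∃ pt, LinPoint hlam a i pt 2 := by
  obtain ⟨hp, hrun⟩ := hr.run hi
  obtain ⟨x, w, s₁, s₂, s₃, h1, h2, h3, h4, h5, h6, h7, h8, view, rfl, h9⟩ := run_scan hlam hrun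
  have hmod : (snapHistory hlam a).ModBy (.sTable ⟨p.val, hp⟩) w p
      ⟨seqAt (snapHistory hlam a).toHistory x, true⟩ := .inr h3
  have hval : tableAt (snapHistory hlam a).toHistory ⟨p.val, hp⟩ (w + 1) =
    ⟨seqAt (snapHistory hlam a).toHistory x, true⟩ := (snapHistory hlam a).mem_of_modBy hmod
  obtain ⟨P, h10, h11, h12, h13, h14⟩ := exists_scan_point (H := snapHistory hlam a) (u := l)
    ⟨p, _, hmod⟩ (by rw [hval]) (fun s h10 h11 p' v h12 => by
      obtain rfl : p' = p := Fin.ext (write_sTable hlam h12)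
      exact h4 s h10 h11 _ _ h12) h5 h6 h7 h8
  refine ⟨P + 1, .inr (.inr ⟨p, l, P, view, hi, hr, by omega, by omega, fun j => ?_, rfl, rfl⟩)⟩
  obtain ⟨c, c', h15, h16, h17⟩ := h9 j
  exact collects_eq (H := snapHistory hlam a) (by omega) h16 h12 h13 h14 h17

theorem exists_linPoint (hlam : 0 < lam) {a : (impl n lam m V).Execution} {i l : ℕ} {p : Fin n}
    {o : SnapOp m V} {r : SnapResp m V} (hi : a.Invokes i p o) (hr : a.Responds i p l r) :
    ∃ pt b, LinPoint hlam a i pt b := by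
  cases o with
  | update j v =>
    obtain ⟨-, ⟨α, -, h1⟩ | ⟨h1, α, h2, h3, h4⟩⟩ := update_cases hlam hi hr
    · exact ⟨_, _, .inl ⟨p, j, v, α, hi, h1, rfl, rfl⟩⟩
    · exact ⟨_, _, .inr (.inl ⟨p, j, v, α, l, r, hi, h1, hr, h2, h4, h3, rfl, rfl⟩)⟩
  | scan =>
    obtain ⟨pt, h⟩ := scan_linPoint hlam hi hr
    exact ⟨pt, 2, h⟩

namespace LinPoint

variable {hlam : 0 < lam} {a : (impl n lam m V).Execution} {i pt b : ℕ}

theorem invokes (h : LinPoint hlam a i pt b) : ∃ p o, a.Invokes i p o := by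
  rcases h with ⟨p, j, v, α, h, -⟩ | ⟨p, j, v, α, l, r, h, -⟩ | ⟨p, l, P, view, h, -⟩
  all_goals exact ⟨_, _, h⟩

theorem after (h : LinPoint hlam a i pt b) : i + 1 ≤ pt := by
  rcases h with ⟨p, j, v, α, -, ⟨p', π, h1, h2, h3, -⟩, rfl, -⟩ |
    ⟨p, j, v, α, l, r, -, -, -, -, h, -, rfl, -⟩ | ⟨p, l, P, view, -, -, h, -, -, rfl, -⟩
  · have := (applies_commit h3).lt_of_mod h1.mod h2
    have := h1.1.2.1
    omega
  · omega
  · omega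

theorem le_len (h : LinPoint hlam a i pt b) : (pt : ℕ∞) ≤ a.len := by
  have key : ∀ {t u : ℕ}, t < u → (u : ℕ∞) < a.len → ((t + 1 : ℕ) : ℕ∞) ≤ a.len :=
    fun htu hu => succ_le (lt_len_of_le htu.le hu)
  rcases h with ⟨p, j, v, α, -, ⟨p', π, h1, h2, h3, -⟩, rfl, -⟩ |
    ⟨p, j, v, α, l, r, -, -, -, h, -, -, rfl, -⟩ | ⟨p, l, P, view, -, hr, -, h, -, rfl, -⟩
  · exact key (applies_commit h3).lt (lt_len_of_mod hlam (applies_commit h3).1)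
  · exact key (applies_commit h).lt (lt_len_of_mod hlam (applies_commit h).1)
  · exact key h hr.2.1

/-- A commit step precedes its application, and `update_cases` provides an application before the
response. By `Performed.unique` this is the one used in the linearization point. -/
theorem before (h : LinPoint hlam a i pt b) {p : Fin n} {l : ℕ} {r : SnapResp m V}
    {o : SnapOp m V} (hi : a.Invokes i p o) (hr : a.Responds i p l r) : pt ≤ l + 1 := by
  rcases h with ⟨p', j, v, α, hi', h, rfl, -⟩ |
    ⟨p', j, v, α, l', r', hi', -, hr', h, -, h', rfl, -⟩ |
    ⟨p', l', P, view, hi', hr', -, h, -, rfl, -⟩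
  · obtain ⟨rfl, rfl⟩ := hi.unique hi'
    obtain ⟨-, ⟨α', h1, h2⟩ | ⟨h1, -⟩⟩ := update_cases hlam hi hr
    · obtain ⟨-, rfl⟩ := h.unique h2
      obtain ⟨-, -, -, -, h3, -⟩ := h
      have := (applies_commit h3).lt
      omega
    · exact (h1 _ _ _ h).elim
  · obtain ⟨rfl, rfl⟩ := hi.unique hi'
    obtain ⟨rfl, -⟩ := hr.unique hr'
    have := (applies_commit h).lt
    omega
  · obtain ⟨rfl, rfl⟩ := hi.unique hi'
    obtain ⟨rfl, -⟩ := hr.unique hr'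
    omega

/-- An update is linearized when it, or the update that overwrites it, takes effect. -/
theorem of_update (h : LinPoint hlam a i pt b) {p : Fin n} {j : Fin m} {v : V}
    (hi : a.Invokes i p (.update j v)) :
    ∃ α, (∃ τ, Applies (snapHistory hlam a) j α τ) ∧ pt = commit (snapHistory hlam a) j α + 1 ∧
      (b = 1 ∧ Performed hlam a i j v α ∨ b = 0) := by
  rcases h with ⟨p', j', v', α, hi', h, h1, h2⟩ |
    ⟨p', j', v', α, l', r', hi', -, hr', h, -, h', h1, h2⟩ |
    ⟨p', l', P, view, hi', -⟩
  · obtain ⟨rfl, ho⟩ := hi.unique hi'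
    obtain ⟨rfl, rfl⟩ : j' = j ∧ v' = v := by simpa using ho
    obtain ⟨-, -, -, -, h3, -⟩ := id h
    exact ⟨α, h3, h1, .inl ⟨h2, h⟩⟩
  · obtain ⟨rfl, ho⟩ := hi.unique hi'
    obtain ⟨rfl, rfl⟩ : j' = j ∧ v' = v := by simpa using ho
    exact ⟨α, h, h1, .inr h2⟩
  · have := (hi.unique hi').2
    simp at this

theorem of_performed (h : LinPoint hlam a i pt b) {p : Fin n} {j : Fin m} {v : V} {α : ℕ}
    (hi : a.Invokes i p (.update j v)) (h' : Performed hlam a i j v α) :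
    pt = commit (snapHistory hlam a) j α + 1 ∧ b = 1 := by
  rcases h with ⟨p', j', v', α', hi', h, h1, h2⟩ |
    ⟨p', j', v', α, l', r', hi', h, -⟩ | ⟨p', l', P, view, hi', -⟩
  · obtain ⟨rfl, rfl⟩ := h.unique h'
    exact ⟨h1, h2⟩
  · exact (h _ _ _ h').elim
  · have := (hi.unique hi').2
    simp at this

theorem of_scan (h : LinPoint hlam a i pt b) {p : Fin n} (hi : a.Invokes i p .scan) {l : ℕ}
    {r : SnapResp m V} (hr : a.Responds i p l r) :
    ∃ P view, r = .view view ∧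
    (∀ j, ∃ z, view j = (valAt (snapHistory hlam a).toHistory j z).value ∧
      ∀ α τ, Applies (snapHistory hlam a) j α τ → (α < z → τ ≤ P) ∧ (z ≤ α → P < τ)) ∧
    pt = P + 1 ∧ b = 2 := by
  rcases h with ⟨p', j', v', α', hi', -⟩ |
    ⟨p', j', v', α, l', r', hi', h, -⟩ | ⟨p', l', P, view, hi', hr', -, -, h, h1, h2⟩
  · have := (hi.unique hi').2
    simp at this
  · have := (hi.unique hi').2
    simp at this
  · obtain ⟨rfl, -⟩ := hi.unique hi'
    obtain ⟨-, rfl⟩ := hr'.unique hr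
    exact ⟨P, view, rfl, h, h1, h2⟩

end LinPoint

/-! ### Construction of the linearization -/

/-- The operation that is invoked at step `i`. -/
def opAt (a : (impl n lam m V).Execution) (i : ℕ) : SnapOp m V :=
  match a.ev i with
  | .invoke _ o => o
  | _ => .scan

theorem opAt_eq {a : (impl n lam m V).Execution} {i : ℕ} {p : Fin n} {o : SnapOp m V}
    (h : a.Invokes i p o) : opAt a i = o := by
  rw [opAt, h.2]

theorem linearizable (hlam : 0 < lam) : (impl n lam m V).Linearizable (snapshot m V) := by
  intro a
  let L : Set ℕ := {i | ∃ x : ℕ × ℕ, LinPoint hlam a i x.1 x.2}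
  have hL : ∀ i, ∃ x : ℕ × ℕ, i ∈ L → LinPoint hlam a i x.1 x.2 := fun i => by
    by_cases h : i ∈ L
    · exact h.imp fun _ h _ => h
    · exact ⟨0, fun h' => (h h').elim⟩
  choose pos hpos using hL
  -- The tie-breaker is at most 2, so the factor 3 encodes the lexicographic order of pairs.
  let rank : ℕ → ℕ := fun i => 3 * (pos i).1 + (pos i).2
  -- Since `i < rank i`, all keys of rank `r` lie below `(r + 1) ^ 2`; the order is by rank, then by
  -- invocation.
  let key : ℕ → ℕ := fun i => rank i ^ 2 + i
  have hlt : ∀ i ∈ L, i < rank i := fun i hi => by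
    have := (hpos i hi).after
    simp only [rank]
    omega
  have key_lt : ∀ i i', i ∈ L → rank i < rank i' → key i < key i' := by
    intro i i' hi h
    have h1 := hlt i hi
    have h2 : (rank i + 1) ^ 2 ≤ rank i' ^ 2 := Nat.pow_le_pow_left h 2
    simp only [key]
    nlinarith
  have rank_le : ∀ i i', i' ∈ L → key i < key i' → rank i ≤ rank i' := by
    intro i i' hi' h
    by_contra! hc
    exact lt_asymm h (key_lt i' i hi' hc)
  have key_inj : Set.InjOn key L := by
    intro i hi i' hi' h
    have h1 : rank i = rank i' := by
      rcases lt_trichotomy (rank i) (rank i') with hc | hc | hc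
      · exact absurd h (key_lt i i' hi hc).ne
      · exact hc
      · exact absurd h (key_lt i' i hi' hc).ne'
    simpa [key, h1] using h
  obtain ⟨size, f, hf1, hf2, hf3⟩ := exists_enumeration L key key_inj
  have le_of_key : ∀ k k' : ℕ, (k : ℕ∞) < size → key (f k) < key (f k') → k < k' := by
    intro k k' hk h
    by_contra! hc
    rcases hc.eq_or_lt with rfl | hc
    · exact lt_irrefl _ h
    · exact lt_asymm h (hf3 k' k hc hk)
  let state : ℕ → Fin m → Option V := fun k =>
    Nat.rec (motive := fun _ => Fin m → Option V) (fun _ => none)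
      (fun k s => ((snapshot m V).apply s (opAt a (f k))).1) k
  have state_succ : ∀ k, state (k + 1) = ((snapshot m V).apply (state k) (opAt a (f k))).1 :=
    fun k => rfl
  have state_eq : ∀ (j : Fin m) (k₀ k : ℕ), k₀ ≤ k →
      (∀ k', k₀ ≤ k' → k' < k → ∀ v, opAt a (f k') ≠ .update j v) → state k j = state k₀ j := by
    intro j k₀ k hk
    induction k, hk using Nat.le_induction with
    | base => exact fun _ => rfl
    | succ k hk ih =>
      intro h
      rw [state_succ, ← ih fun k' h1 h2 => h k' h1 (by omega)]
      have := h k hk (Nat.lt_succ_self k)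
      cases ho : opAt a (f k) with
      | scan => rfl
      | update j' v =>
        have hj : j ≠ j' := by
          rintro rfl
          exact this v ho
        exact Function.update_of_ne hj _ _
  refine ⟨{
    size := size
    inv := f
    state := state
    point := fun k => (pos (f k)).1
    invoked := fun k hk => (hpos _ (hf1 k hk)).invokes
    injective := fun k k' hk hk' h => ?_
    complete := fun t p o l r hi hr => ?_
    state_zero := rfl
    state_succ := fun k _ p o hi => by rw [state_succ, opAt_eq hi]
    response := fun k hk p o hi l r hr => ?_
    after_invocation := fun k hk => (hpos _ (hf1 k hk)).after
    point_le_len := fun k hk => (hpos _ (hf1 k hk)).le_len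
    before_response := fun k hk p o hi l r hr => (hpos _ (hf1 k hk)).before hi hr
    ordered := fun k k' hkk hk' => ?_ }⟩
  · rcases lt_trichotomy k k' with hkk | hkk | hkk
    · exact absurd (congrArg key h) (hf3 k k' hkk hk').ne
    · exact hkk
    · exact absurd (congrArg key h) (hf3 k' k hkk hk).ne'
  · obtain ⟨pt, b, h⟩ := exists_linPoint hlam hi hr
    exact hf2 t ⟨(pt, b), h⟩
  · have hpt := hpos _ (hf1 k hk)
    cases o with
    | update j v => exact (update_cases hlam hi hr).1
    | scan =>
      obtain ⟨P, view, rfl, h1, h2, h3⟩ := hpt.of_scan hi hr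
      refine congrArg SnapResp.view (funext fun j => ?_)
      obtain ⟨z, h4, h5⟩ := h1 j
      have hrank : rank (f k) = 3 * (P + 1) + 2 := by simp only [rank, h2, h3]
      -- Updates of `j` sorted before the `SCAN` belong to applications before `z`: an application
      -- from `z` on commits after `P`, which would give a rank above that of the `SCAN`.
      have upd : ∀ k', k' < k → ∀ v, opAt a (f k') = .update j v →
          (k' : ℕ∞) < size ∧ ∃ α, (∃ τ, Applies (snapHistory hlam a) j α τ) ∧ α < z ∧
          (rank (f k') = 3 * (commit (snapHistory hlam a) j α + 1) + 1 ∧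
            Performed hlam a (f k') j v α ∨
            rank (f k') = 3 * (commit (snapHistory hlam a) j α + 1)) := by
        intro k' hk' v hv
        have hsz : (k' : ℕ∞) < size := lt_trans (by exact_mod_cast hk') hk
        obtain ⟨p', o', hi'⟩ := (hpos _ (hf1 k' hsz)).invokes
        obtain rfl := (opAt_eq hi').symm.trans hv
        obtain ⟨α, h6, h7, h8⟩ := (hpos _ (hf1 k' hsz)).of_update hi'
        refine ⟨hsz, α, h6, ?_, h8.imp (fun h => ⟨by simp only [rank, h7, h.1], h.2⟩)
          fun h => by simp only [rank, h7, h, add_zero]⟩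
        have := rank_le _ _ (hf1 k hk) (hf3 k' k hk' hk)
        have h9 : 3 * (commit (snapHistory hlam a) j α + 1) ≤ rank (f k') := by
          simp only [rank, h7]
          omega
        by_contra! hc
        have := (h5 α _ (applies_commit h6)).2 hc
        omega
      rw [h4]
      rcases value_cases (H := snapHistory hlam a) j z with ⟨h6, h7⟩ |
        ⟨α, τ, w, h6, h7, h8, h9, h10⟩
      · rw [h7]
        refine (state_eq j 0 k (Nat.zero_le k) fun k' _ hk' v hv => ?_).symm
        obtain ⟨-, α, ⟨τ, h8⟩, h9, -⟩ := upd k' hk' v hv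
        exact h6 α τ h8 h9
      -- The value at `z` comes from the last application before `z`; its operation is sorted before
      -- the `SCAN`, and it remains to see that no update of `j` comes in between.
      · obtain ⟨i₀, p₀, hi₀, hperf⟩ := exists_performed hlam ⟨τ, h6⟩ h8
        have hi₀L : i₀ ∈ L := ⟨(_, _), .inl ⟨p₀, j, w, α, hi₀, hperf, rfl, rfl⟩⟩
        obtain ⟨k₀, hk₀, rfl⟩ := hf2 i₀ hi₀L
        obtain ⟨h11, h12⟩ := (hpos _ hi₀L).of_performed hi₀ hperf
        have hrank₀ : rank (f k₀) = 3 * (commit (snapHistory hlam a) j α + 1) + 1 := by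
          simp only [rank, h11, h12]
        have hP := (h5 α _ (applies_commit ⟨τ, h6⟩)).1 h7
        have hk₀k : k₀ < k := le_of_key _ _ hk₀ (key_lt _ _ hi₀L (by omega))
        rw [h9, state_eq j (k₀ + 1) k hk₀k, state_succ, opAt_eq hi₀]
        · exact (Function.update_self j (some w) (state k₀)).symm
        · intro k' hk' hk'k v hv
          obtain ⟨hsz, α', h13, h14, h15⟩ := upd k' hk'k v hv
          have hle := rank_le _ _ (hf1 k' hsz) (hf3 k₀ k' hk' hsz)
          -- With the same application, `k'` is either the same operation or an overwritten update
          -- of smaller rank; with an earlier application, the commit step is earlier. Each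
          -- contradicts the position after `k₀`.
          rcases (h10 α' _ (applies_commit h13) h14).eq_or_lt with rfl | hlt'
          · rcases h15 with ⟨-, h15⟩ | h15
            · have heq := hperf.eq h15
              have := hf3 k₀ k' hk' hsz
              rw [heq] at this
              exact lt_irrefl _ this
            · omega
          · have := commit_lt h13 ⟨τ, h6⟩ hlt'
            omega
  · rcases hkk.eq_or_lt with rfl | hkk
    · exact le_rfl
    · have h1 := rank_le _ _ (hf1 k' hk') (hf3 k k' hkk hk')
      have h2 : ∀ i ∈ L, (pos i).2 ≤ 2 := fun i hi => by
        rcases hpos i hi with ⟨_, _, _, _, _, _, _, h⟩ |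
          ⟨_, _, _, _, _, _, _, _, _, _, _, _, _, h⟩ | ⟨_, _, _, _, _, _, _, _, _, _, h⟩ <;> omega
      have h3 := h2 _ (hf1 k' hk')
      simp only [rank] at h1
      omega

/-! ### Registers and scanners -/

theorem card_reg (hlam : 0 < lam) (hm : 0 < m) :
    ENat.card (Reg lam m) ≤ (40 * lam * m : ℕ) := by
  let code : Reg lam m → Unit ⊕ Fin m ⊕ (Fin lam × Fin m) ⊕ Fin lam := fun r => match r with
    | .seq => .inl ()
    | .values j => .inr (.inl j)
    | .preValues i j => .inr (.inr (.inl (i, j)))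
    | .sTable i => .inr (.inr (.inr i))
  have hcode : Function.Injective code := by
    rintro (_ | _ | _ | _) (_ | _ | _ | _) h <;> simp_all [code]
  refine (ENat.card_le_card_of_injective hcode).trans ?_
  rw [ENat.card_eq_coe_fintype_card]
  simp only [Fintype.card_sum, Fintype.card_prod, Fintype.card_fin, Fintype.card_unit]
  have h1 : lam ≤ lam * m := Nat.le_mul_of_pos_right _ hm
  have h2 : m ≤ lam * m := Nat.le_mul_of_pos_left _ hlam
  rw [Nat.mul_assoc]
  exact_mod_cast (by omega : 1 + (m + (lam * m + lam)) ≤ 40 * (lam * m))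

/-- An active `SCAN` was once invoked, hence by one of the permitted processes. -/
theorem isScanner (hlam : lam ≤ n) : (impl n lam m V).IsScanner lam := by
  have hcard : {p : Fin n | p.val < lam}.encard = lam := by
    have : {p : Fin n | p.val < lam} = Set.range (Fin.castLE hlam) := by
      ext p
      exact ⟨fun h => ⟨⟨p.val, h⟩, rfl⟩, by rintro ⟨q, rfl⟩; exact q.isLt⟩
    rw [this, ← Set.image_univ, (Fin.castLE_injective hlam).encard_image, Set.encard_univ]
    simp
  refine ⟨fun _ _ _ => trivial, hcard, fun a t ht => ?_⟩
  rw [← hcard]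
  refine Set.encard_le_encard ?_
  rintro p ⟨k, hk⟩
  obtain ⟨i, hi⟩ := exists_during ht hk
  exact hi.1.proc.choose

end LSnap

theorem theorem2 :
    ∃ C : ℕ, ∀ (n lam m : ℕ) (V : Type), 0 < lam → lam ≤ n → 0 < m →
      (LSnap.impl n lam m V).WaitFree ∧
      (LSnap.impl n lam m V).Linearizable (snapshot m V) ∧
      (LSnap.impl n lam m V).IsScanner lam ∧
      ENat.card (LSnap.impl n lam m V).base.Reg ≤ C * lam * m ∧
      (∀ (j : Fin m) (v : V), (LSnap.impl n lam m V).stepComplexity (.update j v) ≤ C * lam) ∧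
      (LSnap.impl n lam m V).stepComplexity .scan ≤ C * lam * m := by
  -- A generous common constant: there are at most `4 * lam * m` registers, and an `UPDATE` costs at
  -- most `26 * lam` and a `SCAN` at most `34 * lam * m` accesses.
  refine ⟨40, fun n lam m V hlam hn hm => ⟨?_, LSnap.linearizable hlam, LSnap.isScanner hn, ?_,
    fun j v => ?_, ?_⟩⟩
  · refine Implementation.waitFree_of_costLE fun o => ?_
    cases o with
    | update j v => exact ⟨_, fun _ _ => LSnap.cost_update hlam⟩
    | scan => exact ⟨_, fun _ _ => LSnap.cost_scan hlam hm⟩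
  · exact_mod_cast LSnap.card_reg (lam := lam) (m := m) hlam hm
  · exact_mod_cast Implementation.stepComplexity_le (N := 40 * lam)
      fun _ _ => LSnap.cost_update hlam
  · exact_mod_cast Implementation.stepComplexity_le (N := 40 * lam * m)
      fun _ _ => LSnap.cost_scan hlam hm
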